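/- Fix an integer $N\ge 2$ and an integer $m$ with $0\le m\le N$. Let $R_B=\mathbb{C}[B_1,\dots,B_N]$, graded by $\deg B_k=2k$. A graded matrix factorization over $R_B$ with potential $w$ is a pair of graded free $R_B$-modules $M_0,M_1$ with homogeneous $R_B$-linear maps $M_0\xrightarrow{d_0}M_1\xrightarrow{d_1}M_0$ of degree $N+1$ such that $d_1d_0=w$ and $d_0d_1=w$; morphisms preserve the $\mathbb{Z}/2$-grading and the $\mathbb{Z}$-grading and commute with the differentials; two morphisms $g,g'$ are homotopic if $g-g'=dh+hd$ for an $R_B$-linear map $h$ that is odd and homogeneous of degree $-(N+1)$. Write $\simeq$ for homotopy equivalence and $\cong$ for isomorphism of graded matrix factorizations over $R_B$. $M\langle 1\rangle$ is $M$ with $M_0$ and $M_1$ exchanged, $\langle m\rangle$ is its $m$-fold iterate, $M\{q^k\}$ is $M$ with all degrees raised by $k$, and $M\{\sum_k a_kq^k\}=\bigoplus_k (M\{q^k\})^{\oplus a_k}$ for integers $a_k\ge0$. Put $C_f(\emptyset)=(R_B\to 0\to R_B)$. An alphabet is a finite set of indeterminates of degree $2$, $\mathrm{Sym}(\mathbb{X}|\mathbb{Y})$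 is the ring of complex polynomials in the disjoint alphabets $\mathbb{X},\mathbb{Y}$ that are symmetric in each of them, and for an alphabet $\mathbb{X}$, with power sums $p_k(\mathbb{X})=\sum_{x\in\mathbb{X}}x^k$, let \[ f(\mathbb{X})=p_{N+1}(\mathbb{X})+\sum_{k=1}^N(-1)^{k}\tfrac{N+1}{N+1-k}B_k\,p_{N+1-k}(\mathbb{X}). \] Let $\bigcirc_m$ be the circle colored by $m$ with one marked point, to which an alphabet $\mathbb{X}$ of $m$ indeterminates is assigned. Its matrix factorization is obtained as follows. Let $\mathbb{Y}$ be another alphabet of $m$ indeterminates, and let $X_j,Y_j$ be the $j$-th elementary symmetric polynomials in $\mathbb{X},\mathbb{Y}$. There are homogeneous $U_1,\dots,U_m\in \mathrm{Sym}(\mathbb{X}|\mathbb{Y})\otimes_{\mathbb{C}}R_B$ with $\deg U_j=2N+2-2j$ and $\sum_j U_j(X_j-Y_j)=f(\mathbb{X})-f(\mathbb{Y})$. For any such choice, $C_f(\bigcirc_m)$ is the Koszul matrix factorization with rows $(U_j,\,X_j-Y_j)|_{\mathbb{Y}=\mathbb{X}}$, $j=1,\dots,m$, that is, the tensor product over $A=\mathrm{Sym}(\mathbb{X})\otimes_{\mathbb{C}}R_B$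 of the factorizations \[ A\xrightarrow{\,U_j|_{\mathbb{Y}=\mathbb{X}}\,}A\{q^{N+1-\deg U_j}\}\xrightarrow{\,(X_j-Y_j)|_{\mathbb{Y}=\mathbb{X}}\,}A, \] regarded over $R_B$; it has potential $0$. Let $\mathbb{B}$ be an alphabet of $N$ indeterminates disjoint from $\mathbb{X}$, and identify $R_B$ with $\mathrm{Sym}(\mathbb{B})$ by identifying $B_k$ with the $k$-th elementary symmetric polynomial in $\mathbb{B}$. Define $h_k(\mathbb{X}-\mathbb{B})$ by $\sum_k h_k(\mathbb{X}-\mathbb{B})t^k=\prod_{x\in\mathbb{X}}(1-xt)^{-1}\prod_{b\in\mathbb{B}}(1-bt)$, and let $\mathcal{H}$ be the ideal of $\mathrm{Sym}(\mathbb{X}|\mathbb{B})$ generated by $h_N(\mathbb{X}-\mathbb{B}),h_{N-1}(\mathbb{X}-\mathbb{B}),\dots,h_{N+1-m}(\mathbb{X}-\mathbb{B})$. Then, as graded matrix factorizations over $R_B$ with potential $0$, \[ C_f(\bigcirc_m)\;\simeq\; C_f(\emptyset)\otimes_{R_B}\mathrm{Sym}(\mathbb{X}|\mathbb{B})/\mathcal{H}\;\{q^{-m(N-m)}\}\langle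 m\rangle\;\cong\; C_f(\emptyset)\Big\{\genfrac{[}{]}{0pt}{}{N}{m}\Big\}\langle m\rangle, \] where $\genfrac{[}{]}{0pt}{}{N}{m}=\frac{[N]!}{[m]!\,[N-m]!}$, $[n]!=[1][2]\cdots[n]$ and $[n]=\frac{q^n-q^{-n}}{q-q^{-1}}$. -/

import Mathlib

open scoped LaurentPolynomial TensorProduct

noncomputable section

/-! ## Graded modules and graded matrix factorizations -/

/-- The underlying data of a (two-periodic, graded) matrix factorization over `R`:
`M₀ --d₀--> M₁ --d₁--> M₀`, with families of homogeneous pieces indexed by `ℤ`.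
The axioms are in `MatFact.IsGraded`. -/
structure MatFact (R : Type) [CommRing R] where
  M₀ : Type
  M₁ : Type
  [acg₀ : AddCommGroup M₀]
  [acg₁ : AddCommGroup M₁]
  [mod₀ : Module R M₀]
  [mod₁ : Module R M₁]
  gr₀ : ℤ → AddSubgroup M₀
  gr₁ : ℤ → AddSubgroup M₁
  d₀ : M₀ →ₗ[R] M₁
  d₁ : M₁ →ₗ[R] M₀

attribute [instance] MatFact.acg₀ MatFact.acg₁ MatFact.mod₀ MatFact.mod₁

/-- `M`, with homogeneous pieces `gr`, is a graded free module over the graded ring `(R, 𝒜)`: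
it has a homogeneous basis `b`, `b i` of degree `δ i`, that is `M ≅ ⨁ᵢ R{q^(δ i)}`. -/
def IsGradedFree {R M : Type} [CommRing R] [AddCommGroup M] [Module R M]
    (𝒜 : ℤ → AddSubgroup R) (gr : ℤ → AddSubgroup M) : Prop :=
  ∃ (ι : Type) (b : Module.Basis ι R M) (δ : ι → ℤ),
    ∀ (n : ℤ) (x : M), x ∈ gr n ↔ ∀ i, b.repr x i ∈ 𝒜 (n - δ i)

namespace MatFact

variable {R : Type} [CommRing R]

/-- `M` is a graded matrix factorization over the graded ring `(R, 𝒜)` with potential `w`: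
both modules are graded free, the differentials are homogeneous of degree `N + 1`, and
both composites are multiplication by `w`. -/
structure IsGraded (𝒜 : ℤ → AddSubgroup R) (N : ℕ) (w : R) (M : MatFact R) : Prop where
  free₀ : IsGradedFree 𝒜 M.gr₀
  free₁ : IsGradedFree 𝒜 M.gr₁
  deg_d₀ : ∀ (n : ℤ) (x : M.M₀), x ∈ M.gr₀ n → M.d₀ x ∈ M.gr₁ (n + (N + 1))
  deg_d₁ : ∀ (n : ℤ) (x : M.M₁), x ∈ M.gr₁ n → M.d₁ x ∈ M.gr₀ (n + (N + 1))
  d₁_d₀ : ∀ x, M.d₁ (M.d₀ x) = w • x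
  d₀_d₁ : ∀ x, M.d₀ (M.d₁ x) = w • x

/-- Morphisms of matrix factorizations that preserve the `ℤ/2`-grading and the `ℤ`-grading. -/
structure Hom (M M' : MatFact R) where
  f₀ : M.M₀ →ₗ[R] M'.M₀
  f₁ : M.M₁ →ₗ[R] M'.M₁
  comm₀ : ∀ x, f₁ (M.d₀ x) = M'.d₀ (f₀ x)
  comm₁ : ∀ x, f₀ (M.d₁ x) = M'.d₁ (f₁ x)
  deg₀ : ∀ (n : ℤ) (x : M.M₀), x ∈ M.gr₀ n → f₀ x ∈ M'.gr₀ n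
  deg₁ : ∀ (n : ℤ) (x : M.M₁), x ∈ M.gr₁ n → f₁ x ∈ M'.gr₁ n

/-- The identity morphism. -/
def Hom.id (M : MatFact R) : Hom M M where
  f₀ := LinearMap.id
  f₁ := LinearMap.id
  comm₀ _ := rfl
  comm₁ _ := rfl
  deg₀ _ _ h := h
  deg₁ _ _ h := h

/-- Composition of morphisms, first `f`, then `g`. -/
def Hom.comp {M M' M'' : MatFact R} (g : Hom M' M'') (f : Hom M M') : Hom M M'' where
  f₀ := g.f₀ ∘ₗ f.f₀
  f₁ := g.f₁ ∘ₗ f.f₁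
  comm₀ x := by simp [f.comm₀, g.comm₀]
  comm₁ x := by simp [f.comm₁, g.comm₁]
  deg₀ n x h := g.deg₀ n _ (f.deg₀ n x h)
  deg₁ n x h := g.deg₁ n _ (f.deg₁ n x h)

/-- `f ≃ g`: there is an `R`-linear map `h`, odd for the `ℤ/2`-grading and homogeneous of degree
`-(N + 1)`, with `f - g = d h + h d`. -/
def Homotopic (N : ℕ) {M M' : MatFact R} (f g : Hom M M') : Prop :=
  ∃ (h₀ : M.M₀ →ₗ[R] M'.M₁) (h₁ : M.M₁ →ₗ[R] M'.M₀),
    (∀ (n : ℤ) (x : M.M₀), x ∈ M.gr₀ n → h₀ x ∈ M'.gr₁ (n - (N + 1))) ∧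
    (∀ (n : ℤ) (x : M.M₁), x ∈ M.gr₁ n → h₁ x ∈ M'.gr₀ (n - (N + 1))) ∧
    (∀ x, f.f₀ x - g.f₀ x = M'.d₁ (h₀ x) + h₁ (M.d₀ x)) ∧
    (∀ x, f.f₁ x - g.f₁ x = M'.d₀ (h₁ x) + h₀ (M.d₁ x))

/-- `M` and `M'` are homotopic as graded matrix factorizations over `R`. -/
def HomotopyEquivalent (N : ℕ) (M M' : MatFact R) : Prop :=
  ∃ (φ : Hom M M') (ψ : Hom M' M),
    Homotopic N (ψ.comp φ) (Hom.id M) ∧ Homotopic N (φ.comp ψ) (Hom.id M')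

/-- `M` and `M'` are isomorphic as graded matrix factorizations over `R`. -/
def Isomorphic (M M' : MatFact R) : Prop :=
  ∃ (φ : Hom M M') (ψ : Hom M' M), ψ.comp φ = Hom.id M ∧ φ.comp ψ = Hom.id M'

/-- `M⟨1⟩`: exchange the two `ℤ/2`-degrees. -/
def shift (M : MatFact R) : MatFact R where
  M₀ := M.M₁
  M₁ := M.M₀
  gr₀ := M.gr₁
  gr₁ := M.gr₀
  d₀ := M.d₁
  d₁ := M.d₀

/-- `M⟨k⟩`. -/
def shiftBy (M : MatFact R) (k : ℕ) : MatFact R := shift^[k] M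

/-- `M{q^k}`: an element of degree `n` in `M` has degree `n + k` in `M{q^k}`. -/
def qShift (M : MatFact R) (k : ℤ) : MatFact R where
  M₀ := M.M₀
  M₁ := M.M₁
  gr₀ n := M.gr₀ (n - k)
  gr₁ n := M.gr₁ (n - k)
  d₀ := M.d₀
  d₁ := M.d₁

/-- Finitely supported functions into `M` whose value at `i` is in `gr (n - δ i)`,
that is the degree `n` piece of `⨁ᵢ M{q^(δ i)}`. -/
def directSumGr {ι M : Type} [AddCommGroup M] (gr : ℤ → AddSubgroup M) (δ : ι → ℤ) (n : ℤ) :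
    AddSubgroup (ι →₀ M) where
  carrier := {x | ∀ i, x i ∈ gr (n - δ i)}
  zero_mem' _ := zero_mem _
  add_mem' hx hy i := add_mem (hx i) (hy i)
  neg_mem' hx i := neg_mem (hx i)

/-- `M{F(q)} = ⨁ₖ M{q^k}^(⊕ aₖ)` for a Laurent polynomial `F = ∑ₖ aₖ q^k`, `aₖ ∈ ℕ`. -/
def qSum (M : MatFact R) (F : ℕ[T;T⁻¹]) : MatFact R where
  M₀ := ((k : ℤ) × Fin (F.coeff k)) →₀ M.M₀
  M₁ := ((k : ℤ) × Fin (F.coeff k)) →₀ M.M₁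
  gr₀ := directSumGr M.gr₀ Sigma.fst
  gr₁ := directSumGr M.gr₁ Sigma.fst
  d₀ := Finsupp.mapRange.linearMap M.d₀
  d₁ := Finsupp.mapRange.linearMap M.d₁

/-- The degree `n` piece of `M ⊗ Q`, generated by the `x ⊗ y` with `deg x + deg y = n`. -/
def tensorGr {M Q : Type} [AddCommGroup M] [AddCommGroup Q] [Module R M] [Module R Q]
    (gr : ℤ → AddSubgroup M) (grQ : ℤ → AddSubgroup Q) (n : ℤ) : AddSubgroup (M ⊗[R] Q) :=
  AddSubgroup.closure {z | ∃ i j : ℤ, i + j = n ∧ ∃ x ∈ gr i, ∃ y ∈ grQ j, z = x ⊗ₜ[R] y}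

/-- The tensor product of a matrix factorization with a graded module `Q`. -/
def tensorModule (M : MatFact R) (Q : Type) [AddCommGroup Q] [Module R Q]
    (grQ : ℤ → AddSubgroup Q) : MatFact R where
  M₀ := M.M₀ ⊗[R] Q
  M₁ := M.M₁ ⊗[R] Q
  gr₀ := tensorGr M.gr₀ grQ
  gr₁ := tensorGr M.gr₁ grQ
  d₀ := M.d₀.rTensor Q
  d₁ := M.d₁.rTensor Q

end MatFact

/-! ## Koszul matrix factorizations -/

namespace Koszul

theorem card_symmDiff_singleton {k : ℕ} (s : Finset (Fin k)) (j : Fin k) :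
    Even (symmDiff s {j}).card ↔ Odd s.card := by
  by_cases h : j ∈ s
  · have h1 : symmDiff s {j} = s.erase j := by
      ext x
      simp only [Finset.mem_symmDiff, Finset.mem_singleton, Finset.mem_erase]
      grind
    have h2 := Finset.card_erase_add_one h
    rw [h1, ← h2, Nat.odd_add_one, Nat.not_odd_iff_even]
  · have h1 : symmDiff s {j} = insert j s := by
      ext x
      simp only [Finset.mem_symmDiff, Finset.mem_singleton, Finset.mem_insert]
      grind
    rw [h1, Finset.card_insert_of_notMem h, Nat.even_add_one, Nat.not_even_iff_odd]

/-- `ε ∈ {0,1}^k` is the set of the `j` with `ε j = 1`; flip the `j`-th entry of an odd one. -/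
def flipOdd {k : ℕ} (s : {s : Finset (Fin k) // Odd s.card}) (j : Fin k) :
    {s : Finset (Fin k) // Even s.card} :=
  ⟨symmDiff s.1 {j}, (card_symmDiff_singleton s.1 j).2 s.2⟩

/-- Flip the `j`-th entry of an even `ε`. -/
def flipEven {k : ℕ} (s : {s : Finset (Fin k) // Even s.card}) (j : Fin k) :
    {s : Finset (Fin k) // Odd s.card} :=
  ⟨symmDiff s.1 {j}, by
    rw [← Nat.not_even_iff_odd, card_symmDiff_singleton, Nat.not_odd_iff_even]
    exact s.2⟩

/-- The entry of `d` from `1_(flip j ε)` to `1_ε`, `ε` being given by `s`: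
`(-1)^(ε₁ + ⋯ + ε_(j-1))` times `a j` if `ε j = 1`, times `b j` if `ε j = 0`. -/
def entry {k : ℕ} {A : Type} [CommRing A] (a b : Fin k → A) (s : Finset (Fin k)) (j : Fin k) :
    A :=
  (-1) ^ (s.filter (· < j)).card * (if j ∈ s then a j else b j)

/-- The degree `n` piece of `⨁_ε A · 1_ε`, where `1_ε` has degree `∑_{ε j = 1} (N + 1 - da j)`. -/
def piece {k : ℕ} {A : Type} [CommRing A] (grA : ℤ → AddSubgroup A) (N : ℕ) (da : Fin k → ℤ)
    (P : Finset (Fin k) → Prop) (n : ℤ) : AddSubgroup ({s : Finset (Fin k) // P s} → A) where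
  carrier := {x | ∀ s : {s : Finset (Fin k) // P s}, x s ∈ grA (n - ∑ j ∈ s.1, ((N : ℤ) + 1 - da j))}
  zero_mem' _ := zero_mem _
  add_mem' hx hy s := add_mem (hx s) (hy s)
  neg_mem' hx s := neg_mem (hx s)

end Koszul

open Koszul in
/-- The Koszul matrix factorization over `A` with rows `(a j, b j)`, where `deg (a j) = da j`,
viewed over `R` by restriction of scalars. It is the tensor product over `A` of the factorizations
`A --a j--> A{q^(N+1-da j)} --b j--> A`, written in its basis `1_ε`, `ε ∈ {0,1}^k`:
`d 1_ε = ∑ⱼ (-1)^(ε₁ + ⋯ + ε_(j-1)) c_j 1_(flip j ε)` with `c_j = a j` if `ε j = 0` and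
`c_j = b j` if `ε j = 1`. -/
def koszul (R : Type) {A : Type} [CommRing R] [CommRing A] [Algebra R A]
    (grA : ℤ → AddSubgroup A) (N : ℕ) {k : ℕ} (a b : Fin k → A) (da : Fin k → ℤ) :
    MatFact R where
  M₀ := {s : Finset (Fin k) // Even s.card} → A
  M₁ := {s : Finset (Fin k) // Odd s.card} → A
  gr₀ := piece grA N da (fun s => Even s.card)
  gr₁ := piece grA N da (fun s => Odd s.card)
  d₀ :=
    { toFun := fun x s => ∑ j, entry a b s.1 j * x (flipOdd s j)
      map_add' := fun x y => by
        funext s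
        simp [mul_add, Finset.sum_add_distrib]
      map_smul' := fun r x => by
        funext s
        simp [Finset.smul_sum] }
  d₁ :=
    { toFun := fun x s => ∑ j, entry a b s.1 j * x (flipEven s j)
      map_add' := fun x y => by
        funext s
        simp [mul_add, Finset.sum_add_distrib]
      map_smul' := fun r x => by
        funext s
        simp [Finset.smul_sum] }

/-! ## The base ring and rings of partially symmetric polynomials -/

/-- `R_B = ℂ[B₁, …, B_N]`; the variable `X i` is `B_(i+1)`. -/
abbrev RB (N : ℕ) : Type := MvPolynomial (Fin N) ℂ

/-- The grading of `R_B` with `deg B_k = 2k`. -/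
def RBgr (N : ℕ) (n : ℤ) : AddSubgroup (RB N) :=
  (MvPolynomial.weightedHomogeneousSubmodule ℂ
    (fun i : Fin N => 2 * ((i : ℤ) + 1)) n).toAddSubgroup

/-- The total polynomial grading of `ℂ[σ] ⊗ R_B = R_B[σ]`, where the variables in `σ` have
degree `2`. -/
def totalGr (σ : Type) (N : ℕ) (n : ℤ) : AddSubgroup (MvPolynomial σ (RB N)) where
  carrier := {p | ∀ s : σ →₀ ℕ, p.coeff s ∈ RBgr N (n - 2 * (s.degree : ℤ))}
  zero_mem' s := by simp
  add_mem' hp hq s := by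
    rw [MvPolynomial.coeff_add]
    exact add_mem (hp s) (hq s)
  neg_mem' hp s := by
    rw [MvPolynomial.coeff_neg]
    exact neg_mem (hp s)

/-- `Sym(σ|τ)` with coefficients in `R`: polynomials in the disjoint alphabets `σ`, `τ` that are
symmetric in `σ` and symmetric in `τ`. With coefficients in `R_B` this is `Sym(σ|τ) ⊗_ℂ R_B`. -/
def partSym (σ τ R : Type) [CommRing R] : Subalgebra R (MvPolynomial (σ ⊕ τ) R) where
  carrier := {p | ∀ (e : Equiv.Perm σ) (e' : Equiv.Perm τ),
    MvPolynomial.rename (Equiv.sumCongr e e') p = p}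
  algebraMap_mem' r e e' := MvPolynomial.rename_C _ r
  mul_mem' ha hb e e' := by rw [map_mul, ha e e', hb e e']
  add_mem' ha hb e e' := by rw [map_add, ha e e', hb e e']

/-- A symmetric polynomial in the first alphabet. -/
def symLeft {σ : Type} (τ : Type) {R : Type} [CommRing R] (p : MvPolynomial σ R)
    (hp : p.IsSymmetric) : partSym σ τ R :=
  ⟨MvPolynomial.rename Sum.inl p, fun e e' => by
    rw [MvPolynomial.rename_rename]
    conv_rhs => rw [← hp e, MvPolynomial.rename_rename]
    rfl⟩

/-- A symmetric polynomial in the second alphabet. -/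
def symRight (σ : Type) {τ : Type} {R : Type} [CommRing R] (p : MvPolynomial τ R)
    (hp : p.IsSymmetric) : partSym σ τ R :=
  ⟨MvPolynomial.rename Sum.inr p, fun e e' => by
    rw [MvPolynomial.rename_rename]
    conv_rhs => rw [← hp e', MvPolynomial.rename_rename]
    rfl⟩

/-! ## The matrix factorizations of the empty graph, of an arc and of a circle -/

/-- `C_f(∅) = (R_B → 0 → R_B)`. -/
def CfEmpty (N : ℕ) : MatFact (RB N) where
  M₀ := RB N
  M₁ := PUnit
  gr₀ := RBgr N
  gr₁ := fun _ => ⊤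
  d₀ := 0
  d₁ := 0

/-- `f(𝕏) = p_(N+1)(𝕏) + ∑_{k=1}^N (-1)^k (N+1)/(N+1-k) B_k p_(N+1-k)(𝕏)`, with `k = i + 1`. -/
def potential (σ : Type) [Fintype σ] (N : ℕ) : MvPolynomial σ (RB N) :=
  MvPolynomial.psum σ (RB N) (N + 1) +
    ∑ i : Fin N,
      MvPolynomial.C (MvPolynomial.C ((-1 : ℂ) ^ ((i : ℕ) + 1) * (((N : ℂ) + 1) / ((N : ℂ) - i))) *
        MvPolynomial.X i) * MvPolynomial.psum σ (RB N) (N - i)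

/-- `X_(j+1) - Y_(j+1) ∈ Sym(𝕏|𝕐) ⊗ R_B`, the difference of the elementary symmetric
polynomials of degree `j + 1`. -/
def arcDiff (N m : ℕ) (j : Fin m) : partSym (Fin m) (Fin m) (RB N) :=
  symLeft (Fin m) (MvPolynomial.esymm (Fin m) (RB N) (j + 1))
      (MvPolynomial.esymm_isSymmetric _ _ _) -
    symRight (Fin m) (MvPolynomial.esymm (Fin m) (RB N) (j + 1))
      (MvPolynomial.esymm_isSymmetric _ _ _)

/-- The conditions on the elements `U₁, …, U_m` of `Sym(𝕏|𝕐) ⊗ R_B` in the definition of the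
matrix factorization with rows `(U_j, X_j - Y_j)` of an arc colored by `m` that is marked by `𝕐`
at its entrance and by `𝕏` at its exit: `deg U_j = 2N + 2 - 2j` and
`∑ U_j (X_j - Y_j) = f(𝕏) - f(𝕐)`. -/
structure IsArcChoice (N m : ℕ) (U : Fin m → partSym (Fin m) (Fin m) (RB N)) : Prop where
  deg : ∀ j : Fin m, (U j : MvPolynomial (Fin m ⊕ Fin m) (RB N)) ∈
    totalGr (Fin m ⊕ Fin m) N (2 * (N : ℤ) + 2 - 2 * ((j : ℤ) + 1))
  sum_eq : ((∑ j, U j * arcDiff N m j : partSym (Fin m) (Fin m) (RB N)) :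
      MvPolynomial (Fin m ⊕ Fin m) (RB N)) =
    MvPolynomial.rename Sum.inl (potential (Fin m) N) -
      MvPolynomial.rename Sum.inr (potential (Fin m) N)

/-- The homomorphism `Sym(𝕏|𝕐) ⊗ R_B → Sym(𝕏) ⊗ R_B` that sets `𝕐 = 𝕏`. -/
def glue (N m : ℕ) : partSym (Fin m) (Fin m) (RB N) →ₐ[RB N]
    MvPolynomial.symmetricSubalgebra (Fin m) (RB N) :=
  ((MvPolynomial.rename (Sum.elim id id)).comp (partSym (Fin m) (Fin m) (RB N)).val).codRestrict _
    (fun p e => by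
      conv_rhs => rw [AlgHom.comp_apply, Subalgebra.coe_val, ← p.2 e e]
      rw [AlgHom.comp_apply, Subalgebra.coe_val, MvPolynomial.rename_rename,
        MvPolynomial.rename_rename]
      congr 2
      ext x
      rcases x with x | x <;> rfl)

/-- The total polynomial grading of `Sym(𝕏) ⊗ R_B`. -/
def symGr (N m : ℕ) (n : ℤ) : AddSubgroup (MvPolynomial.symmetricSubalgebra (Fin m) (RB N)) :=
  (totalGr (Fin m) N n).comap
    (MvPolynomial.symmetricSubalgebra (Fin m) (RB N)).val.toRingHom.toAddMonoidHom

/-- `C_f(○_m)` as a matrix factorization over `R_B`, for the circle colored by `m` with a single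
marked point. Cutting the circle at the marked point gives an arc, and gluing the two ends of the
arc back together sets `𝕐 = 𝕏` in the factorization `(U_j, X_j - Y_j)_j` of the arc. -/
def CfCircle (N m : ℕ) (U : Fin m → partSym (Fin m) (Fin m) (RB N)) : MatFact (RB N) :=
  koszul (RB N) (symGr N m) N (fun j => glue N m (U j)) (fun j => glue N m (arcDiff N m j))
    (fun j => 2 * (N : ℤ) + 2 - 2 * ((j : ℤ) + 1))

/-! ## The ring `Sym(𝕏|𝔹)/ℋ` -/

/-- `h_k(𝕏 - 𝔹) = ∑_{j=0}^k (-1)^j e_j(𝔹) h_(k-j)(𝕏)`, the coefficient of `t^k` in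
`∏_{x ∈ 𝕏} (1 - xt)⁻¹ ∏_{b ∈ 𝔹} (1 - bt)`. -/
def hDiff (N m k : ℕ) : partSym (Fin m) (Fin N) ℂ :=
  ∑ j ∈ Finset.range (k + 1), (-1) ^ j *
    symRight (Fin m) (MvPolynomial.esymm (Fin N) ℂ j) (MvPolynomial.esymm_isSymmetric _ _ _) *
    symLeft (Fin N) (MvPolynomial.hsymm (Fin m) ℂ (k - j)) (MvPolynomial.hsymm_isSymmetric _ _ _)

/-- The ideal `ℋ = (h_N(𝕏-𝔹), h_(N-1)(𝕏-𝔹), …, h_(N+1-m)(𝕏-𝔹))` of `Sym(𝕏|𝔹)`. -/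
def idealH (N m : ℕ) : Ideal (partSym (Fin m) (Fin N) ℂ) :=
  Ideal.span (Set.range fun i : Fin m => hDiff N m (N - i))

/-- `Sym(𝕏|𝔹)/ℋ`. -/
def GrassRing (N m : ℕ) : Type := partSym (Fin m) (Fin N) ℂ ⧸ idealH N m

instance (N m : ℕ) : CommRing (GrassRing N m) :=
  inferInstanceAs (CommRing (partSym (Fin m) (Fin N) ℂ ⧸ idealH N m))

/-- The quotient map. -/
def GrassRing.mk (N m : ℕ) : partSym (Fin m) (Fin N) ℂ →+* GrassRing N m :=
  Ideal.Quotient.mk (idealH N m)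

/-- The identification of `R_B` with `Sym(𝔹) ⊆ Sym(𝕏|𝔹)`: `B_k` goes to the `k`-th elementary
symmetric polynomial in `𝔹`. -/
def baseHom (N m : ℕ) : RB N →+* partSym (Fin m) (Fin N) ℂ :=
  (MvPolynomial.aeval (R := ℂ) fun k : Fin N =>
    symRight (Fin m) (MvPolynomial.esymm (Fin N) ℂ (k + 1))
      (MvPolynomial.esymm_isSymmetric _ _ _)).toRingHom

instance (N m : ℕ) : Algebra (RB N) (GrassRing N m) :=
  ((GrassRing.mk N m).comp (baseHom N m)).toAlgebra

/-- The grading of `Sym(𝕏|𝔹)` in which all the indeterminates have degree `2`. -/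
def symXBGr (N m : ℕ) (n : ℤ) : AddSubgroup (partSym (Fin m) (Fin N) ℂ) :=
  (MvPolynomial.weightedHomogeneousSubmodule ℂ
    (fun _ : Fin m ⊕ Fin N => (2 : ℤ)) n).toAddSubgroup.comap
      (partSym (Fin m) (Fin N) ℂ).val.toRingHom.toAddMonoidHom

/-- The induced grading of `Sym(𝕏|𝔹)/ℋ`. -/
def grassGr (N m : ℕ) (n : ℤ) : AddSubgroup (GrassRing N m) :=
  (symXBGr N m n).map (GrassRing.mk N m).toAddMonoidHom

/-! ## Quantum binomial coefficients -/

/-- `[n] = (q^n - q^(-n))/(q - q⁻¹) = q^(n-1) + q^(n-3) + ⋯ + q^(1-n)`. -/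
def qInt (n : ℕ) : ℕ[T;T⁻¹] :=
  ∑ i ∈ Finset.range n, LaurentPolynomial.T ((n : ℤ) - 1 - 2 * i)

/-- `[n]! = [1][2]⋯[n]`. -/
def qFact (n : ℕ) : ℕ[T;T⁻¹] := ∏ i ∈ Finset.range n, qInt (i + 1)

/-- The quantum binomial coefficient `[n]! / ([k]! [n-k]!)`, as a Laurent polynomial with
coefficients in `ℕ`; see `qBinom_mul`. -/
def qBinom : ℕ → ℕ → ℕ[T;T⁻¹]
  | _, 0 => 1
  | 0, _ + 1 => 0
  | n + 1, k + 1 => LaurentPolynomial.T ((k : ℤ) + 1) * qBinom n (k + 1) +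
      LaurentPolynomial.T ((k : ℤ) - n) * qBinom n k

theorem qInt_add (a b : ℕ) : qInt (a + b) =
    LaurentPolynomial.T (b : ℤ) * qInt a + LaurentPolynomial.T (-(a : ℤ)) * qInt b := by
  unfold qInt
  rw [Finset.sum_range_add, Finset.mul_sum, Finset.mul_sum]
  congr 1
  · refine Finset.sum_congr rfl fun i _ => ?_
    rw [← LaurentPolynomial.T_add]
    congr 1
    push_cast
    ring
  · refine Finset.sum_congr rfl fun i _ => ?_
    rw [← LaurentPolynomial.T_add]
    congr 1
    push_cast
    ring

theorem qBinom_eq_zero : ∀ (n k : ℕ), n < k → qBinom n k = 0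
  | 0, k + 1, _ => by simp [qBinom]
  | n + 1, k + 1, h => by
      simp [qBinom, qBinom_eq_zero n k (by omega), qBinom_eq_zero n (k + 1) (by omega)]

theorem qFact_succ (n : ℕ) : qFact (n + 1) = qFact n * qInt (n + 1) :=
  Finset.prod_range_succ _ _

/-- `[n choose k] [k]! [n-k]! = [n]!` for `k ≤ n`, with `n = a + k`. -/
theorem qBinom_mul : ∀ (n a k : ℕ), n = a + k → qBinom n k * qFact k * qFact a = qFact n
  | n, a, 0, h => by
      have h' : n = a := by omega
      cases n <;> simp [qBinom, qFact, ← h']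
  | 0, a, k + 1, h => by omega
  | n + 1, 0, k + 1, h => by
      have hk : n = k := by omega
      subst hk
      have ih := qBinom_mul n 0 n (by omega)
      have h0 : qFact 0 = 1 := by simp [qFact]
      rw [h0, mul_one] at ih ⊢
      rw [qBinom, qBinom_eq_zero n (n + 1) (by omega), mul_zero, zero_add, sub_self,
        LaurentPolynomial.T_zero, one_mul, qFact_succ, ← mul_assoc, ih]
  | n + 1, a + 1, k + 1, h => by
      have ih1 := qBinom_mul n a (k + 1) (by omega)
      have ih2 := qBinom_mul n (a + 1) k (by omega)
      have e : n + 1 = (a + 1) + (k + 1) := h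
      have hn : (k : ℤ) - n = -((a + 1 : ℕ) : ℤ) := by
        push_cast
        omega
      have hadd := qInt_add (a + 1) (k + 1)
      rw [← e] at hadd
      rw [qFact_succ n, hadd, qBinom, hn]
      rw [qFact_succ a] at ih2 ⊢
      rw [qFact_succ k] at ih1 ⊢
      calc _ = LaurentPolynomial.T ((k : ℤ) + 1) * qInt (a + 1) *
              (qBinom n (k + 1) * (qFact k * qInt (k + 1)) * qFact a) +
            LaurentPolynomial.T (-((a + 1 : ℕ) : ℤ)) * qInt (k + 1) *
              (qBinom n k * qFact k * (qFact a * qInt (a + 1))) := by ring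
        _ = _ := by
          rw [ih1, ih2]
          push_cast
          ring

end

/-! Gluing the ends of the arc kills the second column, so the circle is a Koszul factorization over
`A = Sym(𝕏) ⊗ R_B` with rows `(U_j, 0)`. The `U_j` need not be unique before gluing, but they are
determined afterwards: differentiating `∑ U_j (X_j - Y_j) = f(𝕏) - f(𝕐)` with respect to `x_κ` and
setting `𝕐 = 𝕏` gives a linear system whose matrix is the nonsingular Jacobian of the elementary
symmetric polynomials. A computation with generating functions solves it: with `j` counted from 0,
`U_j` becomes `(N + 1) (-1)^j h_(N-j)(𝕏 - 𝔹)` (`glue_arcChoice`).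

The heart is a basis theorem. Let `n = N - m` and let `t_j`, `0 ≤ j < m`, be nonzero constant
multiples of `h_(N-j)(𝕏 - 𝔹)`. Then `A` is free over `R_B` on the `X^α t^β` with `|α| ≤ n` and `β`
arbitrary (`exists_basis_mono`, `exists_basis_polynomial`). Spanning: modulo the `t_j` and `B_k` all
`h_k` with `k > n` vanish, so `1, X_1, …, X_m` satisfies a linear recurrence of order `n`. The
resulting vanishing determinants, of Jacobi-Trudi shape, rewrite products of `n + 1` of the `X_i` by
shorter ones (`prod_mem_of_recurrence`, `span_monomials_eq_top`). An induction on the weight, as in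
the graded Nakayama lemma, lifts this from the quotient (`span_mono_eq_top`). Independence: by the
product formula for Gaussian binomials there are as many `X^α t^β` of each weight as ordinary
monomials (`exists_boxExp_prod_equiv`), and a surjective graded endomorphism with finite-dimensional
pieces is injective (`injective_of_surjective_of_graded`).

On such a basis multiplication by `t_j` raises an exponent, so it has a one-sided inverse `E_j` that
commutes with the other `t_i`. The `E_j` give an explicit homotopy contracting the Koszul
factorization onto a copy of `A/(t)` in the summand of the full subset (`diffAt_homotopyAt_add`,
`diffAt_homotopyAt_univ`). The parity of that subset accounts for `⟨m⟩`, its degree `∑ (N + 1 - deg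
U_j) = -m(N - m)` for the shift in `q`.

Finally `Sym(𝕏|𝔹)` is a polynomial ring over `R_B` as well (`partSymHom_bijective`), so the same
theorem gives `Sym(𝕏|𝔹)/ℋ` the basis `X^α`, `|α| ≤ n`. Equal graded bases identify it with `A/(t)`
and, since the degrees of the `X^α` are counted by the quantum binomial coefficient
(`exists_qBinom_equiv`), with the sum of shifted copies of `R_B`. -/

open scoped LaurentPolynomial TensorProduct

noncomputable section

/-! ## Koszul matrix factorizations with a regular first column -/

namespace Koszul

/-! ### The contracting homotopy on families over all subsets -/

section Homotopy

variable {R A : Type} [CommRing R] [CommRing A] [Algebra R A] {k : ℕ}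

/-- `x ↦ x - a (E x)`, the projection attached to a one-sided inverse `E` of multiplication by
`a`. -/
def proj (a : A) (E : A →ₗ[R] A) : A →ₗ[R] A := LinearMap.id - LinearMap.mulLeft R a ∘ₗ E

theorem proj_apply (a : A) (E : A →ₗ[R] A) (x : A) : proj a E x = x - a * E x := rfl

/-- The composite of the first `j` of the projections `proj (a i) (E i)`. -/
def projBelow (a : Fin k → A) (E : Fin k → A →ₗ[R] A) : ℕ → A →ₗ[R] A
  | 0 => LinearMap.id
  | j + 1 => if h : j < k then proj (a ⟨j, h⟩) (E ⟨j, h⟩) ∘ₗ projBelow a E j else projBelow a E j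

/-- `E j` divides by `a j` from the left and commutes with the other `a i`. -/
structure IsDivision (a : Fin k → A) (E : Fin k → A →ₗ[R] A) : Prop where
  cancel : ∀ j x, E j (a j * x) = x
  comm : ∀ i j x, i ≠ j → E j (a i * x) = a i * E j x

variable {a : Fin k → A} {E : Fin k → A →ₗ[R] A}

theorem projBelow_succ (j : Fin k) (x : A) :
    projBelow a E (j + 1) x = projBelow a E j x - a j * E j (projBelow a E j x) := by
  simp [projBelow, proj_apply]

/-- Only the `E l` with `l < j ≤ i` enter, and these commute with multiplication by `a i`. -/
theorem IsDivision.projBelow_mul_of_le (h : IsDivision a E) (i : Fin k) (x : A) :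
    ∀ j : ℕ, j ≤ i → projBelow a E j (a i * x) = a i * projBelow a E j x
  | 0, _ => rfl
  | j + 1, hj => by
      have hjk : j < k := by omega
      have ih := h.projBelow_mul_of_le i x j (by omega)
      have e := projBelow_succ (a := a) (E := E) ⟨j, hjk⟩
      simp only at e
      rw [e, e, ih, h.comm i ⟨j, hjk⟩ _ (by intro hh; rw [hh] at hj; simp at hj)]
      ring

/-- The `i`-th factor is among those applied and `(1 - a i E i) (a i x) = 0`. Earlier factors let `a
i` pass, and later ones preserve zero. -/
theorem IsDivision.projBelow_mul_of_lt (h : IsDivision a E) (i : Fin k) (x : A) :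
    ∀ j : ℕ, (i : ℕ) < j → projBelow a E j (a i * x) = 0
  | j + 1, hj => by
      by_cases hij : (i : ℕ) = j
      · subst hij
        rw [projBelow_succ, h.projBelow_mul_of_le i x i le_rfl, h.cancel, sub_self]
      · have ih := h.projBelow_mul_of_lt i x j (by omega)
        by_cases hjk : j < k
        · have e := projBelow_succ (a := a) (E := E) ⟨j, hjk⟩
          simp only at e
          rw [e, ih]
          simp
        · simp [projBelow, hjk, ih]

/-- The part of the homotopy that goes to `1_s`, given a family `x` on all subsets. -/
def homotopyAt (a : Fin k → A) (E : Fin k → A →ₗ[R] A) (x : Finset (Fin k) → A)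
    (s : Finset (Fin k)) : A :=
  -- Only the least gap `j` of `s` is filled, from `s ∪ {j}`. All indices below `j` lie in `s`, so
  -- the matching entry of the differential has the sign `(-1) ^ j`.
  if h : (sᶜ).Nonempty then
    (-1) ^ ((sᶜ).min' h : ℕ) * E ((sᶜ).min' h) (projBelow a E ((sᶜ).min' h)
      (x (symmDiff s {(sᶜ).min' h})))
  else 0

theorem homotopyAt_of_min (x : Finset (Fin k) → A) (s : Finset (Fin k)) (j : Fin k)
    (hj : j ∉ s) (hlt : ∀ i < j, i ∈ s) :
    homotopyAt a E x s = (-1) ^ (j : ℕ) * E j (projBelow a E j (x (symmDiff s {j}))) := by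
  have hne : (sᶜ).Nonempty := ⟨j, by simpa using hj⟩
  have hmin : (sᶜ).min' hne = j := by
    apply le_antisymm
    · exact Finset.min'_le _ _ (by simpa using hj)
    · by_contra hlt'
      have := Finset.min'_mem (sᶜ) hne
      rw [Finset.mem_compl] at this
      exact this (hlt _ (not_le.1 hlt'))
  rw [homotopyAt, dif_pos hne, hmin]

theorem homotopyAt_univ (x : Finset (Fin k) → A) : homotopyAt a E x Finset.univ = 0 := by
  simp [homotopyAt]

/-- The differential of the Koszul factorization with rows `(a j, 0)` on families indexed by all
subsets. -/
def diffAt (a : Fin k → A) (x : Finset (Fin k) → A) (s : Finset (Fin k)) : A :=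
  ∑ j, entry a (fun _ => 0) s j * x (symmDiff s {j})

theorem symmDiff_singleton_of_mem {s : Finset (Fin k)} {j : Fin k} (h : j ∈ s) :
    symmDiff s {j} = s.erase j := by
  ext x
  simp only [Finset.mem_symmDiff, Finset.mem_singleton, Finset.mem_erase]
  grind

theorem symmDiff_singleton_of_notMem {s : Finset (Fin k)} {j : Fin k} (h : j ∉ s) :
    symmDiff s {j} = insert j s := by
  ext x
  simp only [Finset.mem_symmDiff, Finset.mem_singleton, Finset.mem_insert]
  grind

theorem card_filter_lt_of_initial {s : Finset (Fin k)} {j : Fin k} (hlt : ∀ i < j, i ∈ s) :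
    (s.filter (· < j)).card = j := by
  have : s.filter (· < j) = Finset.Iio j := by
    ext i
    simp only [Finset.mem_filter, Finset.mem_Iio]
    exact ⟨fun h => h.2, fun h => ⟨hlt i h, h⟩⟩
  rw [this, Fin.card_Iio]

theorem neg_one_pow_mul_self_mul (j : ℕ) (x : A) : (-1 : A) ^ j * ((-1) ^ j * x) = x := by
  rw [← mul_assoc, ← pow_add, ← two_mul, pow_mul]
  simp

/-- The contribution of an index below all gaps telescopes. -/
theorem sum_below (hE : IsDivision a E) (y : A) : ∀ j : ℕ, j ≤ k →
    ∑ i : Fin k, (if (i : ℕ) < j then a i * E i (projBelow a E i y) else 0) =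
      y - projBelow a E j y
  | 0, _ => by simp [projBelow]
  | j + 1, hj => by
      have hjk : j < k := hj
      have e := projBelow_succ (a := a) (E := E) ⟨j, hjk⟩ y
      simp only at e
      rw [e, ← sub_add, ← sum_below hE y j (by omega)]
      have : ∀ i : Fin k, (if (i : ℕ) < j + 1 then a i * E i (projBelow a E i y) else 0) =
          (if (i : ℕ) < j then a i * E i (projBelow a E i y) else 0) +
          (if i = ⟨j, hjk⟩ then a i * E i (projBelow a E i y) else 0) := by
        intro i
        rcases lt_trichotomy (i : ℕ) j with h | h | h
        · have h2 : i ≠ ⟨j, hjk⟩ := by rintro rfl; simp at h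
          simp [h, h2, Nat.lt_succ_of_lt h]
        · have h2 : i = ⟨j, hjk⟩ := Fin.ext h
          simp [h2]
        · have h2 : i ≠ ⟨j, hjk⟩ := by rintro rfl; simp at h
          have h3 : ¬ (i : ℕ) < j + 1 := by omega
          simp [h2, h3, h.le]
      rw [Finset.sum_congr rfl fun i _ => this i, Finset.sum_add_distrib]
      simp

/-- Erasing `i` from the full subset makes `i` its least gap, so the `i`-th term is `a i E i`
applied to the partial projection. These terms telescope by `sum_below`, and what is missing from
`x` is the full projection. -/
theorem diffAt_homotopyAt_univ (hE : IsDivision a E) (x : Finset (Fin k) → A) :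
    diffAt a (homotopyAt a E x) Finset.univ =
      x Finset.univ - projBelow a E k (x Finset.univ) := by
  rw [← sum_below hE _ k le_rfl, diffAt]
  refine Finset.sum_congr rfl fun i _ => ?_
  have h1 : symmDiff (Finset.univ : Finset (Fin k)) {i} = Finset.univ.erase i :=
    symmDiff_singleton_of_mem (Finset.mem_univ i)
  rw [h1, homotopyAt_of_min _ _ i (by simp) (fun l hl => by simp [hl.ne]), entry,
    card_filter_lt_of_initial (fun _ _ => Finset.mem_univ _),
    symmDiff_singleton_of_notMem (by simp), Finset.insert_erase (Finset.mem_univ i)]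
  simp only [Finset.mem_univ, if_true, i.2]
  rw [mul_right_comm, neg_one_pow_mul_self_mul, mul_comm]

/-- Above the least gap `j`, both `E j` and the partial projection commute with `a i`, so the two
terms agree up to sign. The signs are opposite because adding `j` to `s` puts one more element below
`i`. -/
theorem entry_mul_homotopyAt_erase_of_gt (hE : IsDivision a E) (x : Finset (Fin k) → A)
    {s : Finset (Fin k)} {i j : Fin k} (hj : j ∉ s) (hlt : ∀ i < j, i ∈ s) (hi : i ∈ s)
    (hij : j < i) :
    entry a (fun _ => 0) s i * homotopyAt a E x (symmDiff s {i}) +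
      (-1) ^ (j : ℕ) * E j (projBelow a E j (entry a (fun _ => 0) (symmDiff s {j}) i *
        x (symmDiff (symmDiff s {j}) {i}))) = 0 := by
  have hi' : i ∈ insert j s := Finset.mem_insert_of_mem hi
  have h1 : (insert j s).filter (· < i) = insert j (s.filter (· < i)) := by
    rw [Finset.filter_insert, if_pos hij]
  rw [homotopyAt_of_min x _ j, symmDiff_right_comm, symmDiff_singleton_of_notMem hj]
  · rw [entry, entry, if_pos hi, if_pos hi', h1, Finset.card_insert_of_notMem (by simp [hj])]
    set y := x (symmDiff (insert j s) {i})
    -- The sign is written as an integer scalar, which every additive map lets pass.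
    have e : (-1 : A) ^ ((s.filter (· < i)).card + 1) * a i * y =
        a i * ((-1 : ℤ) ^ ((s.filter (· < i)).card + 1) • y) := by
      simp only [zsmul_eq_mul]
      push_cast
      ring
    rw [e, hE.projBelow_mul_of_le i _ j hij.le, hE.comm i j _ hij.ne', map_zsmul, map_zsmul]
    simp only [zsmul_eq_mul]
    push_cast
    ring
  · rw [symmDiff_singleton_of_mem hi]
    simp [hj]
  · intro l hl
    rw [symmDiff_singleton_of_mem hi, Finset.mem_erase]
    exact ⟨(hl.trans hij).ne, hlt l hl⟩

/-- Let `j` be the least gap of `s` and `P_j` the partial projection below it. Indices `i < j`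
contribute `a i E i P_i x` through `d h` and nothing through `h d`, as `P_j` kills multiples of `a
i`. The index `j` contributes `E j (a j P_j x) = P_j x` through `h d`, and indices above `j` cancel.
The first group telescopes to `x - P_j x`. -/
theorem diffAt_homotopyAt_add (hE : IsDivision a E) (x : Finset (Fin k) → A)
    (s : Finset (Fin k)) (hs : s ≠ Finset.univ) :
    diffAt a (homotopyAt a E x) s + homotopyAt a E (diffAt a x) s = x s := by
  have hne : (sᶜ).Nonempty := by
    rw [Finset.nonempty_iff_ne_empty, Ne, Finset.compl_eq_empty_iff]
    exact hs
  obtain ⟨j, hj, hlt⟩ : ∃ j, j ∉ s ∧ ∀ i < j, i ∈ s := by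
    refine ⟨(sᶜ).min' hne, by simpa using Finset.min'_mem _ hne, fun i hi => ?_⟩
    by_contra h
    exact absurd (Finset.min'_le (sᶜ) i (by simpa using h)) (not_le.2 hi)
  rw [homotopyAt_of_min _ s j hj hlt, diffAt, diffAt, map_sum, map_sum, Finset.mul_sum,
    ← Finset.sum_add_distrib]
  have key : ∀ i : Fin k, entry a (fun _ => 0) s i * homotopyAt a E x (symmDiff s {i}) +
      (-1) ^ (j : ℕ) * E j (projBelow a E j (entry a (fun _ => 0) (symmDiff s {j}) i *
        x (symmDiff (symmDiff s {j}) {i}))) =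
      (if (i : ℕ) < j then a i * E i (projBelow a E i (x s)) else 0) +
        (if i = j then projBelow a E j (x s) else 0) := by
    intro i
    rcases lt_trichotomy i j with h | h | h
    · have his : i ∈ s := hlt i h
      have hlt' : ∀ l < i, l ∈ s := fun l hl => hlt l (hl.trans h)
      have hij : i ∈ insert j s := Finset.mem_insert_of_mem his
      have h2 : (i : ℕ) < j := h
      rw [if_pos h2, if_neg h.ne, add_zero, symmDiff_singleton_of_notMem hj, entry, entry,
        if_pos his, if_pos hij, card_filter_lt_of_initial hlt',
        homotopyAt_of_min x _ i (by rw [symmDiff_singleton_of_mem his]; simp)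
          (fun l hl => by
            rw [symmDiff_singleton_of_mem his, Finset.mem_erase]; exact ⟨hl.ne, hlt' l hl⟩),
        symmDiff_symmDiff_cancel_right, mul_comm _ (a i), mul_comm _ (a i), mul_assoc (a i),
        mul_assoc (a i), hE.projBelow_mul_of_lt i _ j h2, map_zero, mul_zero, add_zero,
        neg_one_pow_mul_self_mul]
    · subst h
      rw [if_neg (lt_irrefl _), if_pos rfl, zero_add, symmDiff_symmDiff_cancel_right,
        symmDiff_singleton_of_notMem hj, entry, entry, if_neg hj,
        if_pos (Finset.mem_insert_self i s),
        card_filter_lt_of_initial (fun l hl => Finset.mem_insert_of_mem (hlt l hl)),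
        mul_zero, zero_mul, zero_add]
      have e : (-1 : A) ^ (i : ℕ) * a i * x s = a i * ((-1 : ℤ) ^ (i : ℕ) • x s) := by
        simp only [zsmul_eq_mul]
        push_cast
        ring
      rw [e, hE.projBelow_mul_of_le i _ i le_rfl, hE.cancel, map_zsmul, zsmul_eq_mul]
      push_cast
      rw [neg_one_pow_mul_self_mul]
    · have h2 : ¬ (i : ℕ) < j := by
        rw [not_lt]
        exact h.le
      rw [if_neg h2, if_neg h.ne', add_zero]
      by_cases hi : i ∈ s
      · exact entry_mul_homotopyAt_erase_of_gt hE x hj hlt hi h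
      · have hi' : i ∉ insert j s := by simp [hi, h.ne']
        rw [symmDiff_singleton_of_notMem hj, entry, entry, if_neg hi, if_neg hi']
        simp
  rw [Finset.sum_congr rfl fun i _ => key i, Finset.sum_add_distrib,
    sum_below hE _ j j.2.le]
  simp

end Homotopy

/-! ### Even and odd subsets, homogeneity, and the summand of the full subset -/

section Factorization

variable {R A : Type} [CommRing R] [CommRing A] [Algebra R A] {k : ℕ}
  {a : Fin k → A} {E : Fin k → A →ₗ[R] A}

/-- Extension by zero of a family on the subsets satisfying `P`. -/
def extend (P : Finset (Fin k) → Prop) (x : {s // P s} → A) (s : Finset (Fin k)) : A :=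
  open Classical in if h : P s then x ⟨s, h⟩ else 0

theorem extend_of {P : Finset (Fin k) → Prop} (x : {s // P s} → A) {s : Finset (Fin k)}
    (h : P s) : extend P x s = x ⟨s, h⟩ := by
  rw [extend, dif_pos h]

theorem extend_add {P : Finset (Fin k) → Prop} (x y : {s // P s} → A) :
    extend P (x + y) = extend P x + extend P y := by
  funext s
  by_cases h : P s <;> simp [extend, h]

theorem extend_smul {P : Finset (Fin k) → Prop} (r : R) (x : {s // P s} → A) :
    extend P (r • x) = r • extend P x := by
  funext s
  by_cases h : P s <;> simp [extend, h]

theorem homotopyAt_add (x y : Finset (Fin k) → A) (s : Finset (Fin k)) :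
    homotopyAt a E (x + y) s = homotopyAt a E x s + homotopyAt a E y s := by
  by_cases h : (sᶜ).Nonempty <;> simp [homotopyAt, h, mul_add]

theorem homotopyAt_smul (r : R) (x : Finset (Fin k) → A) (s : Finset (Fin k)) :
    homotopyAt a E (r • x) s = r • homotopyAt a E x s := by
  by_cases h : (sᶜ).Nonempty <;> simp [homotopyAt, h]

theorem homotopyAt_congr {x y : Finset (Fin k) → A} {s : Finset (Fin k)}
    (h : ∀ j, x (symmDiff s {j}) = y (symmDiff s {j})) :
    homotopyAt a E x s = homotopyAt a E y s := by
  simp only [homotopyAt, h]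

/-- The homotopy as a map between families on subsets satisfying `P` and `P'`. -/
def homotopyMap (a : Fin k → A) (E : Fin k → A →ₗ[R] A) (P P' : Finset (Fin k) → Prop) :
    ({s // P s} → A) →ₗ[R] ({s // P' s} → A) where
  toFun x s := homotopyAt a E (extend P x) s.1
  map_add' x y := by
    funext s
    rw [extend_add, homotopyAt_add]
    rfl
  map_smul' r x := by
    funext s
    rw [extend_smul, homotopyAt_smul]
    rfl

/-- The homogeneity conditions on the rows of a Koszul factorization and on divisions by them. -/
structure IsHomogeneousDivision (grA : ℤ → AddSubgroup A) (da : Fin k → ℤ) (a : Fin k → A)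
    (E : Fin k → A →ₗ[R] A) : Prop extends IsDivision a E where
  mul_mem : ∀ j n x, x ∈ grA n → a j * x ∈ grA (n + da j)
  div_mem : ∀ j n x, x ∈ grA n → E j x ∈ grA (n - da j)

theorem neg_one_pow_mul_mem {G : AddSubgroup A} (j : ℕ) {x : A} (hx : x ∈ G) :
    (-1) ^ j * x ∈ G := by
  rcases neg_one_pow_eq_or A j with h | h <;> rw [h]
  · rwa [one_mul]
  · rw [neg_one_mul]
    exact neg_mem hx

variable {grA : ℤ → AddSubgroup A} {da : Fin k → ℤ}

theorem IsHomogeneousDivision.projBelow_mem (h : IsHomogeneousDivision grA da a E) (n : ℤ)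
    (x : A) (hx : x ∈ grA n) : ∀ j : ℕ, projBelow a E j x ∈ grA n
  | 0 => hx
  | j + 1 => by
      have ih := h.projBelow_mem n x hx j
      by_cases hj : j < k
      · have e := projBelow_succ (a := a) (E := E) ⟨j, hj⟩ x
        simp only at e
        rw [e]
        refine sub_mem ih ?_
        have := h.mul_mem ⟨j, hj⟩ _ _ (h.div_mem ⟨j, hj⟩ _ _ ih)
        rwa [sub_add_cancel] at this
      · simpa [projBelow, hj] using ih

theorem extend_mem {P : Finset (Fin k) → Prop} {N : ℕ} {n : ℤ} {x : {s // P s} → A}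
    (hx : x ∈ piece grA N da P n) (s : Finset (Fin k)) :
    extend P x s ∈ grA (n - ∑ j ∈ s, ((N : ℤ) + 1 - da j)) := by
  by_cases h : P s
  · rw [extend_of x h]
    exact hx ⟨s, h⟩
  · rw [extend, dif_neg h]
    exact zero_mem _

theorem IsHomogeneousDivision.homotopyMap_mem (h : IsHomogeneousDivision grA da a E)
    (P P' : Finset (Fin k) → Prop) (N : ℕ) (n : ℤ) (x : {s // P s} → A)
    (hx : x ∈ piece grA N da P n) :
    homotopyMap a E P P' x ∈ piece grA N da P' (n - (N + 1)) := by
  intro s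
  change homotopyAt a E _ _ ∈ _
  by_cases hne : (s.1ᶜ).Nonempty
  · rw [homotopyAt, dif_pos hne]
    set j := (s.1ᶜ).min' hne
    have hj : j ∉ s.1 := by simpa using Finset.min'_mem _ hne
    refine neg_one_pow_mul_mem _ ?_
    have := h.div_mem j _ _ (h.projBelow_mem _ _ (extend_mem hx (symmDiff s.1 {j})) j)
    rw [symmDiff_singleton_of_notMem hj, Finset.sum_insert hj] at this
    rw [symmDiff_singleton_of_notMem hj]
    convert this using 2
    ring
  · rw [homotopyAt, dif_neg hne]
    exact zero_mem _

theorem IsHomogeneousDivision.diffAt_mem (h : IsHomogeneousDivision grA da a E)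
    {N : ℕ} {n : ℤ} {x : Finset (Fin k) → A}
    (hx : ∀ s, x s ∈ grA (n - ∑ j ∈ s, ((N : ℤ) + 1 - da j))) (s : Finset (Fin k)) :
    diffAt a x s ∈ grA (n + (N + 1) - ∑ j ∈ s, ((N : ℤ) + 1 - da j)) := by
  refine sum_mem fun j _ => ?_
  rw [entry, mul_assoc]
  refine neg_one_pow_mul_mem _ ?_
  by_cases hj : j ∈ s
  · rw [if_pos hj]
    have := h.mul_mem j _ _ (hx (symmDiff s {j}))
    rw [symmDiff_singleton_of_mem hj] at this ⊢
    convert this using 2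
    rw [← Finset.add_sum_erase s _ hj]
    ring
  · rw [if_neg hj, zero_mul]
    exact zero_mem _

theorem diffAt_congr {x y : Finset (Fin k) → A} {s : Finset (Fin k)}
    (h : ∀ j, x (symmDiff s {j}) = y (symmDiff s {j})) : diffAt a x s = diffAt a y s := by
  simp only [diffAt, h]

theorem diffAt_add (x y : Finset (Fin k) → A) (s : Finset (Fin k)) :
    diffAt a (x + y) s = diffAt a x s + diffAt a y s := by
  simp [diffAt, mul_add, Finset.sum_add_distrib]

theorem diffAt_smul (r : R) (x : Finset (Fin k) → A) (s : Finset (Fin k)) :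
    diffAt a (r • x) s = r • diffAt a x s := by
  simp [diffAt, Finset.smul_sum]

/-- The differential as a map between families on subsets satisfying `P` and `P'`. -/
def diffMap (R : Type) {A : Type} [CommRing R] [CommRing A] [Algebra R A] (a : Fin k → A)
    (P P' : Finset (Fin k) → Prop) : ({s // P s} → A) →ₗ[R] ({s // P' s} → A) where
  toFun x s := diffAt a (extend P x) s.1
  map_add' x y := by
    funext s
    rw [extend_add, diffAt_add]
    rfl
  map_smul' r x := by
    funext s
    rw [extend_smul, diffAt_smul]
    rfl

/-- Flips at distinct `i`, `j` in `s` cancel in pairs: removing the smaller index changes the sign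
attached to the larger one, but not conversely. If `i = j`, or if one of them lies outside `s`, an
entry of the zero column occurs. -/
theorem diffAt_diffAt (x : Finset (Fin k) → A) (s : Finset (Fin k)) :
    diffAt a (diffAt a x) s = 0 := by
  simp only [diffAt, Finset.mul_sum]
  rw [← Finset.sum_product']
  refine Finset.sum_involution (fun p _ => (p.2, p.1)) ?_ ?_ (by simp) (by simp)
  · rintro ⟨i, j⟩ -
    simp only
    rw [symmDiff_right_comm s {j} {i}]
    by_cases hij : i = j
    · subst hij
      by_cases hi : i ∈ s <;> simp [entry, Finset.mem_symmDiff, hi]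
    by_cases hi : i ∈ s
    swap
    · simp [entry, Finset.mem_symmDiff, hi, hij]
    by_cases hj : j ∈ s
    swap
    · simp [entry, Finset.mem_symmDiff, hj, Ne.symm hij]
    have e : ∀ {i j : Fin k}, i ∈ s → j ∈ s → i < j →
        entry a (fun _ => 0) s i * entry a (fun _ => 0) (symmDiff s {i}) j +
        entry a (fun _ => 0) s j * entry a (fun _ => 0) (symmDiff s {j}) i = 0 := by
      intro i j hi hj h
      rw [symmDiff_singleton_of_mem hi, symmDiff_singleton_of_mem hj]
      have h1 : (s.erase j).filter (· < i) = s.filter (· < i) := by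
        rw [Finset.filter_erase, Finset.erase_eq_of_notMem]
        simp [h.le]
      have h2 : ((s.erase i).filter (· < j)).card + 1 = (s.filter (· < j)).card := by
        rw [Finset.filter_erase, Finset.card_erase_add_one]
        simp [hi, h]
      simp only [entry, h1, ← h2, Finset.mem_erase, hi, hj, h.ne, h.ne', ne_eq, not_false_eq_true,
        and_self, if_true]
      ring
    rw [← mul_assoc, ← mul_assoc, ← add_mul]
    rcases lt_or_gt_of_ne hij with h | h
    · rw [e hi hj h, zero_mul]
    · rw [add_comm, e hj hi h, zero_mul]
  · rintro ⟨i, j⟩ - h heq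
    simp only [Prod.mk.injEq] at heq
    obtain ⟨rfl, -⟩ := heq
    apply h
    by_cases hi : j ∈ s <;> simp [entry, Finset.mem_symmDiff, hi]

/-- Extension by zero loses nothing: the value at `s` uses the inner map only at subsets one flip
away from `s`, and these satisfy `P'`. The same remark transfers the homotopy identities below. -/
theorem diffMap_diffMap {P P' : Finset (Fin k) → Prop}
    (hP : ∀ s j, P s → P' (symmDiff s {j})) (x : {s // P s} → A) :
    diffMap R a P' P (diffMap R a P P' x) = 0 := by
  funext s
  rw [Pi.zero_apply, ← diffAt_diffAt (a := a) (extend P x) s.1]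
  exact diffAt_congr fun j => extend_of _ (hP s.1 j s.2)

theorem diffMap_homotopyMap_add (hE : IsDivision a E) {P P' : Finset (Fin k) → Prop}
    (hP : ∀ s j, P s → P' (symmDiff s {j})) (x : {s // P s} → A) (s : {s // P s})
    (hs : s.1 ≠ Finset.univ) :
    diffMap R a P' P (homotopyMap a E P P' x) s + homotopyMap a E P' P (diffMap R a P P' x) s =
      x s := by
  have h := diffAt_homotopyAt_add hE (extend P x) s.1 hs
  rw [extend_of x s.2] at h
  refine Eq.trans (congrArg₂ _ ?_ ?_) h
  · exact diffAt_congr fun j => extend_of _ (hP s.1 j s.2)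
  · exact homotopyAt_congr fun j => extend_of _ (hP s.1 j s.2)

theorem diffMap_homotopyMap_add_univ (hE : IsDivision a E) {P P' : Finset (Fin k) → Prop}
    (hP : ∀ s j, P s → P' (symmDiff s {j})) (x : {s // P s} → A) (hs : P Finset.univ) :
    diffMap R a P' P (homotopyMap a E P P' x) ⟨Finset.univ, hs⟩ +
      homotopyMap a E P' P (diffMap R a P P' x) ⟨Finset.univ, hs⟩ =
      x ⟨Finset.univ, hs⟩ - projBelow a E k (x ⟨Finset.univ, hs⟩) := by
  have h := diffAt_homotopyAt_univ hE (extend P x)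
  rw [extend_of x hs] at h
  rw [← h]
  refine Eq.trans (congrArg₂ _ ?_ ?_) (add_zero _)
  · exact diffAt_congr fun j => extend_of _ (hP _ j hs)
  · exact homotopyAt_univ _

theorem koszul_d₀ (N : ℕ) : (koszul R grA N a (fun _ => 0) da).d₀ =
    diffMap R a (fun s => Even s.card) (fun s => Odd s.card) := by
  refine LinearMap.ext fun x => funext fun s => ?_
  change ∑ j, entry a (fun _ => 0) s.1 j * x (flipOdd s j) =
    ∑ j, entry a (fun _ => 0) s.1 j * extend (fun s => Even s.card) x (symmDiff s.1 {j})
  exact Finset.sum_congr rfl fun j _ => congrArg _ (extend_of x (flipOdd s j).2).symm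

theorem koszul_d₁ (N : ℕ) : (koszul R grA N a (fun _ => 0) da).d₁ =
    diffMap R a (fun s => Odd s.card) (fun s => Even s.card) := by
  refine LinearMap.ext fun x => funext fun s => ?_
  change ∑ j, entry a (fun _ => 0) s.1 j * x (flipEven s j) =
    ∑ j, entry a (fun _ => 0) s.1 j * extend (fun s => Odd s.card) x (symmDiff s.1 {j})
  exact Finset.sum_congr rfl fun j _ => congrArg _ (extend_of x (flipEven s j).2).symm

theorem odd_of_even {s : Finset (Fin k)} (j : Fin k) (h : Even s.card) :
    Odd (symmDiff s {j}).card := (flipEven ⟨s, h⟩ j).2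

theorem even_of_odd {s : Finset (Fin k)} (j : Fin k) (h : Odd s.card) :
    Even (symmDiff s {j}).card := (flipOdd ⟨s, h⟩ j).2

theorem diffMap_mem {P P' : Finset (Fin k) → Prop} (h : IsHomogeneousDivision grA da a E)
    {N : ℕ} {n : ℤ} {x : {s // P s} → A} (hx : x ∈ piece grA N da P n) :
    diffMap R a P P' x ∈ piece grA N da P' (n + (N + 1)) :=
  fun s => h.diffAt_mem (extend_mem hx) s.1

/-- Evaluation at the full subset, followed by `π`. -/
def topMap {Q : Type} [AddCommGroup Q] [Module R Q] (π : A →ₗ[R] Q)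
    (P : Finset (Fin k) → Prop) (hP : P Finset.univ) : ({s // P s} → A) →ₗ[R] Q :=
  π ∘ₗ LinearMap.proj ⟨Finset.univ, hP⟩

/-- `ι` followed by the inclusion of the summand of the full subset. -/
def topInclusion {Q : Type} [AddCommGroup Q] [Module R Q] (ι : Q →ₗ[R] A)
    (P : Finset (Fin k) → Prop) : Q →ₗ[R] ({s // P s} → A) :=
  LinearMap.pi fun s => open Classical in if s.1 = Finset.univ then ι else 0

theorem topMap_diffMap {Q : Type} [AddCommGroup Q] [Module R Q] {π : A →ₗ[R] Q}
    (hπ : ∀ j x, π (a j * x) = 0) {P P' : Finset (Fin k) → Prop} (hP' : P' Finset.univ)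
    (x : {s // P s} → A) : topMap π P' hP' (diffMap R a P P' x) = 0 := by
  change π (diffAt a _ Finset.univ) = 0
  rw [diffAt, map_sum]
  refine Finset.sum_eq_zero fun j _ => ?_
  rw [entry, if_pos (Finset.mem_univ j), mul_comm _ (a j), mul_assoc, hπ]

/-- An arrow out of the full subset ends at a subset that misses the flipped index `j`, so its entry
belongs to the zero second column. -/
theorem diffMap_topInclusion {Q : Type} [AddCommGroup Q] [Module R Q] (ι : Q →ₗ[R] A)
    (P P' : Finset (Fin k) → Prop) (x : Q) : diffMap R a P P' (topInclusion ι P x) = 0 := by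
  funext s
  change diffAt a _ _ = 0
  refine Finset.sum_eq_zero fun j _ => ?_
  by_cases hj : j ∈ s.1
  · have : symmDiff s.1 {j} ≠ Finset.univ := by
      rw [symmDiff_singleton_of_mem hj]
      intro h
      have := Finset.mem_univ j
      rw [← h] at this
      simp at this
    by_cases hP : P (symmDiff s.1 {j})
    · rw [extend_of _ hP]
      simp [topInclusion, this]
    · rw [extend, dif_neg hP, mul_zero]
  · simp [entry, hj]

/-- Away from the full subset the homotopy contracts everything. At the full subset `d h + h d` is
the identity minus the projection `ι π`. The homotopy is negated because the difference is taken as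
`ι π - id`. -/
theorem topInclusion_topMap_sub {Q : Type} [AddCommGroup Q] [Module R Q] (hE : IsDivision a E)
    {π : A →ₗ[R] Q} {ι : Q →ₗ[R] A} (hιπ : ∀ x, ι (π x) = projBelow a E k x)
    {P P' : Finset (Fin k) → Prop} (hP : ∀ s j, P s → P' (symmDiff s {j}))
    (hs : P Finset.univ) (x : {s // P s} → A) :
    topInclusion ι P (topMap π P hs x) - x =
      diffMap R a P' P ((-homotopyMap a E P P') x) +
        (-homotopyMap a E P' P) (diffMap R a P P' x) := by
  rw [LinearMap.neg_apply, LinearMap.neg_apply, map_neg, ← neg_add, ← neg_sub, neg_inj]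
  funext s
  by_cases h : s.1 = Finset.univ
  · obtain ⟨s, hs'⟩ := s
    simp only at h
    subst h
    rw [Pi.add_apply, diffMap_homotopyMap_add_univ hE hP, Pi.sub_apply, ← hιπ]
    simp [topInclusion, topMap]
  · rw [Pi.add_apply, diffMap_homotopyMap_add hE hP x s h, Pi.sub_apply]
    simp [topInclusion, h]

/-- The parity that does not contain the full subset is contractible, so there the zero map is
homotopic to the identity. -/
theorem neg_id_eq_homotopy (hE : IsDivision a E)
    {P P' : Finset (Fin k) → Prop} (hP : ∀ s j, P s → P' (symmDiff s {j}))
    (hs : ¬ P Finset.univ) (x : {s // P s} → A) :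
    0 - x = diffMap R a P' P ((-homotopyMap a E P P') x) +
        (-homotopyMap a E P' P) (diffMap R a P P' x) := by
  rw [LinearMap.neg_apply, LinearMap.neg_apply, map_neg, ← neg_add, zero_sub, neg_inj]
  funext s
  exact (diffMap_homotopyMap_add hE hP x s (fun h => hs (h ▸ s.2))).symm

variable {Q : Type} [AddCommGroup Q] [Module R Q]

theorem topMap_mem {grQ : ℤ → AddSubgroup Q} {N : ℕ} {π : A →ₗ[R] Q}
    (hπ : ∀ n x, x ∈ grA n → π x ∈ grQ (n + ∑ j, ((N : ℤ) + 1 - da j)))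
    {P : Finset (Fin k) → Prop} (hP : P Finset.univ) {n : ℤ} {x : {s // P s} → A}
    (hx : x ∈ piece grA N da P n) : topMap π P hP x ∈ grQ n := by
  have := hπ _ _ (hx ⟨Finset.univ, hP⟩)
  rwa [sub_add_cancel] at this

theorem topInclusion_mem {grQ : ℤ → AddSubgroup Q} {N : ℕ} {ι : Q →ₗ[R] A}
    (hι : ∀ n x, x ∈ grQ n → ι x ∈ grA (n - ∑ j, ((N : ℤ) + 1 - da j)))
    (P : Finset (Fin k) → Prop) {n : ℤ} {x : Q} (hx : x ∈ grQ n) :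
    topInclusion ι P x ∈ piece grA N da P n := by
  rintro ⟨s, hs⟩
  by_cases h : s = Finset.univ
  · subst h
    simpa [topInclusion] using hι n x hx
  · simp [topInclusion, h]

theorem topMap_topInclusion {π : A →ₗ[R] Q} {ι : Q →ₗ[R] A} (hπι : ∀ x, π (ι x) = x)
    {P : Finset (Fin k) → Prop} (hP : P Finset.univ) (x : Q) :
    topMap π P hP (topInclusion ι P x) = x := by
  simp [topInclusion, topMap, hπι]

end Factorization

end Koszul

open Koszul in
/-- A Koszul factorization with rows `(a j, 0)`, the `a j` admitting divisions, is homotopy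
equivalent to the image of the projection along the `a j`, placed in the parity of `k`:
here for `k` even. -/
theorem koszul_homotopyEquivalent_of_even {R A : Type} [CommRing R] [CommRing A] [Algebra R A]
    {k N : ℕ} {a : Fin k → A} {E : Fin k → A →ₗ[R] A} {grA : ℤ → AddSubgroup A} {da : Fin k → ℤ}
    (hE : IsHomogeneousDivision grA da a E) (hk : Even k) (T : MatFact R)
    [Subsingleton T.M₁] {π : A →ₗ[R] T.M₀} {ι : T.M₀ →ₗ[R] A}
    (hπa : ∀ j x, π (a j * x) = 0)
    (hπι : ∀ x, π (ι x) = x) (hιπ : ∀ x, ι (π x) = projBelow a E k x)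
    (hπ : ∀ n x, x ∈ grA n → π x ∈ T.gr₀ (n + ∑ j, ((N : ℤ) + 1 - da j)))
    (hι : ∀ n x, x ∈ T.gr₀ n → ι x ∈ grA (n - ∑ j, ((N : ℤ) + 1 - da j))) :
    MatFact.HomotopyEquivalent N (koszul R grA N a (fun _ => 0) da) T := by
  have hu : Even (Finset.univ : Finset (Fin k)).card := by simpa using hk
  have hu' : ¬ Odd (Finset.univ : Finset (Fin k)).card := by simpa using hk
  let φ : MatFact.Hom (koszul R grA N a (fun _ => 0) da) T :=
    { f₀ := topMap π (fun s => Even s.card) hu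
      f₁ := 0
      comm₀ := fun x => Subsingleton.elim _ _
      comm₁ := fun x => by
        rw [koszul_d₁, LinearMap.zero_apply, map_zero]
        exact topMap_diffMap hπa hu x
      deg₀ := fun n x hx => topMap_mem hπ hu hx
      deg₁ := fun n x hx => zero_mem _ }
  let ψ : MatFact.Hom T (koszul R grA N a (fun _ => 0) da) :=
    { f₀ := topInclusion ι (fun s => Even s.card)
      f₁ := 0
      comm₀ := fun x => by
        rw [koszul_d₀, LinearMap.zero_apply]
        exact (diffMap_topInclusion ι _ _ x).symm
      comm₁ := fun x => by
        rw [Subsingleton.elim x 0, map_zero, map_zero, map_zero]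
        exact map_zero (topInclusion ι _)
      deg₀ := fun n x hx => topInclusion_mem hι _ hx
      deg₁ := fun n x hx => zero_mem _ }
  -- On the `T` side `φ ψ` is the identity on the nose, so the zero homotopy suffices.
  refine ⟨φ, ψ, ⟨-homotopyMap a E _ _, -homotopyMap a E _ _,
    fun n x hx => neg_mem (hE.homotopyMap_mem _ _ N n x hx),
    fun n x hx => neg_mem (hE.homotopyMap_mem _ _ N n x hx), fun x => ?_, fun x => ?_⟩,
    ⟨0, 0, fun _ _ _ => zero_mem _, fun _ _ _ => zero_mem _, fun x => ?_, fun x => ?_⟩⟩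
  · rw [koszul_d₀, koszul_d₁]
    exact topInclusion_topMap_sub hE.toIsDivision hιπ (fun s j => odd_of_even j) hu x
  · rw [koszul_d₀, koszul_d₁]
    exact neg_id_eq_homotopy hE.toIsDivision (fun s j => even_of_odd j) hu' x
  · have : (φ.comp ψ).f₀ x = x := topMap_topInclusion hπι hu x
    rw [this]
    simp [MatFact.Hom.id]
  · exact Subsingleton.elim _ _

open Koszul in
/-- The analogue of `koszul_homotopyEquivalent_of_even` for `k` odd. -/
theorem koszul_homotopyEquivalent_of_odd {R A : Type} [CommRing R] [CommRing A] [Algebra R A]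
    {k N : ℕ} {a : Fin k → A} {E : Fin k → A →ₗ[R] A} {grA : ℤ → AddSubgroup A} {da : Fin k → ℤ}
    (hE : IsHomogeneousDivision grA da a E) (hk : Odd k) (T : MatFact R)
    [Subsingleton T.M₀] {π : A →ₗ[R] T.M₁} {ι : T.M₁ →ₗ[R] A}
    (hπa : ∀ j x, π (a j * x) = 0)
    (hπι : ∀ x, π (ι x) = x) (hιπ : ∀ x, ι (π x) = projBelow a E k x)
    (hπ : ∀ n x, x ∈ grA n → π x ∈ T.gr₁ (n + ∑ j, ((N : ℤ) + 1 - da j)))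
    (hι : ∀ n x, x ∈ T.gr₁ n → ι x ∈ grA (n - ∑ j, ((N : ℤ) + 1 - da j))) :
    MatFact.HomotopyEquivalent N (koszul R grA N a (fun _ => 0) da) T := by
  have hu : Odd (Finset.univ : Finset (Fin k)).card := by simpa using hk
  have hu' : ¬ Even (Finset.univ : Finset (Fin k)).card := by simpa using hk
  let φ : MatFact.Hom (koszul R grA N a (fun _ => 0) da) T :=
    { f₀ := 0
      f₁ := topMap π (fun s => Odd s.card) hu
      comm₀ := fun x => by
        rw [koszul_d₀, LinearMap.zero_apply, map_zero]
        exact topMap_diffMap hπa hu x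
      comm₁ := fun x => Subsingleton.elim _ _
      deg₀ := fun n x hx => zero_mem _
      deg₁ := fun n x hx => topMap_mem hπ hu hx }
  let ψ : MatFact.Hom T (koszul R grA N a (fun _ => 0) da) :=
    { f₀ := 0
      f₁ := topInclusion ι (fun s => Odd s.card)
      comm₀ := fun x => by
        rw [Subsingleton.elim x 0, map_zero, map_zero, map_zero]
        exact map_zero (topInclusion ι _)
      comm₁ := fun x => by
        rw [koszul_d₁, LinearMap.zero_apply]
        exact (diffMap_topInclusion ι _ _ x).symm
      deg₀ := fun n x hx => zero_mem _
      deg₁ := fun n x hx => topInclusion_mem hι _ hx }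
  refine ⟨φ, ψ, ⟨-homotopyMap a E _ _, -homotopyMap a E _ _,
    fun n x hx => neg_mem (hE.homotopyMap_mem _ _ N n x hx),
    fun n x hx => neg_mem (hE.homotopyMap_mem _ _ N n x hx), fun x => ?_, fun x => ?_⟩,
    ⟨0, 0, fun _ _ _ => zero_mem _, fun _ _ _ => zero_mem _, fun x => ?_, fun x => ?_⟩⟩
  · rw [koszul_d₀, koszul_d₁]
    exact neg_id_eq_homotopy hE.toIsDivision (fun s j => odd_of_even j) hu' x
  · rw [koszul_d₀, koszul_d₁]
    exact topInclusion_topMap_sub hE.toIsDivision hιπ (fun s j => even_of_odd j) hu x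
  · exact Subsingleton.elim _ _
  · have : (φ.comp ψ).f₁ x = x := topMap_topInclusion hπι hu x
    rw [this]
    simp [MatFact.Hom.id]

/-! ## Graded bases -/

/-- The basis `b`, with `b i` of degree `δ i`, exhibits `M` as a graded free module. -/
def IsGradedBasis {ι R M : Type} [CommRing R] [AddCommGroup M] [Module R M]
    (𝒜 : ℤ → AddSubgroup R) (gr : ℤ → AddSubgroup M) (b : Module.Basis ι R M) (δ : ι → ℤ) : Prop :=
  ∀ (n : ℤ) (x : M), x ∈ gr n ↔ ∀ i, b.repr x i ∈ 𝒜 (n - δ i)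

/-- The pieces `gr k` are independent. -/
def GradingIndependent {M : Type} [AddCommGroup M] (gr : ℤ → AddSubgroup M) : Prop :=
  ∀ (T : Finset ℤ) (x : ℤ → M), (∀ k ∈ T, x k ∈ gr k) → ∑ k ∈ T, x k = 0 → ∀ k ∈ T, x k = 0

section GradedBasis

variable {ι R M : Type} [CommRing R] [AddCommGroup M] [Module R M]
  {𝒜 : ℤ → AddSubgroup R} {gr : ℤ → AddSubgroup M} {b : Module.Basis ι R M} {δ : ι → ℤ}

theorem IsGradedBasis.isGradedFree (h : IsGradedBasis 𝒜 gr b δ) : IsGradedFree 𝒜 gr :=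
  ⟨ι, b, δ, h⟩

/-- A basis of homogeneous elements is a graded basis. -/
theorem isGradedBasis_of_mem (c : R → ℤ →₀ R) (hc : ∀ r k, c r k ∈ 𝒜 k)
    (hsum : ∀ r, (c r).sum (fun _ x => x) = r)
    (hsmul : ∀ i j r x, r ∈ 𝒜 i → x ∈ gr j → r • x ∈ gr (i + j))
    (hind : GradingIndependent gr) (hb : ∀ i, b i ∈ gr (δ i)) :
    IsGradedBasis 𝒜 gr b δ := by
  classical
  intro n x
  constructor
  · intro hx
    let r := b.repr x
    -- `y k` is the degree `k` part of `x` computed from the coordinates, and `T` is a finite set of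
    -- degrees containing `n` and every degree that occurs.
    let y : ℤ → M := fun k => ∑ i ∈ r.support, c (r i) (k - δ i) • b i
    have hy : ∀ k, y k ∈ gr k := fun k => sum_mem fun i _ => by
      have := hsmul _ _ _ _ (hc (r i) (k - δ i)) (hb i)
      rwa [sub_add_cancel] at this
    let T : Finset ℤ := insert n
      (r.support.biUnion fun i => (c (r i)).support.image fun k => k + δ i)
    have hT : ∀ i ∈ r.support, ∑ k ∈ T, c (r i) (k - δ i) = r i := by
      intro i hi
      conv_rhs => rw [← hsum (r i), Finsupp.sum]
      rw [← Finset.sum_subset (s₁ := (c (r i)).support.image fun k => k + δ i)]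
      · rw [Finset.sum_image (fun _ _ _ _ h => add_right_cancel h)]
        simp
      · intro k hk
        exact Finset.mem_insert_of_mem (Finset.mem_biUnion.2 ⟨i, hi, hk⟩)
      · intro k _ hk
        by_contra hne
        exact hk (Finset.mem_image.2 ⟨k - δ i, Finsupp.mem_support_iff.2 hne, by simp⟩)
    have hyx : ∑ k ∈ T, y k = x := by
      rw [Finset.sum_comm]
      conv_rhs => rw [← b.linearCombination_repr x, Finsupp.linearCombination_apply, Finsupp.sum]
      refine Finset.sum_congr rfl fun i hi => ?_
      rw [← Finset.sum_smul, hT i hi]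
    have hn : n ∈ T := Finset.mem_insert_self _ _
    -- Independence applied to the `y k`, with `x` subtracted in degree `n`: these sum to zero,
    -- whence `y n = x`, and the coordinates of `x` are homogeneous components.
    have key := hind T (fun k => y k - if k = n then x else 0) (fun k _ => by
      by_cases h : k = n
      · subst h
        simpa using sub_mem (hy k) hx
      · simpa [h] using hy k) (by
        rw [Finset.sum_sub_distrib, hyx]
        simp [hn]) n hn
    rw [if_pos rfl, sub_eq_zero] at key
    intro i
    have e : b.repr x i = if i ∈ r.support then c (r i) (n - δ i) else 0 := by
      rw [← key]
      simp only [y, map_sum, map_smul, Module.Basis.repr_self, Finsupp.smul_single, smul_eq_mul,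
        mul_one, Finsupp.finsetSum_apply, Finsupp.single_apply, Finset.sum_ite_eq']
    rw [e]
    split_ifs
    · exact hc _ _
    · exact zero_mem _
  · intro h
    rw [← b.linearCombination_repr x, Finsupp.linearCombination_apply, Finsupp.sum]
    refine sum_mem fun i _ => ?_
    have := hsmul _ _ _ _ (h i) (hb i)
    rwa [sub_add_cancel] at this

theorem IsGradedBasis.mem_of_one_mem (h : IsGradedBasis 𝒜 gr b δ) (h1 : (1 : R) ∈ 𝒜 0) (i : ι) :
    b i ∈ gr (δ i) := by
  classical
  rw [h]
  intro j
  rw [b.repr_self, Finsupp.single_apply]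
  split_ifs with hij
  · subst hij
    rwa [sub_self]
  · exact zero_mem _

/-- The homogeneous basis of the pieces of a Koszul factorization. -/
theorem IsGradedBasis.piece {A : Type} [CommRing A] [Algebra R A] {grA : ℤ → AddSubgroup A}
    {b : Module.Basis ι R A} (h : IsGradedBasis 𝒜 grA b δ) {k : ℕ} (N : ℕ) (da : Fin k → ℤ)
    (P : Finset (Fin k) → Prop) : IsGradedFree 𝒜 (Koszul.piece grA N da P) := by
  classical
  refine ⟨(_ : {s // P s}) × ι, Pi.basis fun _ => b,
    fun p => (∑ j ∈ p.1.1, ((N : ℤ) + 1 - da j)) + δ p.2, fun n x => ?_⟩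
  have : ∀ s : {s // P s}, x s ∈ grA (n - ∑ j ∈ s.1, ((N : ℤ) + 1 - da j)) ↔
      ∀ i, b.repr (x s) i ∈ 𝒜 (n - (∑ j ∈ s.1, ((N : ℤ) + 1 - da j) + δ i)) := by
    intro s
    rw [h]
    simp only [sub_sub]
  constructor
  · intro hx p
    rw [Pi.basis_repr]
    exact (this p.1).1 (hx p.1) p.2
  · intro hx s
    rw [this]
    intro i
    have := hx ⟨s, i⟩
    rwa [Pi.basis_repr] at this

/-- A graded module of the form `⨁ᵢ R{q^(δ i)}` is determined by its degrees. -/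
theorem IsGradedBasis.equiv_mem {ι' M' : Type} [AddCommGroup M'] [Module R M']
    {gr' : ℤ → AddSubgroup M'} {b' : Module.Basis ι' R M'} {δ' : ι' → ℤ}
    (h : IsGradedBasis 𝒜 gr b δ) (h' : IsGradedBasis 𝒜 gr' b' δ') (e : ι ≃ ι') (c : ℤ)
    (he : ∀ i, δ' (e i) = δ i + c) (n : ℤ) (x : M) (hx : x ∈ gr n) :
    b.equiv b' e x ∈ gr' (n + c) := by
  rw [h']
  intro i
  obtain ⟨i, rfl⟩ := e.surjective i
  have : b'.repr (b.equiv b' e x) (e i) = b.repr x i := by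
    classical
    have : Finsupp.lapply (e i) ∘ₗ b'.repr.toLinearMap ∘ₗ (b.equiv b' e).toLinearMap =
        Finsupp.lapply i ∘ₗ b.repr.toLinearMap :=
      b.ext fun j => by simp [Finsupp.single_apply]
    exact LinearMap.congr_fun this x
  rw [this, he]
  convert (h n x).1 hx i using 2
  ring

end GradedBasis

/-! ## Free polynomial actions -/

section Monomial

open Koszul

variable {R A Λ : Type} [CommRing R] [CommRing A] [Algebra R A] {k : ℕ}

/-- `b` is a basis of `A` over `R[a₁, …, a_k]` in the form of a basis over `R`. -/
def IsMonomialBasis (a : Fin k → A) (b : Module.Basis (Λ × (Fin k →₀ ℕ)) R A) : Prop :=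
  ∀ j α β, a j * b (α, β) = b (α, β + Finsupp.single j 1)

/-- Division by `a j`, for a monomial basis. -/
def divMap (b : Module.Basis (Λ × (Fin k →₀ ℕ)) R A) (j : Fin k) : A →ₗ[R] A :=
  b.constr R fun p => if p.2 j = 0 then 0 else b (p.1, p.2 - Finsupp.single j 1)

variable {a : Fin k → A} {b : Module.Basis (Λ × (Fin k →₀ ℕ)) R A}

theorem divMap_basis (j : Fin k) (α : Λ) (β : Fin k →₀ ℕ) :
    divMap b j (b (α, β)) = if β j = 0 then 0 else b (α, β - Finsupp.single j 1) := by
  rw [divMap, Module.Basis.constr_basis]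

theorem IsMonomialBasis.isDivision (h : IsMonomialBasis a b) : IsDivision a (divMap b) where
  cancel j x := by
    have : divMap b j ∘ₗ LinearMap.mulLeft R (a j) = LinearMap.id := by
      refine b.ext fun p => ?_
      obtain ⟨α, β⟩ := p
      simp [h j, divMap_basis]
    exact LinearMap.congr_fun this x
  comm i j x hij := by
    have : divMap b j ∘ₗ LinearMap.mulLeft R (a i) = LinearMap.mulLeft R (a i) ∘ₗ divMap b j := by
      refine b.ext fun p => ?_
      obtain ⟨α, β⟩ := p
      simp only [LinearMap.comp_apply, LinearMap.mulLeft_apply, h i, divMap_basis,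
        Finsupp.add_apply, Finsupp.single_eq_of_ne hij.symm, add_zero]
      split_ifs with h0
      · rw [mul_zero]
      · rw [h i]
        congr 2
        ext l
        simp only [Finsupp.coe_tsub, Finsupp.coe_add, Pi.sub_apply, Pi.add_apply,
          Finsupp.single_apply]
        by_cases hl : j = l
        · subst hl
          simp [hij]
        · simp [hl]
    exact LinearMap.congr_fun this x

/-- A basis element with `β ≠ 0` is a multiple of some `a j` and is killed. Those with `β = 0` are
annihilated by every division, so every factor fixes them. -/
theorem IsMonomialBasis.projBelow_basis (h : IsMonomialBasis a b) (α : Λ) (β : Fin k →₀ ℕ) :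
    projBelow a (divMap b) k (b (α, β)) = if β = 0 then b (α, 0) else 0 := by
  split_ifs with hβ
  · subst hβ
    have : ∀ j, projBelow a (divMap b) j (b (α, 0)) = b (α, 0) := by
      intro j
      induction j with
      | zero => rfl
      | succ j ih =>
        by_cases hj : j < k
        · have e := projBelow_succ (a := a) (E := divMap b) ⟨j, hj⟩ (b (α, 0))
          simp only at e
          rw [e, ih, divMap_basis]
          simp
        · simpa [projBelow, hj] using ih
    exact this k
  · obtain ⟨j, hj⟩ := Finsupp.ne_iff.1 hβ
    have : b (α, β) = a j * b (α, β - Finsupp.single j 1) := by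
      rw [h j, tsub_add_cancel_of_le]
      rw [Finsupp.single_le_iff]
      simp only [Finsupp.coe_zero, Pi.zero_apply] at hj
      omega
    rw [this, h.isDivision.projBelow_mul_of_lt j _ k j.2]

theorem repr_divMap (j : Fin k) (x : A) (α : Λ) (β : Fin k →₀ ℕ) :
    b.repr (divMap b j x) (α, β) = b.repr x (α, β + Finsupp.single j 1) := by
  classical
  have : Finsupp.lapply (α, β) ∘ₗ b.repr.toLinearMap ∘ₗ divMap b j =
      Finsupp.lapply (α, β + Finsupp.single j 1) ∘ₗ b.repr.toLinearMap := by
    refine b.ext fun p => ?_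
    obtain ⟨α', β'⟩ := p
    simp only [LinearMap.comp_apply, LinearEquiv.coe_coe, divMap_basis, Finsupp.lapply_apply,
      Module.Basis.repr_self, Finsupp.single_apply, Prod.mk.injEq]
    by_cases h0 : β' j = 0
    · rw [if_pos h0, if_neg]
      · simp
      · rintro ⟨-, rfl⟩
        simp at h0
    · rw [if_neg h0, Module.Basis.repr_self, Finsupp.single_apply]
      have e : β' - Finsupp.single j 1 = β ↔ β' = β + Finsupp.single j 1 := by
        constructor
        · rintro rfl
          rw [tsub_add_cancel_of_le]
          rw [Finsupp.single_le_iff]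
          omega
        · rintro rfl
          simp
      simp only [Prod.mk.injEq, e]
  exact LinearMap.congr_fun this x

variable {𝒜 : ℤ → AddSubgroup R} {grA : ℤ → AddSubgroup A} {δ : Λ → ℤ} {da : Fin k → ℤ}

/-- The degree of the basis element `(α, β)`. -/
def monomialDegree (δ : Λ → ℤ) (da : Fin k → ℤ) (p : Λ × (Fin k →₀ ℕ)) : ℤ :=
  δ p.1 + ∑ j, p.2 j * da j

theorem monomialDegree_add_single (α : Λ) (β : Fin k →₀ ℕ) (j : Fin k) :
    monomialDegree δ da (α, β + Finsupp.single j 1) = monomialDegree δ da (α, β) + da j := by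
  simp [monomialDegree, add_mul, Finset.sum_add_distrib, Finsupp.single_apply, add_assoc]

theorem IsMonomialBasis.repr_mul (h : IsMonomialBasis a b) (j : Fin k) (x : A) (α : Λ)
    (β : Fin k →₀ ℕ) : b.repr (a j * x) (α, β) =
      if β j = 0 then 0 else b.repr x (α, β - Finsupp.single j 1) := by
  classical
  split_ifs with hβ
  · have : Finsupp.lapply (α, β) ∘ₗ b.repr.toLinearMap ∘ₗ LinearMap.mulLeft R (a j) = 0 := by
      refine b.ext fun p => ?_
      obtain ⟨α', β'⟩ := p
      simp only [LinearMap.comp_apply, LinearEquiv.coe_coe, LinearMap.mulLeft_apply, h j,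
        Finsupp.lapply_apply, Module.Basis.repr_self, LinearMap.zero_apply]
      rw [Finsupp.single_apply, if_neg]
      rintro ⟨⟩
      simp at hβ
    exact LinearMap.congr_fun this x
  · have e : β - Finsupp.single j 1 + Finsupp.single j 1 = β := by
      rw [tsub_add_cancel_of_le]
      rw [Finsupp.single_le_iff]
      omega
    conv_rhs => rw [← h.isDivision.cancel j x, repr_divMap, e]

theorem IsMonomialBasis.isHomogeneousDivision (h : IsMonomialBasis a b)
    (hgr : IsGradedBasis 𝒜 grA b (monomialDegree δ da)) :
    IsHomogeneousDivision grA da a (divMap b) where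
  toIsDivision := h.isDivision
  mul_mem j n x hx := by
    rw [hgr]
    rintro ⟨α, β⟩
    rw [h.repr_mul]
    split_ifs with hβ
    · exact zero_mem _
    · have := (hgr n x).1 hx (α, β - Finsupp.single j 1)
      convert this using 2
      have e : β - Finsupp.single j 1 + Finsupp.single j 1 = β := by
        rw [tsub_add_cancel_of_le]
        rw [Finsupp.single_le_iff]
        omega
      conv_lhs => rw [← e, monomialDegree_add_single]
      ring
  div_mem j n x hx := by
    rw [hgr]
    rintro ⟨α, β⟩
    rw [repr_divMap]
    convert (hgr n x).1 hx (α, β + Finsupp.single j 1) using 2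
    rw [monomialDegree_add_single]
    ring

variable {Q : Type} [AddCommGroup Q] [Module R Q] {grQ : ℤ → AddSubgroup Q}

/-- The projection from `A` to `A / (a₁, …, a_k)`, in terms of bases. -/
def basisProj (b : Module.Basis (Λ × (Fin k →₀ ℕ)) R A) (bQ : Module.Basis Λ R Q) : A →ₗ[R] Q :=
  b.constr R fun p => if p.2 = 0 then bQ p.1 else 0

/-- The section of `basisProj`. -/
def basisSection (b : Module.Basis (Λ × (Fin k →₀ ℕ)) R A) (bQ : Module.Basis Λ R Q) : Q →ₗ[R] A :=
  bQ.constr R fun α => b (α, 0)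

variable {bQ : Module.Basis Λ R Q}

theorem basisProj_basis (α : Λ) (β : Fin k →₀ ℕ) :
    basisProj b bQ (b (α, β)) = if β = 0 then bQ α else 0 := by
  rw [basisProj, Module.Basis.constr_basis]

theorem basisSection_basis (α : Λ) : basisSection b bQ (bQ α) = b (α, 0) := by
  rw [basisSection, Module.Basis.constr_basis]

theorem basisProj_basisSection (x : Q) : basisProj b bQ (basisSection b bQ x) = x := by
  have : basisProj b bQ ∘ₗ basisSection b bQ = LinearMap.id :=
    bQ.ext fun α => by simp [basisSection_basis, basisProj_basis]
  exact LinearMap.congr_fun this x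

/-- Identifies the projection left over by the contracting homotopy with passing to the quotient and
back: both fix `b (α, 0)` and kill the rest of the basis. -/
theorem IsMonomialBasis.basisSection_basisProj (h : IsMonomialBasis a b) (x : A) :
    basisSection b bQ (basisProj b bQ x) = projBelow a (divMap b) k x := by
  have : basisSection b bQ ∘ₗ basisProj b bQ = projBelow a (divMap b) k := by
    refine b.ext fun p => ?_
    obtain ⟨α, β⟩ := p
    rw [h.projBelow_basis, LinearMap.comp_apply, basisProj_basis]
    split_ifs
    · rw [basisSection_basis]
    · rw [map_zero]
  exact LinearMap.congr_fun this x

theorem IsMonomialBasis.basisProj_mul (h : IsMonomialBasis a b) (j : Fin k) (x : A) :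
    basisProj b bQ (a j * x) = 0 := by
  have : basisProj b bQ ∘ₗ LinearMap.mulLeft R (a j) = 0 := by
    refine b.ext fun p => ?_
    obtain ⟨α, β⟩ := p
    rw [LinearMap.comp_apply, LinearMap.mulLeft_apply, h j, basisProj_basis, if_neg]
    · rfl
    · intro h0
      have := DFunLike.congr_fun h0 j
      simp at this
  exact LinearMap.congr_fun this x

theorem repr_basisProj (x : A) (α : Λ) : bQ.repr (basisProj b bQ x) α = b.repr x (α, 0) := by
  classical
  have : Finsupp.lapply α ∘ₗ bQ.repr.toLinearMap ∘ₗ basisProj b bQ =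
      Finsupp.lapply (α, 0) ∘ₗ b.repr.toLinearMap := by
    refine b.ext fun p => ?_
    obtain ⟨α', β'⟩ := p
    simp only [LinearMap.comp_apply, LinearEquiv.coe_coe, basisProj_basis, Finsupp.lapply_apply,
      Module.Basis.repr_self, Finsupp.single_apply, Prod.mk.injEq]
    by_cases h0 : β' = 0
    · simp [h0, Finsupp.single_apply]
    · simp [h0]
  exact LinearMap.congr_fun this x

theorem repr_basisSection (x : Q) (α : Λ) (β : Fin k →₀ ℕ) :
    b.repr (basisSection b bQ x) (α, β) = if β = 0 then bQ.repr x α else 0 := by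
  classical
  split_ifs with hβ
  · subst hβ
    rw [← repr_basisProj (bQ := bQ), basisProj_basisSection]
  · have : Finsupp.lapply (α, β) ∘ₗ b.repr.toLinearMap ∘ₗ basisSection b bQ = 0 := by
      refine bQ.ext fun α' => ?_
      simp only [LinearMap.comp_apply, LinearEquiv.coe_coe, basisSection_basis,
        Finsupp.lapply_apply, Module.Basis.repr_self, LinearMap.zero_apply]
      rw [Finsupp.single_apply, if_neg]
      rintro ⟨⟩
      exact hβ rfl
    exact LinearMap.congr_fun this x

theorem basisProj_mem (hgr : IsGradedBasis 𝒜 grA b (monomialDegree δ da)) {c : ℤ}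
    (hQ : IsGradedBasis 𝒜 grQ bQ (fun α => δ α + c)) (n : ℤ) (x : A) (hx : x ∈ grA n) :
    basisProj b bQ x ∈ grQ (n + c) := by
  rw [hQ]
  intro α
  rw [repr_basisProj]
  convert (hgr n x).1 hx (α, 0) using 2
  simp [monomialDegree]

theorem basisSection_mem (hgr : IsGradedBasis 𝒜 grA b (monomialDegree δ da)) {c : ℤ}
    (hQ : IsGradedBasis 𝒜 grQ bQ (fun α => δ α + c)) (n : ℤ) (x : Q) (hx : x ∈ grQ n) :
    basisSection b bQ x ∈ grA (n - c) := by
  rw [hgr]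
  rintro ⟨α, β⟩
  rw [repr_basisSection]
  split_ifs with h
  · subst h
    convert (hQ n x).1 hx α using 2
    simp [monomialDegree]
    ring
  · exact zero_mem _

end Monomial

/-! ## Exponents of bounded degree and Gaussian binomial coefficients -/

/-- Exponents `α` of monomials in `m` variables with `|α| ≤ n`. -/
abbrev BoxExp (m n : ℕ) : Type := {α : Fin m → ℕ // ∑ i, α i ≤ n}

/-- The weight `∑ᵢ (i + 1) αᵢ` of an exponent. -/
def expWeight {m : ℕ} (α : Fin m → ℕ) : ℕ := ∑ i, α i * ((i : ℕ) + 1)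

instance (m n : ℕ) : Finite (BoxExp m n) := by
  refine Finite.of_injective (β := Fin m → Fin (n + 1))
    (fun α i => ⟨α.1 i, Nat.lt_succ_of_le
      ((Finset.single_le_sum (fun _ _ => Nat.zero_le _) (Finset.mem_univ i)).trans α.2)⟩) ?_
  intro α β h
  refine Subtype.ext (funext fun i => ?_)
  have := congrFun h i
  simpa using this

instance (m n : ℕ) : Fintype (BoxExp m n) := Fintype.ofFinite _

theorem expWeight_snoc_zero {m : ℕ} (α : Fin m → ℕ) :
    expWeight (Fin.snoc α 0 : Fin (m + 1) → ℕ) = expWeight α := by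
  simp [expWeight, Fin.sum_univ_castSucc]

theorem expWeight_add_single {m : ℕ} (α : Fin m → ℕ) (i : Fin m) :
    expWeight (α + Pi.single i 1) = expWeight α + (i + 1) := by
  simp [expWeight, add_mul, Finset.sum_add_distrib, Pi.single_apply]

theorem sum_add_single {m : ℕ} (α : Fin m → ℕ) (i : Fin m) :
    ∑ j, (α + Pi.single i 1 : Fin m → ℕ) j = ∑ j, α j + 1 := by
  simp [Finset.sum_add_distrib, Pi.single_apply]

/-- An exponent either does not involve the last variable or is divisible by it. -/
def boxExpEquiv (m n : ℕ) : BoxExp m (n + 1) ⊕ BoxExp (m + 1) n ≃ BoxExp (m + 1) (n + 1) :=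
  Equiv.ofBijective
    (Sum.elim (fun α => ⟨Fin.snoc α.1 0, by simpa [Fin.sum_univ_castSucc] using α.2⟩)
      (fun α => ⟨α.1 + Pi.single (Fin.last m) 1, by
        rw [sum_add_single]
        exact Nat.succ_le_succ α.2⟩)) (by
    constructor
    · rintro (α | α) (β | β) h
      · have h' := congrArg Subtype.val h
        simp only [Sum.elim_inl] at h'
        have := congrArg Fin.init h'
        rw [Fin.init_snoc, Fin.init_snoc] at this
        rw [Subtype.ext this]
      · have h' := congrFun (congrArg Subtype.val h) (Fin.last m)
        simp at h'
      · have h' := congrFun (congrArg Subtype.val h) (Fin.last m)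
        simp at h'
      · have h' := congrArg Subtype.val h
        simp only [Sum.elim_inr] at h'
        rw [Subtype.ext (add_right_cancel h')]
    · intro α
      by_cases h : α.1 (Fin.last m) = 0
      · have e : (Fin.snoc (Fin.init α.1) 0 : Fin (m + 1) → ℕ) = α.1 := by
          rw [← h, Fin.snoc_init_self]
        refine ⟨Sum.inl ⟨Fin.init α.1, ?_⟩, Subtype.ext e⟩
        have := α.2
        rw [← e] at this
        simpa [Fin.sum_univ_castSucc] using this
      · have e : (α.1 - Pi.single (Fin.last m) 1) + Pi.single (Fin.last m) 1 = α.1 := by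
          funext i
          by_cases hi : i = Fin.last m
          · subst hi
            simp
            omega
          · simp [hi]
        refine ⟨Sum.inr ⟨α.1 - Pi.single (Fin.last m) 1, ?_⟩, Subtype.ext e⟩
        have := α.2
        rw [← e, sum_add_single] at this
        omega)

/-- `∑ t^(weight of α)` over the exponents `α` with `|α| ≤ n`. -/
def boxSum {S : Type} [CommSemiring S] (t : S) (m n : ℕ) : S :=
  ∑ α : BoxExp m n, t ^ expWeight α.1

section BoxSum

variable {S : Type} [CommSemiring S] (t : S)

theorem boxSum_zero_left (n : ℕ) : boxSum t 0 n = 1 := by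
  have : Unique (BoxExp 0 n) :=
    { default := ⟨0, by simp⟩
      uniq := fun α => Subtype.ext (funext fun i => i.elim0) }
  rw [boxSum, Fintype.sum_unique]
  simp [expWeight]

theorem boxSum_zero_right (m : ℕ) : boxSum t m 0 = 1 := by
  let _ : Unique (BoxExp m 0) :=
    { default := ⟨0, by simp⟩
      uniq := fun α => Subtype.ext (funext fun i => by
        have := α.2
        simp only [nonpos_iff_eq_zero, Finset.sum_eq_zero_iff, Finset.mem_univ,
          true_imp_iff] at this
        exact this i) }
  rw [boxSum, Fintype.sum_unique]
  change t ^ expWeight (0 : Fin m → ℕ) = 1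
  simp [expWeight]

/-- The Pascal rule: an exponent avoids the last variable, which has weight `m + 1`, or is divisible
by it. -/
theorem boxSum_succ (m n : ℕ) :
    boxSum t (m + 1) (n + 1) = boxSum t m (n + 1) + t ^ (m + 1) * boxSum t (m + 1) n := by
  rw [boxSum, ← (boxExpEquiv m n).sum_comp, Fintype.sum_sum_type, boxSum, boxSum, Finset.mul_sum]
  congr 1
  · refine Finset.sum_congr rfl fun α _ => ?_
    change t ^ expWeight (Fin.snoc α.1 0 : Fin (m + 1) → ℕ) = _
    rw [expWeight_snoc_zero]
  · refine Finset.sum_congr rfl fun α _ => ?_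
    change t ^ expWeight (α.1 + Pi.single (Fin.last m) 1) = _
    rw [expWeight_add_single, pow_add, mul_comm, Fin.val_last]

/-- The product formula of the Gaussian binomial coefficient with its denominator cleared, so that
`t` can be the power series variable. The induction follows `boxSum_succ`. -/
theorem boxSum_mul_prod {S : Type} [CommRing S] (t : S) : ∀ m n : ℕ,
    boxSum t m n * ∏ i ∈ Finset.range m, (1 - t ^ (i + 1)) =
      ∏ i ∈ Finset.range m, (1 - t ^ (n + 1 + i))
  | 0, n => by simp [boxSum_zero_left]
  | m + 1, 0 => by
      rw [boxSum_zero_right, one_mul]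
      exact Finset.prod_congr rfl fun i _ => by rw [zero_add, add_comm]
  | m + 1, n + 1 => by
      have h1 := boxSum_mul_prod t m (n + 1)
      have h2 := boxSum_mul_prod t (m + 1) n
      rw [Finset.prod_range_succ' (fun i => 1 - t ^ (n + 1 + i))] at h2
      have e : ∏ i ∈ Finset.range m, (1 - t ^ (n + 1 + (i + 1))) =
          ∏ i ∈ Finset.range m, (1 - t ^ (n + 1 + 1 + i)) :=
        Finset.prod_congr rfl fun i _ => by rw [add_assoc (n + 1) 1 i, add_comm 1 i]
      rw [e] at h2
      rw [boxSum_succ, add_mul, mul_assoc, h2, Finset.prod_range_succ, ← mul_assoc, h1,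
        Finset.prod_range_succ]
      ring

end BoxSum

/-- Both sides obey a Pascal rule. The factor `T (-(m n))` turns the rule of `boxSum`, which starts
in degree zero, into the symmetric normalization of `qBinom`. -/
theorem qBinom_eq_boxSum : ∀ n m : ℕ, qBinom (n + m) m =
    LaurentPolynomial.T (-((m : ℤ) * n)) * boxSum (LaurentPolynomial.T 2) m n
  | n, 0 => by
      rw [boxSum_zero_left]
      cases n <;> simp [qBinom]
  | 0, m + 1 => by
      have ih := qBinom_eq_boxSum 0 m
      rw [boxSum_zero_right, Nat.cast_zero, mul_zero, neg_zero, LaurentPolynomial.T_zero,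
        one_mul] at ih ⊢
      rw [zero_add] at ih ⊢
      rw [qBinom, ih, qBinom_eq_zero m (m + 1) (Nat.lt_succ_self m)]
      simp
  | n + 1, m + 1 => by
      have ih1 := qBinom_eq_boxSum n (m + 1)
      have ih2 := qBinom_eq_boxSum (n + 1) m
      have e : n + 1 + (m + 1) = (n + 1 + m) + 1 := by ring
      have e' : n + (m + 1) = n + 1 + m := by ring
      rw [e'] at ih1
      rw [e, qBinom, ih1, ih2, boxSum_succ, mul_add, add_comm, ← mul_assoc, ← mul_assoc,
        ← mul_assoc, LaurentPolynomial.T_pow, ← LaurentPolynomial.T_add, ← LaurentPolynomial.T_add,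
        ← LaurentPolynomial.T_add]
      congr 3 <;> push_cast <;> ring

/-- The summands of `M{[n + m, m]}` are indexed by the exponents `α` with `|α| ≤ n`. -/
theorem exists_qBinom_equiv (n m : ℕ) :
    ∃ e : BoxExp m n ≃ (k : ℤ) × Fin ((qBinom (n + m) m).coeff k),
      ∀ α, (e α).1 = 2 * (expWeight α.1 : ℤ) - m * n := by
  classical
  let d : BoxExp m n → ℤ := fun α => 2 * (expWeight α.1 : ℤ) - m * n
  have hcard : ∀ k : ℤ, Fintype.card {α // d α = k} = (qBinom (n + m) m).coeff k := by
    intro k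
    have : qBinom (n + m) m = ∑ α : BoxExp m n, LaurentPolynomial.T (d α) := by
      rw [qBinom_eq_boxSum, boxSum, Finset.mul_sum]
      refine Finset.sum_congr rfl fun α _ => ?_
      rw [LaurentPolynomial.T_pow, ← LaurentPolynomial.T_add]
      congr 1
      simp only [d]
      ring
    rw [this, AddMonoidAlgebra.coeff_sum, Finsupp.finsetSum_apply]
    simp only [LaurentPolynomial.T_apply, Finset.sum_boole, Nat.cast_id, Fintype.card_subtype]
  let e := (Equiv.sigmaFiberEquiv d).symm.trans
    (Equiv.sigmaCongrRight fun k => Fintype.equivFinOfCardEq (hcard k))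
  exact ⟨e, fun α => rfl⟩

/-! ## Counting by weight -/

/-- The generating function of the fibers of a weight function. -/
def weightSeries {I : Type} (w : I → ℕ) : PowerSeries ℤ :=
  PowerSeries.mk fun k => (Nat.card {i // w i = k} : ℤ)

/-- All fibers of `w` are finite. -/
def FiniteFibers {I : Type} (w : I → ℕ) : Prop := ∀ k, Finite {i // w i = k}

/-- The pairs of total weight `k`, sorted by the weights of their components. -/
def prodFiberEquiv {I J : Type} (w : I → ℕ) (w' : J → ℕ) (k : ℕ) :
    {p : I × J // w p.1 + w' p.2 = k} ≃
      ((q : Finset.HasAntidiagonal.antidiagonal k) ×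
        ({i // w i = q.1.1} × {j // w' j = q.1.2})) where
  toFun p := ⟨⟨(w p.1.1, w' p.1.2), Finset.HasAntidiagonal.mem_antidiagonal.2 p.2⟩,
    ⟨p.1.1, rfl⟩, ⟨p.1.2, rfl⟩⟩
  invFun q := ⟨(q.2.1.1, q.2.2.1), by
    rw [q.2.1.2, q.2.2.2]
    exact Finset.HasAntidiagonal.mem_antidiagonal.1 q.1.2⟩
  left_inv _ := rfl
  right_inv q := by
    obtain ⟨⟨⟨x, y⟩, h⟩, ⟨i, hi⟩, ⟨j, hj⟩⟩ := q
    simp only at hi hj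
    subst hi hj
    rfl

theorem FiniteFibers.prod {I J : Type} {w : I → ℕ} {w' : J → ℕ} (h : FiniteFibers w)
    (h' : FiniteFibers w') : FiniteFibers (fun p : I × J => w p.1 + w' p.2) := fun k =>
  have := h
  have := h'
  have : ∀ q : Finset.HasAntidiagonal.antidiagonal k,
      Finite ({i // w i = q.1.1} × {j // w' j = q.1.2}) :=
    fun q => have := h q.1.1; have := h' q.1.2; inferInstance
  Finite.of_equiv _ (prodFiberEquiv w w' k).symm

theorem weightSeries_prod {I J : Type} {w : I → ℕ} {w' : J → ℕ} (h : FiniteFibers w)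
    (h' : FiniteFibers w') :
    weightSeries (fun p : I × J => w p.1 + w' p.2) = weightSeries w * weightSeries w' := by
  ext k
  rw [PowerSeries.coeff_mul]
  simp only [weightSeries, PowerSeries.coeff_mk]
  have : ∀ q : Finset.HasAntidiagonal.antidiagonal k,
      Finite ({i // w i = q.1.1} × {j // w' j = q.1.2}) :=
    fun q => have := h q.1.1; have := h' q.1.2; inferInstance
  rw [Nat.card_congr (prodFiberEquiv w w' k), Nat.card_sigma]
  push_cast
  rw [← Finset.sum_coe_sort (Finset.HasAntidiagonal.antidiagonal k)
    (fun q => (Nat.card {i // w i = q.1} : ℤ) * (Nat.card {j // w' j = q.2} : ℤ))]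
  refine Finset.sum_congr rfl fun q _ => ?_
  rw [Nat.card_prod]
  push_cast
  rfl

theorem FiniteFibers.of_equiv {I J : Type} {w : I → ℕ} {w' : J → ℕ} (h : FiniteFibers w)
    (e : J ≃ I) (he : ∀ j, w (e j) = w' j) : FiniteFibers w' := fun k =>
  have := h k
  Finite.of_equiv _ (e.subtypeEquiv (p := fun j => w' j = k) (q := fun i => w i = k)
    fun j => by rw [he]).symm

theorem weightSeries_congr {I J : Type} {w : I → ℕ} {w' : J → ℕ}
    (e : J ≃ I) (he : ∀ j, w (e j) = w' j) : weightSeries w' = weightSeries w := by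
  ext k
  simp only [weightSeries, PowerSeries.coeff_mk]
  rw [Nat.card_congr (e.subtypeEquiv (p := fun j => w' j = k) (q := fun i => w i = k)
    fun j => by rw [he])]

/-- Bijections are chosen fiber by fiber. Finiteness of the fibers is essential, because `Nat.card`
is zero on infinite types. -/
theorem exists_equiv_of_weightSeries_eq {I J : Type} {w : I → ℕ} {w' : J → ℕ}
    (h : FiniteFibers w) (h' : FiniteFibers w') (heq : weightSeries w = weightSeries w') :
    ∃ e : I ≃ J, ∀ i, w' (e i) = w i := by
  have hc : ∀ k, Nonempty ({i // w i = k} ≃ {j // w' j = k}) := by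
    intro k
    have := h k
    have := h' k
    refine Finite.card_eq.1 ?_
    have := congrArg (PowerSeries.coeff k) heq
    simpa [weightSeries] using this
  let f := fun k => (hc k).some
  refine ⟨(Equiv.sigmaFiberEquiv w).symm.trans
    ((Equiv.sigmaCongrRight f).trans (Equiv.sigmaFiberEquiv w')), fun i => ?_⟩
  exact (f (w i) ⟨i, rfl⟩).2

theorem finiteFibers_mul {c : ℕ} (hc : 0 < c) : FiniteFibers (fun i : ℕ => i * c) := fun k => by
  have : Subsingleton {i : ℕ // i * c = k} := ⟨fun i j => Subtype.ext
    (Nat.eq_of_mul_eq_mul_right hc (i.2.trans j.2.symm))⟩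
  infer_instance

/-- The geometric series `1 + X^c + X^(2c) + ⋯`: for `c > 0` each multiple of `c` is attained
exactly once. -/
theorem weightSeries_mul {c : ℕ} (hc : 0 < c) :
    weightSeries (fun i : ℕ => i * c) * (1 - PowerSeries.X ^ c) = 1 := by
  have hcard : ∀ k, Nat.card {i : ℕ // i * c = k} = if c ∣ k then 1 else 0 := by
    intro k
    have hs : Subsingleton {i : ℕ // i * c = k} := ⟨fun i j => Subtype.ext
      (Nat.eq_of_mul_eq_mul_right hc (i.2.trans j.2.symm))⟩
    split_ifs with h
    · obtain ⟨i, rfl⟩ := h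
      have : Nonempty {i' : ℕ // i' * c = c * i} := ⟨⟨i, mul_comm _ _⟩⟩
      exact Nat.card_unique
    · have : IsEmpty {i : ℕ // i * c = k} := ⟨fun i => h ⟨i.1, by rw [mul_comm, i.2]⟩⟩
      exact Nat.card_of_isEmpty
  ext k
  rw [mul_sub, mul_one, map_sub, PowerSeries.coeff_mul_X_pow', PowerSeries.coeff_one]
  simp only [weightSeries, PowerSeries.coeff_mk, hcard]
  by_cases h0 : k = 0
  · subst h0
    simp [hc.ne']
  · rw [if_neg h0]
    by_cases hk : c ≤ k
    · rw [if_pos hk]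
      have : c ∣ k - c ↔ c ∣ k := by
        rw [Nat.dvd_sub_iff_left hk (dvd_refl c)]
      simp [this]
    · have : ¬ c ∣ k := fun hd => hk (Nat.le_of_dvd (Nat.pos_of_ne_zero h0) hd)
      simp [hk, this]

theorem finiteFibers_sum : ∀ {m : ℕ} (c : Fin m → ℕ), (∀ i, 0 < c i) →
    FiniteFibers (fun α : Fin m → ℕ => ∑ i, α i * c i)
  | 0, _, _ => fun _ => inferInstance
  | m + 1, c, hc => by
      refine ((finiteFibers_mul (hc 0)).prod
        (finiteFibers_sum (fun i : Fin m => c i.succ) fun i => hc _)).of_equiv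
        (Fin.consEquiv fun _ => ℕ).symm fun α => ?_
      rw [Fin.sum_univ_succ]
      rfl

theorem weightSeries_sum : ∀ {m : ℕ} (c : Fin m → ℕ), (∀ i, 0 < c i) →
    weightSeries (fun α : Fin m → ℕ => ∑ i, α i * c i) * ∏ i, (1 - PowerSeries.X ^ c i) = 1
  | 0, c, _ => by
      ext k
      rw [Finset.univ_eq_empty, Finset.prod_empty, mul_one, PowerSeries.coeff_one]
      simp only [weightSeries, PowerSeries.coeff_mk, Finset.sum_empty]
      split_ifs with h
      · subst h
        simp
      · have : IsEmpty {i : Fin 0 → ℕ // 0 = k} := ⟨fun i => h i.2.symm⟩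
        simp
  | m + 1, c, hc => by
      have ih := weightSeries_sum (fun i : Fin m => c i.succ) fun i => hc _
      have h0 := weightSeries_mul (hc 0)
      rw [weightSeries_congr (w := fun p : ℕ × (Fin m → ℕ) => p.1 * c 0 + ∑ i, p.2 i * c i.succ)
        (Fin.consEquiv fun _ => ℕ).symm (fun α => by rw [Fin.sum_univ_succ]; rfl),
        weightSeries_prod (w := fun i : ℕ => i * c 0)
          (w' := fun α : Fin m → ℕ => ∑ i, α i * c i.succ) (finiteFibers_mul (hc 0))
          (finiteFibers_sum (fun i : Fin m => c i.succ) fun i => hc _), Fin.prod_univ_succ]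
      calc _ = (weightSeries (fun i : ℕ => i * c 0) * (1 - PowerSeries.X ^ c 0)) *
            (weightSeries (fun α : Fin m → ℕ => ∑ i, α i * c i.succ) *
              ∏ i : Fin m, (1 - PowerSeries.X ^ c i.succ)) := by ring
        _ = 1 := by rw [ih, h0, one_mul]

theorem weightSeries_boxExp (m n : ℕ) :
    weightSeries (fun α : BoxExp m n => expWeight α.1) = boxSum PowerSeries.X m n := by
  classical
  ext k
  rw [boxSum, map_sum]
  simp only [weightSeries, PowerSeries.coeff_mk, PowerSeries.coeff_X_pow, Finset.sum_boole]
  rw [Nat.card_eq_fintype_card, Fintype.card_subtype]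
  simp only [eq_comm]

/-- There are as many monomials `X^α t^β` with `|α| ≤ n`, where `t_j` has weight `n + m - j`, as
there are monomials `X^α` without restriction. -/
theorem exists_boxExp_prod_equiv (m n : ℕ) :
    ∃ e : BoxExp m n × (Fin m → ℕ) ≃ (Fin m → ℕ),
      ∀ p, expWeight (e p) = expWeight p.1.1 + ∑ j, p.2 j * (n + m - j) := by
  have hpos : ∀ j : Fin m, 0 < n + m - (j : ℕ) := fun j => by omega
  have f1 : FiniteFibers (fun α : BoxExp m n => expWeight α.1) := fun k => inferInstance
  have f2 := finiteFibers_sum (fun j : Fin m => n + m - (j : ℕ)) hpos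
  have f3 := finiteFibers_sum (fun j : Fin m => (j : ℕ) + 1) (fun j => Nat.succ_pos _)
  refine exists_equiv_of_weightSeries_eq (f1.prod f2) f3 ?_
  rw [weightSeries_prod f1 f2, weightSeries_boxExp]
  have s2 := weightSeries_sum (fun j : Fin m => n + m - (j : ℕ)) hpos
  have s3 := weightSeries_sum (fun j : Fin m => (j : ℕ) + 1) (fun j => Nat.succ_pos _)
  have b := boxSum_mul_prod (PowerSeries.X : PowerSeries ℤ) m n
  rw [Finset.prod_range, Finset.prod_range] at b
  have e : ∏ j : Fin m, (1 - (PowerSeries.X : PowerSeries ℤ) ^ (n + m - (j : ℕ))) =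
      ∏ j : Fin m, (1 - (PowerSeries.X : PowerSeries ℤ) ^ (n + 1 + (j : ℕ))) := by
    rw [← Equiv.prod_comp Fin.revPerm]
    refine Finset.prod_congr rfl fun j _ => ?_
    congr 2
    simp only [Fin.revPerm_apply, Fin.val_rev]
    omega
  rw [e, ← b] at s2
  set u := ∏ j : Fin m, (1 - (PowerSeries.X : PowerSeries ℤ) ^ ((j : ℕ) + 1))
  -- The left side is multiplied by the series of the `X^α` times its inverse `u`. Then `boxSum * u`
  -- is the product inverse to the series of the `t^β`.
  calc _ = boxSum PowerSeries.X m n *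
        weightSeries (fun α : Fin m → ℕ => ∑ j, α j * (n + m - (j : ℕ))) *
          (weightSeries (fun α : Fin m → ℕ => ∑ j, α j * ((j : ℕ) + 1)) * u) := by
        rw [s3, mul_one]
    _ = weightSeries (fun α : Fin m → ℕ => ∑ j, α j * ((j : ℕ) + 1)) *
          (weightSeries (fun α : Fin m → ℕ => ∑ j, α j * (n + m - (j : ℕ))) *
            (boxSum PowerSeries.X m n * u)) := by ring
    _ = weightSeries (fun α : Fin m → ℕ => ∑ j, α j * ((j : ℕ) + 1)) := by rw [s2, mul_one]

/-! ## Spanning by monomials of bounded degree -/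

/-- The rearrangement inequality: a decreasing sequence paired with an increasing one minimizes the
sum, and equality would force `σ` to be monotone, hence trivial. The strictness makes the
straightening below terminate. -/
theorem strictAnti_sum_mul_lt {n : ℕ} {g : Fin n → ℤ} (hg : StrictAnti g) {σ : Equiv.Perm (Fin n)}
    (hσ : σ ≠ 1) : ∑ i, g i * (i : ℤ) < ∑ i, g (σ i) * (i : ℤ) := by
  have h : Antivary g (fun i : Fin n => ((i : ℕ) : ℤ)) := by
    intro i j hij
    have h1 : ((i : ℕ) : ℤ) < ((j : ℕ) : ℤ) := hij
    have h2 : i < j := by exact_mod_cast h1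
    exact (hg h2).le
  rw [h.sum_mul_lt_sum_comp_perm_mul_iff]
  intro h'
  refine hσ ((Equiv.Perm.monotone_iff σ).1 fun i j hij => ?_)
  rcases hij.eq_or_lt with rfl | hlt
  · exact le_rfl
  · have h1 : ((i : ℕ) : ℤ) < ((j : ℕ) : ℤ) := by exact_mod_cast hlt
    have h2 : g (σ j) ≤ g (σ i) := h' h1
    exact hg.le_iff_ge.1 h2

/-- Bounds the sum of squares while the sum stays fixed, so that the measure of the straightening
stays nonnegative. -/
theorem sum_sq_le_sq_sum {n : ℕ} {ν : Fin n → ℤ} (h : ∀ i, 0 ≤ ν i) :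
    ∑ i, ν i ^ 2 ≤ (∑ i, ν i) ^ 2 :=
  Finset.sum_sq_le_sq_sum_of_nonneg fun i _ => h i

/-- If the sequence `e` satisfies a linear recurrence of order `n` from index `1` on, then
products of `n + 1` of its terms are combinations of products of at most `n` of them. -/
theorem prod_mem_of_recurrence {Q : Type} [CommRing Q] {n : ℕ} {e : ℤ → Q} {c : Fin (n + 1) → Q}
    (hc : c (Fin.last n) = 1) (hneg : ∀ k < 0, e k = 0)
    (hrec : ∀ k : ℤ, 1 ≤ k → ∑ j : Fin (n + 1), e (k - n + j) * c j = 0) (W : AddSubgroup Q)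
    (h0 : ∀ ν : Fin (n + 1) → ℤ, (∃ i, ν i = 0) → ∏ i, e (ν i) ∈ W) (ν : Fin (n + 1) → ℤ) :
    ∏ i, e (ν i) ∈ W := by
  -- Straightening keeps `∑ ν i` and increases `∑ ν i ^ 2`, so the induction is on `(∑ ν i)² - ∑ ν
  -- i²`.
  have aux : ∀ (d : ℕ) (ν : Fin (n + 1) → ℤ), ((∑ i, ν i) ^ 2 - ∑ i, ν i ^ 2).toNat = d →
      ∏ i, e (ν i) ∈ W := by
    intro d
    induction d using Nat.strong_induction_on with
    | _ d ih =>
    intro ν hν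
    by_cases hν0 : ∃ i, ν i = 0
    · exact h0 ν hν0
    by_cases hνneg : ∃ i, ν i < 0
    · obtain ⟨i, hi⟩ := hνneg
      rw [Finset.prod_eq_zero (Finset.mem_univ i) (hneg _ hi)]
      exact zero_mem _
    have hpos : ∀ i, 1 ≤ ν i := by
      intro i
      by_contra h
      rcases lt_trichotomy (ν i) 0 with h' | h' | h'
      · exact hνneg ⟨i, h'⟩
      · exact hν0 ⟨i, h'⟩
      · omega
    let τ : Equiv.Perm (Fin (n + 1)) := Fin.revPerm.trans (Tuple.sort ν)
    let μ : Fin (n + 1) → ℤ := fun i => ν (τ i)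
    have hμ : Antitone μ := fun i j hij =>
      Tuple.monotone_sort ν (Fin.rev_le_rev.2 hij : Fin.rev j ≤ Fin.rev i)
    have e1 : ∏ i, e (ν i) = ∏ i, e (μ i) := (Equiv.prod_comp τ fun i => e (ν i)).symm
    have e2 : ∑ i, ν i = ∑ i, μ i := (Equiv.sum_comp τ ν).symm
    have e3 : ∑ i, ν i ^ 2 = ∑ i, μ i ^ 2 := (Equiv.sum_comp τ fun i => ν i ^ 2).symm
    let g : Fin (n + 1) → ℤ := fun i => μ i - i
    have hg : StrictAnti g := by
      intro i j hij
      have h1 := hμ hij.le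
      have h2 : (i : ℤ) < j := by exact_mod_cast hij
      simp only [g]
      omega
    -- A matrix of Jacobi-Trudi type. Its diagonal entries are `e (μ i)`, and row `i` is a window of
    -- length `n + 1` of the sequence. The recurrence applies to it at the index `g i + n = μ i + n
    -- - i`, which is at least 1.
    let M : Matrix (Fin (n + 1)) (Fin (n + 1)) Q := fun i j => e (g i + j)
    have hMc : M.mulVec c = 0 := by
      funext i
      have := hrec (g i + n) (by
        have h1 : 1 ≤ μ i := hpos (τ i)
        have h2 : (i : ℕ) ≤ n := Nat.lt_succ_iff.1 i.2
        simp only [g]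
        omega)
      rw [Pi.zero_apply, ← this, Matrix.mulVec, dotProduct]
      refine Finset.sum_congr rfl fun j _ => ?_
      simp only [M]
      congr 2
      ring
    -- `M` kills `c`, hence so does `det M`, and the last coordinate of `c` is 1. No division is
    -- needed.
    have hdet : M.det = 0 := by
      have h1 : (M.adjugate * M).mulVec c = 0 := by
        rw [← Matrix.mulVec_mulVec, hMc, Matrix.mulVec_zero]
      rw [Matrix.adjugate_mul, Matrix.smul_mulVec, Matrix.one_mulVec] at h1
      have := congrFun h1 (Fin.last n)
      simpa [hc] using this
    -- In the expansion of the zero determinant the identity permutation gives the product in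
    -- question, and every other permutation gives a product with the same index sum and a larger
    -- sum of squares.
    rw [Matrix.det_apply, ← Finset.add_sum_erase _ _ (Finset.mem_univ 1)] at hdet
    have hone : ∏ i, M ((1 : Equiv.Perm (Fin (n + 1))) i) i = ∏ i, e (μ i) :=
      Finset.prod_congr rfl fun i _ => by simp [M, g]
    rw [hone, Equiv.Perm.sign_one, one_smul] at hdet
    rw [e1, eq_neg_of_add_eq_zero_left hdet]
    refine neg_mem (sum_mem fun σ hσ => ?_)
    have hσ1 : σ ≠ 1 := (Finset.mem_erase.1 hσ).1
    have hmem : ∏ i, M (σ i) i ∈ W := by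
      -- A negative index makes the product zero. Otherwise the new sum of squares is at most the
      -- square of the sum, so the measure strictly drops even after truncation by `toNat`.
      by_cases hneg' : ∃ i : Fin (n + 1), g (σ i) + (i : ℤ) < 0
      · obtain ⟨i, hi⟩ := hneg'
        rw [Finset.prod_eq_zero (Finset.mem_univ i) (hneg _ hi)]
        exact zero_mem _
      · have hnn : ∀ i : Fin (n + 1), 0 ≤ g (σ i) + (i : ℤ) := fun i => by
          by_contra h
          exact hneg' ⟨i, not_le.1 h⟩
        refine ih _ ?_ (fun i => g (σ i) + i) rfl
        have s1 : ∑ i : Fin (n + 1), (g (σ i) + (i : ℤ)) = ∑ i, μ i := by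
          rw [Finset.sum_add_distrib, Equiv.sum_comp σ g, ← Finset.sum_add_distrib]
          exact Finset.sum_congr rfl fun i _ => by simp [g]
        have s2 : ∑ i : Fin (n + 1), μ i ^ 2 < ∑ i : Fin (n + 1), (g (σ i) + (i : ℤ)) ^ 2 := by
          have h1 : ∀ i : Fin (n + 1), (g (σ i) + (i : ℤ)) ^ 2 =
              g (σ i) ^ 2 + (i : ℤ) ^ 2 + 2 * (g (σ i) * (i : ℤ)) := fun i => by ring
          have h2 : ∀ i : Fin (n + 1), μ i ^ 2 =
              g i ^ 2 + (i : ℤ) ^ 2 + 2 * (g i * (i : ℤ)) := fun i => by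
            simp only [g]
            ring
          simp only [h1, h2, Finset.sum_add_distrib, ← Finset.mul_sum]
          rw [Equiv.sum_comp σ (fun i => g i ^ 2)]
          have := strictAnti_sum_mul_lt hg hσ1
          linarith
        have s3 := sum_sq_le_sq_sum hnn
        rw [s1] at s3 ⊢
        rw [← hν, e2, e3]
        omega
    rcases Int.units_eq_one_or (Equiv.Perm.sign σ) with h | h <;> rw [h]
    · simpa using hmem
    · simpa using hmem
  exact aux _ ν rfl

/-- The sequence `1, x₁, …, x_m`, extended by zero to all integer indices. -/
def extSeq {Q : Type} [CommRing Q] {m : ℕ} (x : Fin m → Q) (k : ℤ) : Q :=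
  if k = 0 then 1 else if h : 0 < k ∧ k ≤ m then x ⟨k.toNat - 1, by omega⟩ else 0

section ExtSeq

variable {Q : Type} [CommRing Q] {m : ℕ} (x : Fin m → Q)

theorem extSeq_zero : extSeq x 0 = 1 := by simp [extSeq]

theorem extSeq_of_neg {k : ℤ} (hk : k < 0) : extSeq x k = 0 := by
  rw [extSeq, if_neg hk.ne, dif_neg (by omega)]

theorem extSeq_of_gt {k : ℤ} (hk : (m : ℤ) < k) : extSeq x k = 0 := by
  rw [extSeq, if_neg (by omega), dif_neg (by omega)]

theorem extSeq_succ (i : Fin m) : extSeq x ((i : ℤ) + 1) = x i := by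
  have h : 0 < (i : ℤ) + 1 ∧ (i : ℤ) + 1 ≤ m := by
    have := i.2
    omega
  rw [extSeq, if_neg (by omega), dif_pos h]
  congr 1

theorem map_extSeq {Q' : Type} [CommRing Q'] (f : Q →+* Q') (k : ℤ) :
    f (extSeq x k) = extSeq (fun i => f (x i)) k := by
  unfold extSeq
  split_ifs <;> simp

theorem extSeq_cases (k : ℤ) : extSeq x k = 0 ∨ extSeq x k = 1 ∨ ∃ i, extSeq x k = x i := by
  unfold extSeq
  split_ifs
  · exact Or.inr (Or.inl rfl)
  · exact Or.inr (Or.inr ⟨_, rfl⟩)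
  · exact Or.inl rfl

theorem prod_pow_add_single (α : Fin m → ℕ) (j : Fin m) :
    ∏ i, x i ^ (α + Pi.single j 1 : Fin m → ℕ) i = x j * ∏ i, x i ^ α i := by
  simp only [Pi.add_apply, pow_add, Finset.prod_mul_distrib]
  rw [mul_comm]
  congr 1
  rw [Finset.prod_eq_single j (fun i _ hi => by simp [hi]) (by simp)]
  simp

theorem prod_extSeq {ι : Type} (s : Finset ι) (ν : ι → ℤ) :
    ∏ i ∈ s, extSeq x (ν i) = 0 ∨
      ∃ α : Fin m → ℕ, ∑ i, α i ≤ s.card ∧ ∏ i ∈ s, extSeq x (ν i) = ∏ i, x i ^ α i := by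
  classical
  induction s using Finset.induction_on with
  | empty => exact Or.inr ⟨0, by simp, by simp⟩
  | insert a s ha ih =>
    rw [Finset.prod_insert ha, Finset.card_insert_of_notMem ha]
    rcases ih with h | ⟨α, hα, h⟩
    · rw [h, mul_zero]
      exact Or.inl rfl
    rcases extSeq_cases x (ν a) with h' | h' | ⟨j, h'⟩
    · rw [h', zero_mul]
      exact Or.inl rfl
    · rw [h', one_mul]
      exact Or.inr ⟨α, by omega, h⟩
    · refine Or.inr ⟨α + Pi.single j 1, ?_, ?_⟩
      · rw [sum_add_single]
        omega
      · rw [prod_pow_add_single, h', h]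

/-- A monomial of degree less than `n` is padded with factors `extSeq x 0 = 1`. -/
theorem exists_prod_extSeq : ∀ (n : ℕ) (α : Fin m → ℕ), ∑ i, α i ≤ n →
    ∃ ν : Fin n → ℤ, ∏ i, x i ^ α i = ∏ i, extSeq x (ν i)
  | 0, α, h => by
      have : ∀ i, α i = 0 := by simpa using h
      exact ⟨0, by simp [this]⟩
  | n + 1, α, h => by
      by_cases h0 : ∀ i, α i = 0
      · exact ⟨0, by simp [h0, extSeq_zero]⟩
      · push Not at h0
        obtain ⟨j, hj⟩ := h0
        have e : (α - Pi.single j 1) + Pi.single j 1 = α := by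
          funext i
          by_cases hi : i = j
          · subst hi
            simp
            omega
          · simp [hi]
        obtain ⟨ν, hν⟩ := exists_prod_extSeq n (α - Pi.single j 1) (by
          rw [← e, sum_add_single] at h
          omega)
        refine ⟨Fin.cons ((j : ℤ) + 1) ν, ?_⟩
        rw [← e, prod_pow_add_single, hν, Fin.prod_univ_succ]
        simp [extSeq_succ]

end ExtSeq

/-- If `∑ⱼ (-1)^j x_j η_(k-j) = 0` for `k ≥ 1` and `η_k = 0` for `k > n`, the monomials in the `x_j`
of degree at most `n` span the algebra that the `x_j` generate. -/
theorem span_monomials_eq_top {K Q : Type} [CommRing K] [CommRing Q] [Algebra K Q] {m n : ℕ}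
    (x : Fin m → Q) (hgen : Algebra.adjoin K (Set.range x) = ⊤) (η : ℕ → Q) (hη0 : η 0 = 1)
    (hη : ∀ k, n < k → η k = 0)
    (hrec : ∀ k : ℕ, 1 ≤ k →
      ∑ j ∈ Finset.range (k + 1), (-1) ^ j * extSeq x j * η (k - j) = 0) :
    Submodule.span K (Set.range fun α : BoxExp m n => ∏ i, x i ^ α.1 i) = ⊤ := by
  set W := Submodule.span K (Set.range fun α : BoxExp m n => ∏ i, x i ^ α.1 i)
  have hW : ∀ ν : Fin (n + 1) → ℤ, ∏ i, extSeq x (ν i) ∈ W.toAddSubgroup := by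
    -- The coefficients are the alternating `η` in reverse order, because `hrec` is read as a
    -- recurrence for the `x_j`. The last coefficient is `η 0 = 1`.
    refine prod_mem_of_recurrence (c := fun j => (-1) ^ (n - (j : ℕ)) * η (n - j)) (by simp [hη0])
      (fun k hk => extSeq_of_neg x hk) ?_ _ ?_
    · intro k hk
      obtain ⟨k, rfl⟩ := Int.eq_ofNat_of_zero_le (show 0 ≤ k by omega)
      have hk' : 1 ≤ k := by exact_mod_cast hk
      have h1 := hrec k hk'
      rw [← Finset.sum_range_reflect] at h1
      have h2 : ∀ l ∈ Finset.range (k + 1), (-1 : Q) ^ (k + 1 - 1 - l) *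
          extSeq x ((k + 1 - 1 - l : ℕ) : ℤ) * η (k - (k + 1 - 1 - l)) =
          (-1) ^ k * ((-1) ^ l * extSeq x ((k : ℤ) - l) * η l) := by
        intro l hl
        have hl' : l ≤ k := by simpa [Nat.lt_succ_iff] using hl
        obtain ⟨p, rfl⟩ := Nat.exists_eq_add_of_le hl'
        have e1 : l + p + 1 - 1 - l = p := by omega
        have e2 : l + p - p = l := by omega
        have e3 : ((l + p : ℕ) : ℤ) - l = (p : ℕ) := by
          push_cast
          ring
        have e4 : (-1 : Q) ^ (l + p) * (-1) ^ l = (-1) ^ p := by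
          rw [pow_add, mul_right_comm, ← pow_add, ← two_mul, pow_mul]
          simp
        rw [e1, e2, e3, ← mul_assoc, ← mul_assoc, e4]
      rw [Finset.sum_congr rfl h2, ← Finset.mul_sum] at h1
      have h3 : ∑ l ∈ Finset.range (k + 1), (-1 : Q) ^ l * extSeq x ((k : ℤ) - l) * η l = 0 := by
        have := congrArg (fun z => (-1 : Q) ^ k * z) h1
        simpa [← mul_assoc, ← pow_add, ← two_mul, pow_mul] using this
      -- The range changes from `k + 1` to `n + 1` terms in either direction: `η l` vanishes for `l
      -- > n`, and `extSeq x (k - l)` vanishes for `l > k`.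
      have h4 : ∑ l ∈ Finset.range (n + 1), (-1 : Q) ^ l * extSeq x ((k : ℤ) - l) * η l = 0 := by
        rw [← h3]
        have hsub : ∀ (a b : ℕ), a ≤ b → (∀ l, a ≤ l → l < b →
            (-1 : Q) ^ l * extSeq x ((k : ℤ) - l) * η l = 0) →
            ∑ l ∈ Finset.range a, (-1 : Q) ^ l * extSeq x ((k : ℤ) - l) * η l =
            ∑ l ∈ Finset.range b, (-1 : Q) ^ l * extSeq x ((k : ℤ) - l) * η l := by
          intro a b hab h
          refine Finset.sum_subset (Finset.range_subset_range.2 hab) fun l hl hl' => ?_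
          exact h l (by simpa using hl') (by simpa using hl)
        rcases le_total n k with h | h
        · exact hsub _ _ (by omega) fun l hl _ => by rw [hη l (by omega), mul_zero]
        · exact (hsub _ _ (by omega) fun l hl _ => by
            rw [extSeq_of_neg x (by omega), mul_zero, zero_mul]).symm
      rw [← h4, Finset.sum_range, ← Equiv.sum_comp Fin.revPerm]
      refine Finset.sum_congr rfl fun l _ => ?_
      have hl : (l : ℕ) ≤ n := Nat.lt_succ_iff.1 l.2
      have e1 : n - ((Fin.revPerm l : Fin (n + 1)) : ℕ) = l := by
        simp only [Fin.revPerm_apply, Fin.val_rev]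
        omega
      have e2 : (((k : ℕ) : ℤ) - n + ((Fin.revPerm l : Fin (n + 1)) : ℕ)) = k - l := by
        simp only [Fin.revPerm_apply, Fin.val_rev]
        omega
      rw [e1]
      change extSeq x (((k : ℕ) : ℤ) - n + ((Fin.revPerm l : Fin (n + 1)) : ℕ)) * _ = _
      rw [e2]
      ring
    · rintro ν ⟨i, hi⟩
      rw [← Finset.mul_prod_erase _ _ (Finset.mem_univ i), hi, extSeq_zero, one_mul]
      rcases prod_extSeq x (Finset.univ.erase i) ν with h | ⟨α, hα, h⟩
      · rw [h]
        exact zero_mem _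
      · rw [h]
        refine Submodule.subset_span ⟨⟨α, hα.trans ?_⟩, rfl⟩
        rw [Finset.card_erase_of_mem (Finset.mem_univ i)]
        simp
  -- A monomial of degree at most `n`, padded to `n` terms and multiplied by `x j`, is a product of
  -- `n + 1` terms of the sequence, so `hW` applies. Hence `W` is stable under the generators, and
  -- it contains 1.
  have hmul : ∀ (j : Fin m) (y : Q), y ∈ W → x j * y ∈ W := by
    intro j y hy
    induction hy using Submodule.span_induction with
    | mem y hy =>
      obtain ⟨α, rfl⟩ := hy
      obtain ⟨ν, hν⟩ := exists_prod_extSeq x n α.1 α.2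
      have := hW (Fin.cons ((j : ℤ) + 1) ν)
      rw [Fin.prod_univ_succ] at this
      simp only [Fin.cons_zero, Fin.cons_succ, extSeq_succ, ← hν] at this
      exact this
    | zero => rw [mul_zero]; exact zero_mem _
    | add y z _ _ hy hz => rw [mul_add]; exact add_mem hy hz
    | smul r y _ hy => rw [mul_smul_comm]; exact W.smul_mem r hy
  have hone : (1 : Q) ∈ W := Submodule.subset_span ⟨⟨0, by simp⟩, by simp⟩
  rw [eq_top_iff]
  rintro y -
  have hy : y ∈ Algebra.adjoin K (Set.range x) := by rw [hgen]; trivial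
  have : ∀ z ∈ W, y * z ∈ W := by
    induction hy using Algebra.adjoin_induction with
    | mem y hy =>
      obtain ⟨j, rfl⟩ := hy
      exact hmul j
    | algebraMap r =>
      intro z hz
      rw [← Algebra.smul_def]
      exact W.smul_mem r hz
    | add y z _ _ hy hz =>
      intro w hw
      rw [add_mul]
      exact add_mem (hy w hw) (hz w hw)
    | mul y z _ _ hy hz =>
      intro w hw
      rw [mul_assoc]
      exact hy _ (hz w hw)
  simpa using this 1 hone

section

/-! ## The polynomial ring as a free module over a polynomial subring -/

namespace MvPolynomial

theorem weightedHomogeneousComponent_mul_of_mem {σ K : Type} [CommRing K] {w : σ → ℕ}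
    (d : ℕ) {e : ℕ} (a : MvPolynomial σ K) {t : MvPolynomial σ K}
    (ht : IsWeightedHomogeneous w t e) :
    weightedHomogeneousComponent w d (a * t) =
      if e ≤ d then weightedHomogeneousComponent w (d - e) a * t else 0 := by
  let _ := weightedGradedAlgebra K w
  have h := DirectSum.coe_decompose_mul_of_right_mem (weightedHomogeneousSubmodule K w) d
    (a := a) (b := t) ht
  have e1 : ∀ (p : MvPolynomial σ K) (k : ℕ),
      ((DirectSum.decompose (weightedHomogeneousSubmodule K w) p) k : MvPolynomial σ K) =
        weightedHomogeneousComponent w k p := fun p k =>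
    weightedDecomposition.decompose'_apply K w p k
  rw [e1, e1] at h
  exact h

end MvPolynomial

open MvPolynomial

/-- A surjective graded endomorphism of a polynomial ring in variables of positive weight is
injective. -/
theorem injective_of_surjective_of_graded {σ K : Type} [Finite σ] [Field K] {w : σ → ℕ}
    (hw : ∀ i, w i ≠ 0) (T : MvPolynomial σ K →ₗ[K] MvPolynomial σ K)
    (hT : ∀ s : σ →₀ ℕ, IsWeightedHomogeneous w (T (monomial s 1)) (Finsupp.weight w s))
    (hsurj : Function.Surjective T) : Function.Injective T := by
  classical
  have hcomm : ∀ d p, weightedHomogeneousComponent w d (T p) =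
      T (weightedHomogeneousComponent w d p) := by
    intro d p
    have : weightedHomogeneousComponent w d ∘ₗ T = T ∘ₗ weightedHomogeneousComponent w d := by
      refine (basisMonomials σ K).ext fun s => ?_
      rw [coe_basisMonomials, LinearMap.comp_apply, LinearMap.comp_apply]
      rw [weightedHomogeneousComponent_of_mem (hT s),
        weightedHomogeneousComponent_of_mem (isWeightedHomogeneous_monomial w s 1 rfl)]
      split_ifs <;> simp
    exact LinearMap.congr_fun this p
  have hmaps : ∀ d, ∀ p ∈ weightedHomogeneousSubmodule K w d,
      T p ∈ weightedHomogeneousSubmodule K w d := by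
    intro d p hp
    have h1 : weightedHomogeneousComponent w d p = p := by
      rw [weightedHomogeneousComponent_of_mem hp, if_pos rfl]
    rw [← h1, ← hcomm]
    exact weightedHomogeneousComponent_mem w _ d
  rw [injective_iff_map_eq_zero]
  intro p hp
  rw [← sum_weightedHomogeneousComponent w p]
  refine finsum_eq_zero_of_forall_eq_zero fun d => ?_
  -- Positivity of the weights leaves finitely many monomials of each weight, so on each piece
  -- surjective implies injective.
  have : FiniteDimensional K (weightedHomogeneousSubmodule K w d) :=
    Module.Finite.iff_fg.2 (weightedHomogeneousSubmodule_fg K w hw d)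
  let Td := T.restrict (hmaps d)
  have hTd : Function.Surjective Td := by
    rintro ⟨q, hq⟩
    obtain ⟨r, hr⟩ := hsurj q
    refine ⟨⟨weightedHomogeneousComponent w d r, weightedHomogeneousComponent_mem w r d⟩, ?_⟩
    refine Subtype.ext ?_
    change T (weightedHomogeneousComponent w d r) = q
    rw [← hcomm, hr, weightedHomogeneousComponent_of_mem hq, if_pos rfl]
  have hinj := LinearMap.injective_iff_surjective.2 hTd
  have h0 : Td ⟨weightedHomogeneousComponent w d p,
      weightedHomogeneousComponent_mem w p d⟩ = 0 := by
    refine Subtype.ext ?_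
    change T (weightedHomogeneousComponent w d p) = 0
    rw [← hcomm, hp, map_zero]
  have := congrArg Subtype.val (hinj (h0.trans (map_zero Td).symm))
  exact this

/-! ### The monomials `X^α t^β B^γ` as a basis over the complex numbers -/

section Polynomial

variable {m N : ℕ}

/-- The weights of the variables `X_(i+1)` and `B_(k+1)`. -/
def varWeight (m N : ℕ) : Fin m ⊕ Fin N → ℕ := Sum.elim (fun i => (i : ℕ) + 1) fun k => (k : ℕ) + 1

theorem varWeight_ne_zero (i : Fin m ⊕ Fin N) : varWeight m N i ≠ 0 := by
  rcases i with i | i <;> simp [varWeight]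

variable (m N) in
/-- The variables `X_(i+1)`. -/
def varX (i : Fin m) : MvPolynomial (Fin m ⊕ Fin N) ℂ := X (Sum.inl i)

variable (m N) in
/-- The variables `B_(k+1)`. -/
def varB (k : Fin N) : MvPolynomial (Fin m ⊕ Fin N) ℂ := X (Sum.inr k)

/-- `η` satisfies the recurrence that characterizes `h_k(𝕏 - 𝔹)` in terms of the elementary
symmetric polynomials `x` in `𝕏` and `B` in `𝔹`. -/
def IsCompleteSeq {Q : Type} [CommRing Q] (x : Fin m → Q) (B : Fin N → Q) (η : ℕ → Q) : Prop :=
  ∀ k, ∑ j ∈ Finset.range (k + 1), (-1) ^ j * extSeq x j * η (k - j) = (-1) ^ k * extSeq B k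

theorem IsCompleteSeq.apply_zero {Q : Type} [CommRing Q] {x : Fin m → Q} {B : Fin N → Q} {η : ℕ → Q}
    (h : IsCompleteSeq x B η) : η 0 = 1 := by
  simpa [extSeq_zero] using h 0

theorem IsCompleteSeq.apply_eq {Q : Type} [CommRing Q] {x : Fin m → Q} {B : Fin N → Q} {η : ℕ → Q}
    (h : IsCompleteSeq x B η) (k : ℕ) : η k = (-1) ^ k * extSeq B k -
      ∑ j ∈ Finset.range k, (-1) ^ (j + 1) * extSeq x ((j + 1 : ℕ) : ℤ) * η (k - (j + 1)) := by
  have := h k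
  rw [Finset.sum_range_succ'] at this
  rw [← this]
  simp [extSeq_zero]

theorem IsCompleteSeq.map {Q Q' : Type} [CommRing Q] [CommRing Q'] {x : Fin m → Q} {B : Fin N → Q}
    {η : ℕ → Q} (h : IsCompleteSeq x B η) (f : Q →+* Q') :
    IsCompleteSeq (fun i => f (x i)) (fun k => f (B k)) (fun k => f (η k)) := by
  intro k
  have := congrArg f (h k)
  simpa only [map_sum, map_mul, map_pow, map_neg, map_one, map_extSeq] using this

theorem isWeightedHomogeneous_extSeq_varX (k : ℕ) :
    IsWeightedHomogeneous (varWeight m N) (extSeq (varX m N) k) k := by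
  rcases k with _ | k
  · rw [Nat.cast_zero, extSeq_zero]
    exact isWeightedHomogeneous_one ℂ _
  by_cases hk : k < m
  · have h := extSeq_succ (varX m N) ⟨k, hk⟩
    rw [Nat.cast_succ, h]
    exact isWeightedHomogeneous_X ℂ (varWeight m N) (Sum.inl ⟨k, hk⟩)
  · rw [extSeq_of_gt _ (by omega)]
    exact isWeightedHomogeneous_zero ℂ _ _

theorem isWeightedHomogeneous_extSeq_varB (k : ℕ) :
    IsWeightedHomogeneous (varWeight m N) (extSeq (varB m N) k) k := by
  rcases k with _ | k
  · rw [Nat.cast_zero, extSeq_zero]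
    exact isWeightedHomogeneous_one ℂ _
  by_cases hk : k < N
  · have h := extSeq_succ (varB m N) ⟨k, hk⟩
    rw [Nat.cast_succ, h]
    exact isWeightedHomogeneous_X ℂ (varWeight m N) (Sum.inr ⟨k, hk⟩)
  · rw [extSeq_of_gt _ (by omega)]
    exact isWeightedHomogeneous_zero ℂ _ _

theorem isWeightedHomogeneous_neg_one_pow_mul {σ : Type} {w : σ → ℕ} {p : MvPolynomial σ ℂ}
    {d : ℕ} (k : ℕ) (hp : IsWeightedHomogeneous w p d) :
    IsWeightedHomogeneous w ((-1) ^ k * p) d := by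
  rcases neg_one_pow_eq_or (MvPolynomial σ ℂ) k with h | h <;> rw [h]
  · rwa [one_mul]
  · rw [neg_one_mul]
    exact hp.neg

theorem IsCompleteSeq.isWeightedHomogeneous {η : ℕ → MvPolynomial (Fin m ⊕ Fin N) ℂ}
    (h : IsCompleteSeq (varX m N) (varB m N) η) (k : ℕ) :
    IsWeightedHomogeneous (varWeight m N) (η k) k := by
  induction k using Nat.strong_induction_on with
  | _ k ih =>
  rw [h.apply_eq]
  refine (isWeightedHomogeneous_neg_one_pow_mul k (isWeightedHomogeneous_extSeq_varB k)).sub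
    (IsWeightedHomogeneous.sum _ _ _ fun j hj => ?_)
  have hj' : j < k := Finset.mem_range.1 hj
  rw [mul_assoc]
  refine isWeightedHomogeneous_neg_one_pow_mul _ ?_
  have := (isWeightedHomogeneous_extSeq_varX (N := N) (m := m) (j + 1)).mul
    (ih (k - (j + 1)) (by omega))
  convert this using 1
  omega

variable {n : ℕ}

/-- Indices of the monomials `X^α t^β B^γ`. -/
abbrev MonoIndex (m n N : ℕ) : Type := (BoxExp m n × (Fin m → ℕ)) × (Fin N → ℕ)

/-- The monomial `X^α t^β B^γ`. -/
def mono (t : Fin m → MvPolynomial (Fin m ⊕ Fin N) ℂ) (p : MonoIndex m n N) :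
    MvPolynomial (Fin m ⊕ Fin N) ℂ :=
  (∏ i, varX m N i ^ p.1.1.1 i) * (∏ j, t j ^ p.1.2 j) * ∏ k, varB m N k ^ p.2 k

/-- The weight of the monomial `X^α t^β B^γ`. -/
def monoWeight (p : MonoIndex m n N) : ℕ :=
  expWeight p.1.1.1 + ∑ j, p.1.2 j * (n + m - j) + ∑ k, p.2 k * ((k : ℕ) + 1)

theorem isWeightedHomogeneous_prod_varX (α : Fin m → ℕ) :
    IsWeightedHomogeneous (varWeight m N) (∏ i, varX m N i ^ α i) (expWeight α) := by
  refine IsWeightedHomogeneous.prod _ _ _ fun i _ => ?_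
  exact (isWeightedHomogeneous_X ℂ (varWeight m N) (Sum.inl i)).pow (α i)

theorem isWeightedHomogeneous_mono {t : Fin m → MvPolynomial (Fin m ⊕ Fin N) ℂ}
    (ht : ∀ j : Fin m, IsWeightedHomogeneous (varWeight m N) (t j) (n + m - j))
    (p : MonoIndex m n N) :
    IsWeightedHomogeneous (varWeight m N) (mono t p) (monoWeight p) := by
  refine ((isWeightedHomogeneous_prod_varX _).mul
    (IsWeightedHomogeneous.prod _ _ _ fun j _ => ?_)).mul
    (IsWeightedHomogeneous.prod _ _ _ fun k _ => ?_)
  · exact (ht j).pow (p.1.2 j)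
  · exact (isWeightedHomogeneous_X ℂ (varWeight m N) (Sum.inr k)).pow (p.2 k)

theorem mul_mono_left (t : Fin m → MvPolynomial (Fin m ⊕ Fin N) ℂ) (p : MonoIndex m n N)
    (j : Fin m) : mono t p * t j = mono t ((p.1.1, p.1.2 + Pi.single j 1), p.2) := by
  simp only [mono, prod_pow_add_single]
  ring

theorem mul_mono_right (t : Fin m → MvPolynomial (Fin m ⊕ Fin N) ℂ) (p : MonoIndex m n N)
    (k : Fin N) : mono t p * varB m N k = mono t (p.1, p.2 + Pi.single k 1) := by
  simp only [mono, prod_pow_add_single]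
  ring

/-- The assumptions on `t`: up to nonzero constants it consists of `η_(N-j)`, `0 ≤ j < m`. -/
def IsTopPart (c : Fin m → ℂ) (η : ℕ → MvPolynomial (Fin m ⊕ Fin N) ℂ)
    (t : Fin m → MvPolynomial (Fin m ⊕ Fin N) ℂ) : Prop :=
  ∀ j : Fin m, c j ≠ 0 ∧ t j = C (c j) * η (N - j)

/-- In the quotient by the `t_j` and the `B_k` the recurrence has zero right-hand side in positive
degrees and `η k` vanishes for `k > n`, so `span_monomials_eq_top` applies to the images of the
`X_i`. -/
theorem exists_sub_mem_ideal (hN : N = n + m) {c : Fin m → ℂ}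
    {η : ℕ → MvPolynomial (Fin m ⊕ Fin N) ℂ} {t : Fin m → MvPolynomial (Fin m ⊕ Fin N) ℂ}
    (hη : IsCompleteSeq (varX m N) (varB m N) η) (ht : IsTopPart c η t)
    (g : MvPolynomial (Fin m ⊕ Fin N) ℂ) :
    ∃ w ∈ Submodule.span ℂ (Set.range fun α : BoxExp m n => ∏ i, varX m N i ^ α.1 i),
      g - w ∈ Ideal.span (Set.range t) ⊔ Ideal.span (Set.range (varB m N)) := by
  set I := Ideal.span (Set.range t) ⊔ Ideal.span (Set.range (varB m N))
  let q := Ideal.Quotient.mkₐ ℂ I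
  have hqs : Function.Surjective q := Ideal.Quotient.mkₐ_surjective ℂ I
  have hB : ∀ k, q (varB m N k) = 0 := fun k => Ideal.Quotient.eq_zero_iff_mem.2
    (Ideal.mem_sup_right (Ideal.subset_span ⟨k, rfl⟩))
  have ht' : ∀ j : Fin m, q (η (N - j)) = 0 := fun j => by
    have h1 : q (t j) = 0 := Ideal.Quotient.eq_zero_iff_mem.2
      (Ideal.mem_sup_left (Ideal.subset_span ⟨j, rfl⟩))
    have h2 : η (N - j) = C (c j)⁻¹ * t j := by
      rw [(ht j).2, ← mul_assoc, ← C_mul, inv_mul_cancel₀ (ht j).1, C_1, one_mul]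
    rw [h2, map_mul, h1, mul_zero]
  have hηq := hη.map q.toRingHom
  have hBk : ∀ k : ℕ, 1 ≤ k → extSeq (fun k => q (varB m N k)) (k : ℤ) = 0 := by
    intro k hk
    rcases extSeq_cases (fun k => q (varB m N k)) (k : ℤ) with h | h | ⟨i, h⟩
    · exact h
    · unfold extSeq at h ⊢
      rw [if_neg (by omega)] at h ⊢
      split_ifs
      · exact hB _
      · rfl
    · rw [h, hB]
  -- For `n < k ≤ N` this is the vanishing of some `t_j`. Beyond `N` the recurrence expresses `η k`
  -- by the `m` preceding terms, whose indices still exceed `n`.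
  have hvan : ∀ k, n < k → q (η k) = 0 := by
    intro k
    induction k using Nat.strong_induction_on with
    | _ k ih =>
    intro hk
    by_cases hkN : k ≤ N
    · have := ht' ⟨N - k, by omega⟩
      have e : N - (N - k) = k := by omega
      simpa only [e] using this
    · have h1 := hηq.apply_eq k
      simp only [AlgHom.toRingHom_eq_coe, RingHom.coe_coe] at h1
      rw [h1, hBk k (by omega), mul_zero, zero_sub, neg_eq_zero]
      refine Finset.sum_eq_zero fun j hj => ?_
      have hj' : j < k := Finset.mem_range.1 hj
      by_cases hjm : j + 1 ≤ m
      · rw [ih (k - (j + 1)) (by omega) (by omega), mul_zero]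
      · rw [extSeq_of_gt _ (by omega), mul_zero, zero_mul]
  have hgen : Algebra.adjoin ℂ (Set.range fun i => q (varX m N i)) = ⊤ := by
    rw [eq_top_iff]
    rintro y -
    obtain ⟨p, rfl⟩ := hqs y
    induction p using MvPolynomial.induction_on with
    | C a =>
      have : q (C a) = algebraMap ℂ _ a := q.commutes a
      rw [this]
      exact Subalgebra.algebraMap_mem _ a
    | add p r hp hr => rw [map_add]; exact add_mem hp hr
    | mul_X p i hp =>
      rw [map_mul]
      refine mul_mem hp ?_
      rcases i with i | k
      · exact Algebra.subset_adjoin ⟨i, rfl⟩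
      · have := hB k
        rw [varB] at this
        rw [this]
        exact zero_mem _
  have key := span_monomials_eq_top (n := n) (fun i => q (varX m N i)) hgen (fun k => q (η k))
    (by rw [hη.apply_zero, map_one]) hvan (fun k hk => by
      have := hηq k
      simp only [AlgHom.toRingHom_eq_coe, RingHom.coe_coe] at this
      rw [this, hBk k hk, mul_zero])
  have hmap : Submodule.span ℂ (Set.range fun α : BoxExp m n => ∏ i, q (varX m N i) ^ α.1 i) =
      (Submodule.span ℂ (Set.range fun α : BoxExp m n => ∏ i, varX m N i ^ α.1 i)).map
        q.toLinearMap := by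
    rw [Submodule.map_span, ← Set.range_comp]
    congr 2
    funext α
    simp
  rw [hmap] at key
  obtain ⟨w, hw, hwg⟩ : q g ∈ Submodule.map q.toLinearMap _ := key ▸ Submodule.mem_top
  refine ⟨w, hw, Ideal.Quotient.eq_zero_iff_mem.1 ?_⟩
  change q (g - w) = 0
  rw [map_sub, sub_eq_zero]
  exact hwg.symm

/-- The graded Nakayama argument. A homogeneous `p` is a combination of the `X^α` plus multiples of
the `t_j` and `B_k`. In the component of its weight the cofactors have smaller weight, since `t_j`
and `B_k` have positive weight, so induction applies to them. -/
theorem span_mono_eq_top (hN : N = n + m) {c : Fin m → ℂ}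
    {η : ℕ → MvPolynomial (Fin m ⊕ Fin N) ℂ} {t : Fin m → MvPolynomial (Fin m ⊕ Fin N) ℂ}
    (hη : IsCompleteSeq (varX m N) (varB m N) η) (ht : IsTopPart c η t) :
    Submodule.span ℂ (Set.range fun p : MonoIndex m n N => mono t p) = ⊤ := by
  classical
  set W := Submodule.span ℂ (Set.range fun p : MonoIndex m n N => mono t p)
  have hmul : ∀ z : MvPolynomial (Fin m ⊕ Fin N) ℂ,
      (∀ p : MonoIndex m n N, mono t p * z ∈ W) → ∀ y ∈ W, y * z ∈ W := by
    intro z hz y hy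
    induction hy using Submodule.span_induction with
    | mem y hy =>
      obtain ⟨p, rfl⟩ := hy
      exact hz p
    | zero => rw [zero_mul]; exact zero_mem _
    | add y y' _ _ h h' => rw [add_mul]; exact add_mem h h'
    | smul r y _ h => rw [smul_mul_assoc]; exact W.smul_mem r h
  have hmt : ∀ (j : Fin m), ∀ y ∈ W, y * t j ∈ W := fun j => hmul _ fun p =>
    Submodule.subset_span ⟨_, (mul_mono_left t p j).symm⟩
  have hmB : ∀ (k : Fin N), ∀ y ∈ W, y * varB m N k ∈ W := fun k => hmul _ fun p =>
    Submodule.subset_span ⟨_, (mul_mono_right t p k).symm⟩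
  have htw : ∀ j : Fin m, IsWeightedHomogeneous (varWeight m N) (t j) (N - j) := fun j => by
    rw [(ht j).2]
    exact (hη.isWeightedHomogeneous _).C_mul _
  have hBw : ∀ k : Fin N, IsWeightedHomogeneous (varWeight m N) (varB m N k) (k + 1) := fun k =>
    isWeightedHomogeneous_X ℂ (varWeight m N) (Sum.inr k)
  have hlow : ∀ d, ∀ w ∈ Submodule.span ℂ (Set.range fun α : BoxExp m n =>
      ∏ i, varX m N i ^ α.1 i), weightedHomogeneousComponent (varWeight m N) d w ∈ W := by
    intro d w hw
    induction hw using Submodule.span_induction with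
    | mem y hy =>
      obtain ⟨α, rfl⟩ := hy
      simp only
      rw [weightedHomogeneousComponent_of_mem (isWeightedHomogeneous_prod_varX α.1)]
      split_ifs
      · exact Submodule.subset_span ⟨((α, 0), 0), by simp [mono]⟩
      · exact zero_mem _
    | zero => rw [map_zero]; exact zero_mem _
    | add y y' _ _ h h' => rw [map_add]; exact add_mem h h'
    | smul r y _ h => rw [map_smul]; exact W.smul_mem r h
  have hhom : ∀ d, ∀ p, IsWeightedHomogeneous (varWeight m N) p d → p ∈ W := by
    intro d
    induction d using Nat.strong_induction_on with
    | _ d ih =>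
    intro p hp
    obtain ⟨w, hw, hI⟩ := exists_sub_mem_ideal hN hη ht p
    obtain ⟨y, hy, z, hz, hyz⟩ := Submodule.mem_sup.1 hI
    obtain ⟨a, rfl⟩ := (Ideal.mem_span_range_iff_exists_fun).1 hy
    obtain ⟨b, rfl⟩ := (Ideal.mem_span_range_iff_exists_fun).1 hz
    have hp' : p = w + (∑ i, a i * t i + ∑ i, b i * varB m N i) := by
      rw [hyz]
      ring
    have hpd : weightedHomogeneousComponent (varWeight m N) d p = p := by
      rw [weightedHomogeneousComponent_of_mem hp, if_pos rfl]
    rw [← hpd, hp', map_add, map_add, map_sum, map_sum]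
    refine add_mem (hlow d w hw) (add_mem (sum_mem fun j _ => ?_) (sum_mem fun k _ => ?_))
    · rw [weightedHomogeneousComponent_mul_of_mem d _ (htw j)]
      split_ifs with h
      · exact hmt j _ (ih _ (by omega) _ (weightedHomogeneousComponent_isWeightedHomogeneous _ _))
      · exact zero_mem _
    · rw [weightedHomogeneousComponent_mul_of_mem d _ (hBw k)]
      split_ifs with h
      · exact hmB k _ (ih _ (by omega) _ (weightedHomogeneousComponent_isWeightedHomogeneous _ _))
      · exact zero_mem _
  rw [eq_top_iff]
  rintro p -
  rw [← sum_weightedHomogeneousComponent (varWeight m N) p]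
  exact finsum_induction (· ∈ W) (zero_mem _) (fun _ _ => add_mem) fun d =>
    hhom d _ (weightedHomogeneousComponent_isWeightedHomogeneous _ _)

theorem exists_monoIndex_equiv (m n N : ℕ) :
    ∃ e : ((Fin m ⊕ Fin N) →₀ ℕ) ≃ MonoIndex m n N,
      ∀ s, monoWeight (e s) = Finsupp.weight (varWeight m N) s := by
  obtain ⟨e, he⟩ := exists_boxExp_prod_equiv m n
  let e' : ((Fin m ⊕ Fin N) →₀ ℕ) ≃ (Fin m → ℕ) × (Fin N → ℕ) :=
    Finsupp.equivFunOnFinite.trans (Equiv.sumArrowEquivProdArrow _ _ _)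
  refine ⟨e'.trans (e.symm.prodCongr (Equiv.refl _)), fun s => ?_⟩
  rw [Finsupp.weight_apply, Finsupp.sum_fintype _ _ (by simp), Fintype.sum_sum_type]
  have h := he (e.symm (e' s).1)
  rw [Equiv.apply_symm_apply] at h
  change expWeight (e.symm (e' s).1).1.1 + ∑ j, (e.symm (e' s).1).2 j * (n + m - j) + _ = _
  rw [← h]
  rfl

/-- The monomials `X^α t^β B^γ` with `|α| ≤ n` form a basis. -/
theorem exists_basis_mono (hN : N = n + m) {c : Fin m → ℂ}
    {η : ℕ → MvPolynomial (Fin m ⊕ Fin N) ℂ} {t : Fin m → MvPolynomial (Fin m ⊕ Fin N) ℂ}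
    (hη : IsCompleteSeq (varX m N) (varB m N) η) (ht : IsTopPart c η t) :
    ∃ b : Module.Basis (MonoIndex m n N) ℂ (MvPolynomial (Fin m ⊕ Fin N) ℂ),
      ∀ p, b p = mono t p := by
  obtain ⟨e, he⟩ := exists_monoIndex_equiv m n N
  -- `T` sends each ordinary monomial to some `X^α t^β B^γ` of the same weight. It is surjective by
  -- spanning, hence bijective.
  let T := (basisMonomials (Fin m ⊕ Fin N) ℂ).constr ℂ fun s => mono t (e s)
  have hT : ∀ s, T (monomial s 1) = mono t (e s) := fun s => by
    have := (basisMonomials (Fin m ⊕ Fin N) ℂ).constr_basis ℂ (fun s => mono t (e s)) s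
    rwa [coe_basisMonomials] at this
  have htw : ∀ j : Fin m, IsWeightedHomogeneous (varWeight m N) (t j) (n + m - j) := fun j => by
    rw [(ht j).2, ← hN]
    exact (hη.isWeightedHomogeneous _).C_mul _
  have hsurj : Function.Surjective T := by
    rw [← LinearMap.range_eq_top, eq_top_iff, ← span_mono_eq_top hN hη ht, Submodule.span_le]
    rintro _ ⟨p, rfl⟩
    exact ⟨monomial (e.symm p) 1, by rw [hT, Equiv.apply_symm_apply]⟩
  have hinj : Function.Injective T := by
    refine injective_of_surjective_of_graded (varWeight_ne_zero (m := m) (N := N)) T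
      (fun s => ?_) hsurj
    rw [hT, ← he]
    exact isWeightedHomogeneous_mono htw _
  have hbij : Function.Bijective T := ⟨hinj, hsurj⟩
  refine ⟨((basisMonomials (Fin m ⊕ Fin N) ℂ).map
    (LinearEquiv.ofBijective T hbij)).reindex e, fun p => ?_⟩
  rw [Module.Basis.reindex_apply, Module.Basis.map_apply, coe_basisMonomials,
    LinearEquiv.ofBijective_apply, hT, Equiv.apply_symm_apply]

end Polynomial

end

/-! ### Passage from complex bases to bases over `R_B` -/

section

open MvPolynomial

/-- `R_B[X₁, …, X_m]` is free over `R_B` on the monomials `X^α t^β` with `|α| ≤ n`. -/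
theorem exists_basis_polynomial {m n N : ℕ} (hN : N = n + m) {c : Fin m → ℂ}
    {η : ℕ → MvPolynomial (Fin m) (RB N)} {t : Fin m → MvPolynomial (Fin m) (RB N)}
    (hη : IsCompleteSeq (fun i => X i) (fun k => C (X k)) η)
    (ht : ∀ j : Fin m, c j ≠ 0 ∧ t j = C (C (c j)) * η (N - j)) :
    ∃ b : Module.Basis (BoxExp m n × (Fin m →₀ ℕ)) (RB N) (MvPolynomial (Fin m) (RB N)),
      ∀ p, b p = (∏ i, X i ^ p.1.1 i) * ∏ j, t j ^ p.2 j := by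
  let S := sumAlgEquiv ℂ (Fin m) (Fin N)
  have hη' : IsCompleteSeq (varX m N) (varB m N) (fun k => S.symm (η k)) := by
    have := hη.map S.symm.toAlgHom.toRingHom
    simp [S] at this
    exact this
  have ht' : IsTopPart c (fun k => S.symm (η k)) (fun j => S.symm (t j)) := fun j =>
    ⟨(ht j).1, by simp only [(ht j).2, map_mul, S, sumAlgEquiv_symm_C_C]⟩
  obtain ⟨b₀, hb₀⟩ := exists_basis_mono (n := n) hN hη' ht'
  let w : BoxExp m n × (Fin m →₀ ℕ) → MvPolynomial (Fin m) (RB N) := fun p =>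
    (∏ i, X i ^ p.1.1 i) * ∏ j, t j ^ p.2 j
  let Φ : ((BoxExp m n × (Fin m →₀ ℕ)) →₀ RB N) →ₗ[RB N] MvPolynomial (Fin m) (RB N) :=
    Finsupp.linearCombination (RB N) w
  let bs : Module.Basis ((Fin N →₀ ℕ) × (BoxExp m n × (Fin m →₀ ℕ))) ℂ
      ((BoxExp m n × (Fin m →₀ ℕ)) →₀ RB N) :=
    (basisMonomials (Fin N) ℂ).smulTower Finsupp.basisSingleOne
  let bt : Module.Basis (MonoIndex m n N) ℂ (MvPolynomial (Fin m) (RB N)) := b₀.map S.toLinearEquiv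
  let e : (Fin N →₀ ℕ) × (BoxExp m n × (Fin m →₀ ℕ)) ≃ MonoIndex m n N :=
    (Equiv.prodComm _ _).trans
      (((Equiv.refl _).prodCongr Finsupp.equivFunOnFinite).prodCongr Finsupp.equivFunOnFinite)
  -- Over the complex numbers the free module has the basis `B^γ` times a standard vector, and `Φ`
  -- matches it with the basis `X^α t^β B^γ`. Bijectivity of the `R_B`-linear map `Φ` follows.
  have hΦ : ∀ x, Φ x = bs.equiv bt e x := by
    intro x
    have : Φ.restrictScalars ℂ = (bs.equiv bt e).toLinearMap := by
      refine bs.ext fun q => ?_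
      obtain ⟨γ, p⟩ := q
      rw [LinearEquiv.coe_coe, Module.Basis.equiv_apply, LinearMap.restrictScalars_apply,
        Module.Basis.smulTower_apply, map_smul]
      have e1 : Φ (Finsupp.basisSingleOne p) = w p := by
        simp [Φ]
      rw [e1, coe_basisMonomials, Module.Basis.map_apply, hb₀]
      simp only [mono, varX, varB, e, w]
      have e2 : (monomial γ (1 : ℂ) : RB N) = ∏ k, X k ^ γ k := by
        rw [monomial_eq, C_1, one_mul, Finsupp.prod_fintype _ _ (by simp)]
      rw [e2, Algebra.smul_def, mul_comm]
      change _ = S _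
      rw [map_mul, map_mul, map_prod, map_prod, map_prod, map_prod]
      simp [S]
    exact LinearMap.congr_fun this x
  have hbij : Function.Bijective Φ := by
    have : (Φ : _ → _) = bs.equiv bt e := funext hΦ
    rw [this]
    exact (bs.equiv bt e).bijective
  refine ⟨Module.Basis.ofRepr (LinearEquiv.ofBijective Φ hbij).symm, fun p => ?_⟩
  rw [Module.Basis.coe_ofRepr, LinearEquiv.symm_symm]
  change Φ _ = _
  simp [Φ, w]

/-- An `R_B`-algebra that is a polynomial algebra on `x₁, …, x_m` is free over `R_B` on the
monomials `x^α t^β` with `|α| ≤ n`. -/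
theorem exists_isMonomialBasis {m n N : ℕ} (hN : N = n + m) {A : Type} [CommRing A]
    [Algebra (RB N) A] (θ : MvPolynomial (Fin m) (RB N) ≃ₐ[RB N] A) {c : Fin m → ℂ} {η : ℕ → A}
    {t : Fin m → A}
    (hη : IsCompleteSeq (fun i => θ (X i)) (fun k => algebraMap (RB N) A (X k)) η)
    (ht : ∀ j : Fin m, c j ≠ 0 ∧ t j = algebraMap (RB N) A (C (c j)) * η (N - j)) :
    ∃ b : Module.Basis (BoxExp m n × (Fin m →₀ ℕ)) (RB N) A,
      IsMonomialBasis t b ∧ ∀ p, b p = (∏ i, θ (X i) ^ p.1.1 i) * ∏ j, t j ^ p.2 j := by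
  have hη' : IsCompleteSeq (fun i => (X i : MvPolynomial (Fin m) (RB N))) (fun k => C (X k))
      (fun k => θ.symm (η k)) := by
    have := hη.map θ.symm.toAlgHom.toRingHom
    simpa [MvPolynomial.algebraMap_eq] using this
  have ht' : ∀ j : Fin m, c j ≠ 0 ∧ θ.symm (t j) = C (C (c j)) * θ.symm (η (N - j)) := fun j =>
    ⟨(ht j).1, by
      rw [(ht j).2, map_mul]
      simp [MvPolynomial.algebraMap_eq]⟩
  obtain ⟨b, hb⟩ := exists_basis_polynomial (n := n) hN hη' ht'
  have hb' : ∀ p, b.map θ.toLinearEquiv p =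
      (∏ i, θ (X i) ^ p.1.1 i) * ∏ j, t j ^ p.2 j := by
    intro p
    rw [Module.Basis.map_apply, hb]
    change θ _ = _
    simp [map_mul, map_prod, map_pow]
  refine ⟨b.map θ.toLinearEquiv, ?_, hb'⟩
  intro j α β
  rw [hb', hb']
  simp only [Finsupp.coe_add, Pi.add_apply, pow_add, Finset.prod_mul_distrib]
  have : ∏ l, t l ^ (Finsupp.single j 1 : Fin m →₀ ℕ) l = t j := by
    rw [Finset.prod_eq_single j (fun i _ hi => by simp [hi.symm]) (by simp)]
    simp
  rw [this]
  ring

end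

/-! ## Generating functions of symmetric polynomials -/

namespace MvPolynomial

section GeneratingFunctions

variable {σ R : Type} [CommRing R]

/-- The elementary symmetric polynomial of degree `k` in the variables from `s`. -/
def esymmOn (R : Type) [CommRing R] (s : Finset σ) (k : ℕ) : MvPolynomial σ R :=
  ∑ t ∈ s.powersetCard k, ∏ i ∈ t, X i

theorem esymmOn_univ [Fintype σ] (k : ℕ) : esymmOn R (Finset.univ : Finset σ) k = esymm σ R k := rfl

/-- The factor `1 - x_i T`. -/
def linFactor (R : Type) [CommRing R] (i : σ) : PowerSeries (MvPolynomial σ R) :=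
  1 - PowerSeries.C (X i) * PowerSeries.X

theorem prod_linFactor (s : Finset σ) :
    ∏ i ∈ s, linFactor R i = PowerSeries.mk fun k => (-1) ^ k * esymmOn R s k := by
  ext1 k
  have h : ∀ t : Finset σ, ∏ i ∈ t, -(PowerSeries.C (X i : MvPolynomial σ R) * PowerSeries.X) =
      PowerSeries.C ((-1) ^ t.card * ∏ i ∈ t, X i) * PowerSeries.X ^ t.card := by
    intro t
    rw [Finset.prod_neg, Finset.prod_mul_distrib, Finset.prod_const, map_mul, map_pow, map_neg,
      map_one, map_prod]
    ring
  simp only [linFactor, sub_eq_add_neg]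
  rw [Finset.prod_one_add, map_sum, PowerSeries.coeff_mk, esymmOn, Finset.mul_sum,
    Finset.powersetCard_eq_filter, Finset.sum_filter]
  refine Finset.sum_congr rfl fun t _ => ?_
  rw [h, PowerSeries.coeff_C_mul, PowerSeries.coeff_X_pow]
  by_cases hk : t.card = k
  · simp [hk]
  · simp [hk, Ne.symm hk]

theorem mk_pow_mul_linFactor (i : σ) :
    PowerSeries.mk (fun k => (X i : MvPolynomial σ R) ^ k) * linFactor R i = 1 := by
  ext1 k
  rw [linFactor, mul_sub, mul_one, mul_left_comm, map_sub, PowerSeries.coeff_C_mul]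
  rcases k with _ | k
  · simp
  · rw [PowerSeries.coeff_succ_mul_X, PowerSeries.coeff_mk, PowerSeries.coeff_mk, pow_succ',
      sub_self, PowerSeries.coeff_one, if_neg (Nat.succ_ne_zero k)]

variable [Fintype σ] [DecidableEq σ]

theorem mk_hsymm : PowerSeries.mk (fun k => hsymm σ R k) =
    ∏ i, PowerSeries.mk (fun k => (X i : MvPolynomial σ R) ^ k) := by
  ext1 k
  rw [PowerSeries.coeff_prod, PowerSeries.coeff_mk, hsymm]
  simp only [PowerSeries.coeff_mk]
  refine Finset.sum_bij' (fun s _ => Multiset.toFinsupp s.1)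
    (fun l hl => ⟨Finsupp.toMultiset l, ?_⟩) ?_ ?_ ?_ ?_ ?_
  · rw [Finsupp.card_toMultiset, Finsupp.sum_fintype _ _ (by simp)]
    exact (Finset.mem_finsuppAntidiag.1 hl).1
  · intro s _
    refine Finset.mem_finsuppAntidiag.2 ⟨?_, Finset.subset_univ _⟩
    have h : ∑ i, Multiset.count i (s : Multiset σ) = k :=
      (Multiset.sum_count_eq_card fun _ _ => Finset.mem_univ _).trans s.2
    exact h
  · intro l hl
    exact Finset.mem_univ _
  · intro s _
    exact Subtype.ext (Multiset.toFinsupp_toMultiset s.1)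
  · intro l _
    exact Finsupp.toMultiset_toFinsupp l
  · intro s _
    rw [Finset.prod_multiset_map_count]
    change _ = ∏ i, (X i : MvPolynomial σ R) ^ Multiset.count i (s : Multiset σ)
    refine Finset.prod_subset (Finset.subset_univ _) fun i _ hi => ?_
    rw [Multiset.count_eq_zero_of_notMem (by simpa using hi), pow_zero]

theorem mk_hsymm_mul_prod_linFactor :
    PowerSeries.mk (fun k => hsymm σ R k) * ∏ i, linFactor R i = 1 := by
  rw [mk_hsymm, ← Finset.prod_mul_distrib]
  exact Finset.prod_eq_one fun i _ => mk_pow_mul_linFactor i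

/-- All factors of `∏ (1 - x_l T)⁻¹` cancel except the one of `x_i`. This relates complete symmetric
polynomials to powers of a single variable, as needed for the partial derivatives of the potential.
-/
theorem mk_hsymm_mul_prod_erase (i : σ) :
    PowerSeries.mk (fun k => hsymm σ R k) * ∏ l ∈ Finset.univ.erase i, linFactor R l =
      PowerSeries.mk (fun k => (X i : MvPolynomial σ R) ^ k) := by
  have h := mk_hsymm_mul_prod_linFactor (σ := σ) (R := R)
  rw [← Finset.mul_prod_erase _ _ (Finset.mem_univ i)] at h
  have h' := mk_pow_mul_linFactor (R := R) i
  calc _ = (PowerSeries.mk (fun k => (X i : MvPolynomial σ R) ^ k) * linFactor R i) *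
        (PowerSeries.mk (fun k => hsymm σ R k) * ∏ l ∈ Finset.univ.erase i, linFactor R l) := by
        rw [h', one_mul]
    _ = PowerSeries.mk (fun k => (X i : MvPolynomial σ R) ^ k) *
        (PowerSeries.mk (fun k => hsymm σ R k) *
          (linFactor R i * ∏ l ∈ Finset.univ.erase i, linFactor R l)) := by ring
    _ = _ := by rw [h, mul_one]

theorem esymm_succ_eq (i : σ) (k : ℕ) :
    esymm σ R (k + 1) = esymmOn R (Finset.univ.erase i) (k + 1) +
      X i * esymmOn R (Finset.univ.erase i) k := by
  have h : (Finset.univ : Finset σ) = insert i (Finset.univ.erase i) :=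
    (Finset.insert_erase (Finset.mem_univ i)).symm
  rw [← esymmOn_univ]
  conv_lhs => rw [h, esymmOn, Finset.powersetCard_succ_insert (Finset.notMem_erase i _)]
  rw [Finset.sum_union, Finset.sum_image]
  · congr 1
    rw [esymmOn, Finset.mul_sum]
    refine Finset.sum_congr rfl fun t ht => ?_
    rw [Finset.prod_insert]
    intro hi
    exact Finset.notMem_erase i _ ((Finset.mem_powersetCard.1 ht).1 hi)
  · intro t ht t' ht' htt
    have h1 : ∀ t ∈ Finset.powersetCard k (Finset.univ.erase i), i ∉ t := fun t ht hi =>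
      Finset.notMem_erase i _ ((Finset.mem_powersetCard.1 ht).1 hi)
    rw [← Finset.erase_insert (h1 t ht), ← Finset.erase_insert (h1 t' ht')]
    exact congrArg (fun u => u.erase i) htt
  · rw [Finset.disjoint_left]
    intro t ht ht'
    obtain ⟨t', -, rfl⟩ := Finset.mem_image.1 ht'
    exact Finset.notMem_erase i _ ((Finset.mem_powersetCard.1 ht).1 (Finset.mem_insert_self i t'))

theorem pderiv_esymmOn_erase (i : σ) (k : ℕ) :
    pderiv i (esymmOn R (Finset.univ.erase i) k) = 0 := by
  rw [esymmOn, map_sum]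
  refine Finset.sum_eq_zero fun t ht => ?_
  have hi : i ∉ t := fun hi =>
    Finset.notMem_erase i _ ((Finset.mem_powersetCard.1 ht).1 hi)
  clear ht
  induction t using Finset.induction_on with
  | empty => simp
  | insert l t hl ih =>
    rw [Finset.mem_insert, not_or] at hi
    rw [Finset.prod_insert hl, Derivation.leibniz, ih hi.2, pderiv_X_of_ne (Ne.symm hi.1)]
    simp

theorem pderiv_esymm_succ (i : σ) (k : ℕ) :
    pderiv i (esymm σ R (k + 1)) = esymmOn R (Finset.univ.erase i) k := by
  rw [esymm_succ_eq i, map_add, pderiv_esymmOn_erase, zero_add, Derivation.leibniz,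
    pderiv_esymmOn_erase, pderiv_X_self]
  simp

theorem pderiv_psum (i : σ) (k : ℕ) :
    pderiv i (psum σ R (k + 1)) = ((k : MvPolynomial σ R) + 1) * X i ^ k := by
  rw [psum, map_sum, Finset.sum_eq_single i]
  · rw [Derivation.leibniz_pow, pderiv_X_self]
    simp
  · intro l _ hl
    rw [Derivation.leibniz_pow, pderiv_X_of_ne hl]
    simp
  · simp

end GeneratingFunctions

theorem extSeq_esymm (m : ℕ) (R : Type) [CommRing R] (k : ℕ) :
    extSeq (fun i : Fin m => esymm (Fin m) R (i + 1)) k = esymm (Fin m) R k := by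
  rcases k with _ | k
  · rw [Nat.cast_zero, extSeq_zero, esymm_zero]
  · by_cases hk : k < m
    · have h := extSeq_succ (fun i : Fin m => esymm (Fin m) R (i + 1)) ⟨k, hk⟩
      rw [Nat.cast_succ]
      exact h
    · rw [extSeq_of_gt _ (by omega), esymm, Finset.powersetCard_eq_empty.2 (by simp; omega),
        Finset.sum_empty]

end MvPolynomial

/-! ### Recurrences as identities of power series -/

section Series

variable {Q : Type} [CommRing Q] {m N : ℕ} {x : Fin m → Q} {B : Fin N → Q}

/-- The generating function `∑ (-1)^k x_k T^k`. -/
def altSeries (x : Fin m → Q) : PowerSeries Q := PowerSeries.mk fun k => (-1) ^ k * extSeq x k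

theorem isCompleteSeq_iff {η : ℕ → Q} :
    IsCompleteSeq x B η ↔ altSeries x * PowerSeries.mk η = altSeries B := by
  rw [PowerSeries.ext_iff]
  refine forall_congr' fun k => ?_
  rw [PowerSeries.coeff_mul, Finset.Nat.sum_antidiagonal_eq_sum_range_succ_mk]
  simp only [altSeries, PowerSeries.coeff_mk]

/-- `h_k(𝕏 - 𝔹)` in terms of `h_k(𝕏)` and the elementary symmetric polynomials in `𝔹`. -/
def diffSeq (B : Fin N → Q) (h : ℕ → Q) (k : ℕ) : Q :=
  ∑ j ∈ Finset.range (k + 1), (-1) ^ j * extSeq B j * h (k - j)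

theorem map_diffSeq {Q' : Type} [CommRing Q'] (f : Q →+* Q') (B : Fin N → Q) (h : ℕ → Q) (k : ℕ) :
    f (diffSeq B h k) = diffSeq (fun i => f (B i)) (fun k => f (h k)) k := by
  simp only [diffSeq, map_sum, map_mul, map_pow, map_neg, map_one, map_extSeq]

theorem mk_diffSeq (B : Fin N → Q) (h : ℕ → Q) :
    PowerSeries.mk (diffSeq B h) = altSeries B * PowerSeries.mk h := by
  ext1 k
  rw [PowerSeries.coeff_mul, Finset.Nat.sum_antidiagonal_eq_sum_range_succ_mk]
  simp only [altSeries, PowerSeries.coeff_mk, diffSeq]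

theorem isCompleteSeq_diffSeq {h : ℕ → Q} (hh : altSeries x * PowerSeries.mk h = 1) :
    IsCompleteSeq x B (diffSeq B h) := by
  rw [isCompleteSeq_iff, mk_diffSeq, mul_left_comm, hh, mul_one]

theorem altSeries_esymm (m : ℕ) (R : Type) [CommRing R] :
    altSeries (fun i : Fin m => MvPolynomial.esymm (Fin m) R (i + 1)) =
      ∏ i, MvPolynomial.linFactor R i := by
  rw [MvPolynomial.prod_linFactor]
  simp only [altSeries, MvPolynomial.extSeq_esymm, MvPolynomial.esymmOn_univ]

theorem altSeries_esymm_mul (m : ℕ) (R : Type) [CommRing R] :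
    altSeries (fun i : Fin m => MvPolynomial.esymm (Fin m) R (i + 1)) *
      PowerSeries.mk (fun k => MvPolynomial.hsymm (Fin m) R k) = 1 := by
  rw [altSeries_esymm, mul_comm, MvPolynomial.mk_hsymm_mul_prod_linFactor]

/-- Transport of the relation between elementary and complete symmetric polynomials along a ring
homomorphism, or back along an injective one. -/
theorem map_altSeries {Q' : Type} [CommRing Q'] (f : Q →+* Q') (x : Fin m → Q) :
    PowerSeries.map f (altSeries x) = altSeries fun i => f (x i) := by
  ext1 k
  simp only [altSeries, PowerSeries.coeff_map, PowerSeries.coeff_mk, map_mul, map_pow, map_neg,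
    map_one, map_extSeq]

theorem altSeries_mul_eq_one_of_injective {Q' : Type} [CommRing Q'] (f : Q →+* Q')
    (hf : Function.Injective f) {h : ℕ → Q}
    (hh : altSeries (fun i => f (x i)) * PowerSeries.mk (fun k => f (h k)) = 1) :
    altSeries x * PowerSeries.mk h = 1 := by
  have hinj : Function.Injective (PowerSeries.map f) := by
    intro p q hpq
    ext1 k
    apply hf
    rw [← PowerSeries.coeff_map, ← PowerSeries.coeff_map, hpq]
  apply hinj
  rw [map_mul, map_altSeries, map_one, ← hh]
  congr 1

theorem altSeries_mul_eq_one_map {Q' : Type} [CommRing Q'] (f : Q →+* Q') {h : ℕ → Q}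
    (hh : altSeries x * PowerSeries.mk h = 1) :
    altSeries (fun i => f (x i)) * PowerSeries.mk (fun k => f (h k)) = 1 := by
  have := congrArg (PowerSeries.map f) hh
  rw [map_mul, map_altSeries, map_one] at this
  rw [← this]
  congr 1

end Series

section

open MvPolynomial

/-! ## Ring gradings -/

/-- The subgroups `gr n` grade the ring `Q` (we do not need that they span). -/
structure IsRingGrading {Q : Type} [CommRing Q] (gr : ℤ → AddSubgroup Q) : Prop where
  one_mem : (1 : Q) ∈ gr 0
  mul_mem : ∀ {i j : ℤ} {x y : Q}, x ∈ gr i → y ∈ gr j → x * y ∈ gr (i + j)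
  independent : GradingIndependent gr

section RingGrading

variable {Q : Type} [CommRing Q] {gr : ℤ → AddSubgroup Q}

theorem IsRingGrading.pow_mem (h : IsRingGrading gr) {d : ℤ} {x : Q} (hx : x ∈ gr d) :
    ∀ k : ℕ, x ^ k ∈ gr (k * d)
  | 0 => by simpa using h.one_mem
  | k + 1 => by
      have := h.mul_mem (h.pow_mem hx k) hx
      rw [pow_succ]
      convert this using 2
      push_cast
      ring

theorem IsRingGrading.prod_mem (h : IsRingGrading gr) {ι : Type} (s : Finset ι) {d : ι → ℤ}
    {x : ι → Q} (hx : ∀ i ∈ s, x i ∈ gr (d i)) : ∏ i ∈ s, x i ∈ gr (∑ i ∈ s, d i) := by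
  classical
  induction s using Finset.induction_on with
  | empty => simpa using h.one_mem
  | insert a s ha ih =>
    rw [Finset.prod_insert ha, Finset.sum_insert ha]
    exact h.mul_mem (hx a (Finset.mem_insert_self a s))
      (ih fun i hi => hx i (Finset.mem_insert_of_mem hi))

theorem IsRingGrading.comap {Q' : Type} [CommRing Q'] (h : IsRingGrading gr) (f : Q' →+* Q)
    (hf : Function.Injective f) : IsRingGrading fun n => (gr n).comap f.toAddMonoidHom where
  one_mem := by
    change f 1 ∈ gr 0
    rw [map_one]
    exact h.one_mem
  mul_mem hx hy := by
    change f (_ * _) ∈ gr _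
    rw [map_mul]
    exact h.mul_mem hx hy
  independent T x hx hsum k hk := by
    apply hf
    rw [map_zero]
    refine h.independent T (fun k => f (x k)) hx ?_ k hk
    rw [← map_sum, hsum, map_zero]

theorem IsRingGrading.extSeq_mem (h : IsRingGrading gr) {m : ℕ} {x : Fin m → Q}
    (hx : ∀ i : Fin m, x i ∈ gr (2 * ((i : ℤ) + 1))) (k : ℕ) : extSeq x k ∈ gr (2 * k) := by
  rcases k with _ | k
  · simpa [extSeq_zero] using h.one_mem
  by_cases hk : k < m
  · have := extSeq_succ x ⟨k, hk⟩
    rw [Nat.cast_succ, this]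
    exact hx ⟨k, hk⟩
  · rw [extSeq_of_gt _ (by omega)]
    exact zero_mem _

theorem IsCompleteSeq.mem {m N : ℕ} {x : Fin m → Q} {B : Fin N → Q} {η : ℕ → Q}
    (hη : IsCompleteSeq x B η) (h : IsRingGrading gr)
    (hx : ∀ i : Fin m, x i ∈ gr (2 * ((i : ℤ) + 1)))
    (hB : ∀ i : Fin N, B i ∈ gr (2 * ((i : ℤ) + 1))) (k : ℕ) : η k ∈ gr (2 * k) := by
  induction k using Nat.strong_induction_on with
  | _ k ih =>
  rw [hη.apply_eq]
  refine sub_mem (Koszul.neg_one_pow_mul_mem k (h.extSeq_mem hB k)) (sum_mem fun j hj => ?_)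
  have hj' : j < k := Finset.mem_range.1 hj
  rw [mul_assoc]
  refine Koszul.neg_one_pow_mul_mem _ ?_
  have := h.mul_mem (h.extSeq_mem hx (j + 1)) (ih (k - (j + 1)) (by omega))
  convert this using 2
  omega

end RingGrading

theorem isRingGrading_weightedHomogeneous {σ : Type} (w : σ → ℤ) :
    IsRingGrading fun n => (weightedHomogeneousSubmodule ℂ w n).toAddSubgroup where
  one_mem := isWeightedHomogeneous_one ℂ w
  mul_mem hx hy := IsWeightedHomogeneous.mul hx hy
  independent T x hx hsum k hk := by
    classical
    have := congrArg (weightedHomogeneousComponent w k) hsum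
    rw [map_sum, map_zero] at this
    rw [← this, Finset.sum_eq_single_of_mem k hk]
    · rw [weightedHomogeneousComponent_of_mem (hx k hk), if_pos rfl]
    · intro l hl hlk
      rw [weightedHomogeneousComponent_of_mem (hx l hl), if_neg hlk.symm]

theorem isRingGrading_RBgr (N : ℕ) : IsRingGrading (RBgr N) :=
  isRingGrading_weightedHomogeneous _

theorem X_mem_RBgr {N : ℕ} (k : Fin N) : (X k : RB N) ∈ RBgr N (2 * ((k : ℤ) + 1)) :=
  isWeightedHomogeneous_X ℂ (fun i : Fin N => 2 * ((i : ℤ) + 1)) k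

theorem C_mem_RBgr {N : ℕ} (c : ℂ) : (C c : RB N) ∈ RBgr N 0 :=
  isWeightedHomogeneous_C _ c

/-- The homogeneous components of an element of `R_B`. -/
def RBcomponents (N : ℕ) (r : RB N) : ℤ →₀ RB N :=
  Finsupp.onFinset (r.support.image (Finsupp.weight fun i : Fin N => 2 * ((i : ℤ) + 1)))
    (fun k => weightedHomogeneousComponent (fun i : Fin N => 2 * ((i : ℤ) + 1)) k r)
    (fun k hk => by
      by_contra h
      exact hk (weightedHomogeneousComponent_eq_zero_of_notMem _ r k h))

theorem RBcomponents_mem (N : ℕ) (r : RB N) (k : ℤ) : RBcomponents N r k ∈ RBgr N k :=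
  weightedHomogeneousComponent_mem _ r k

theorem RBcomponents_sum (N : ℕ) (r : RB N) : (RBcomponents N r).sum (fun _ x => x) = r := by
  conv_rhs => rw [← sum_weightedHomogeneousComponent (fun i : Fin N => 2 * ((i : ℤ) + 1)) r]
  rw [Finsupp.sum, finsum_eq_sum_of_support_subset]
  · rfl
  · intro k hk
    simpa [RBcomponents] using hk

theorem isRingGrading_totalGr (σ : Type) (N : ℕ) : IsRingGrading (totalGr σ N) where
  one_mem s := by
    classical
    rw [coeff_one]
    split_ifs with h
    · subst h
      simpa using (isRingGrading_RBgr N).one_mem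
    · exact zero_mem _
  mul_mem {i j x y} hx hy s := by
    classical
    rw [coeff_mul]
    refine sum_mem fun p hp => ?_
    have := (isRingGrading_RBgr N).mul_mem (hx p.1) (hy p.2)
    convert this using 2
    rw [← Finset.HasAntidiagonal.mem_antidiagonal.1 hp, map_add]
    push_cast
    ring
  independent T x hx hsum k hk := by
    ext1 s
    rw [coeff_zero]
    -- The coefficient at `s` of an element of degree `k` has degree `k - 2|s|`, so the index set is
    -- shifted accordingly.
    have h := (isRingGrading_RBgr N).independent
      (T.map ⟨fun k => k - 2 * (s.degree : ℤ), sub_left_injective⟩)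
      (fun l => coeff s (x (l + 2 * (s.degree : ℤ)))) (by
        intro l hl
        obtain ⟨k, hk, rfl⟩ := Finset.mem_map.1 hl
        simp only [Function.Embedding.coeFn_mk, sub_add_cancel]
        exact hx k hk s) (by
        rw [Finset.sum_map]
        simp only [Function.Embedding.coeFn_mk, sub_add_cancel]
        rw [← coeff_sum, hsum, coeff_zero]) (k - 2 * (s.degree : ℤ))
      (Finset.mem_map.2 ⟨k, hk, rfl⟩)
    simpa using h

theorem X_mem_totalGr {σ : Type} {N : ℕ} (i : σ) :
    (X i : MvPolynomial σ (RB N)) ∈ totalGr σ N 2 := by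
  classical
  intro s
  rw [coeff_X]
  split_ifs with h
  · subst h
    simpa using (isRingGrading_RBgr N).one_mem
  · exact zero_mem _

theorem C_mem_totalGr {σ : Type} {N : ℕ} {n : ℤ} {r : RB N} (hr : r ∈ RBgr N n) :
    (C r : MvPolynomial σ (RB N)) ∈ totalGr σ N n := by
  classical
  intro s
  rw [coeff_C]
  split_ifs with h
  · subst h
    simpa using hr
  · exact zero_mem _

theorem esymm_mem {Q : Type} [CommRing Q] {gr : ℤ → AddSubgroup Q} (h : IsRingGrading gr)
    {σ R : Type} [Fintype σ] [CommRing R] [Algebra R Q] {x : σ → Q} (hx : ∀ i, x i ∈ gr 2) (k : ℕ) :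
    aeval x (esymm σ R k) ∈ gr (2 * k) := by
  rw [esymm, map_sum]
  refine sum_mem fun t ht => ?_
  rw [map_prod]
  have := h.prod_mem t (d := fun _ => 2) (x := fun i => aeval x (X i : MvPolynomial σ R))
    (fun i _ => by rw [aeval_X]; exact hx i)
  rw [Finset.sum_const, (Finset.mem_powersetCard.1 ht).2] at this
  convert this using 2
  simp [mul_comm]

theorem esymm_mem_totalGr {σ : Type} [Fintype σ] {N : ℕ} (k : ℕ) :
    esymm σ (RB N) k ∈ totalGr σ N (2 * k) := by
  have := esymm_mem (isRingGrading_totalGr σ N) (R := RB N) (x := fun i : σ => X i)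
    X_mem_totalGr k
  rwa [aeval_X_left_apply] at this

theorem isRingGrading_symGr (N m : ℕ) :
    IsRingGrading (Q := symmetricSubalgebra (Fin m) (RB N)) (symGr N m) where
  one_mem := (isRingGrading_totalGr (Fin m) N).one_mem
  mul_mem hx hy := (isRingGrading_totalGr (Fin m) N).mul_mem hx hy
  independent T x hx hsum k hk := by
    apply Subtype.val_injective
    refine (isRingGrading_totalGr (Fin m) N).independent T (fun k => (x k).1) hx ?_ k hk
    have := congrArg (symmetricSubalgebra (Fin m) (RB N)).val hsum
    rwa [map_sum, map_zero] at this

theorem isRingGrading_symXBGr (N m : ℕ) :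
    IsRingGrading (Q := partSym (Fin m) (Fin N) ℂ) (symXBGr N m) :=
  (isRingGrading_weightedHomogeneous fun _ : Fin m ⊕ Fin N => (2 : ℤ)).comap
    (partSym (Fin m) (Fin N) ℂ).val.toRingHom Subtype.val_injective

/-! ## Graded monomial bases -/

/-- The degree `2 (N - j)` of `h_(N-j)(𝕏 - 𝔹)`. -/
def rowDegree (N m : ℕ) (j : Fin m) : ℤ := 2 * (N : ℤ) + 2 - 2 * ((j : ℤ) + 1)

/-- The degree of a monomial of bounded degree. -/
def boxDegree {m n : ℕ} (α : BoxExp m n) : ℤ := 2 * (expWeight α.1 : ℤ)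

/-- The basis elements `X^α t^β` are homogeneous because `η_k` has degree `2k`, by the recurrence. A
homogeneous basis is a graded basis. -/
theorem exists_graded_isMonomialBasis {m n N : ℕ} (hN : N = n + m) {A : Type} [CommRing A]
    [Algebra (RB N) A] (θ : MvPolynomial (Fin m) (RB N) ≃ₐ[RB N] A) {c : Fin m → ℂ} {η : ℕ → A}
    {t : Fin m → A}
    (hη : IsCompleteSeq (fun i => θ (X i)) (fun k => algebraMap (RB N) A (X k)) η)
    (ht : ∀ j : Fin m, c j ≠ 0 ∧ t j = algebraMap (RB N) A (C (c j)) * η (N - j))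
    {gr : ℤ → AddSubgroup A} (hgr : IsRingGrading gr)
    (halg : ∀ (n : ℤ) (r : RB N), r ∈ RBgr N n → algebraMap (RB N) A r ∈ gr n)
    (hx : ∀ i : Fin m, θ (X i) ∈ gr (2 * ((i : ℤ) + 1))) :
    ∃ b : Module.Basis (BoxExp m n × (Fin m →₀ ℕ)) (RB N) A,
      IsMonomialBasis t b ∧
        IsGradedBasis (RBgr N) gr b (monomialDegree boxDegree (rowDegree N m)) := by
  obtain ⟨b, hb, hb'⟩ := exists_isMonomialBasis hN θ hη ht
  refine ⟨b, hb, isGradedBasis_of_mem (RBcomponents N) (RBcomponents_mem N) (RBcomponents_sum N)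
    ?_ hgr.independent ?_⟩
  · intro i j r x hr hx
    rw [Algebra.smul_def]
    exact hgr.mul_mem (halg _ _ hr) hx
  · intro p
    rw [hb']
    refine hgr.mul_mem ?_ (hgr.prod_mem _ fun j _ => ?_)
    · have := hgr.prod_mem Finset.univ (d := fun i : Fin m => (p.1.1 i : ℤ) * (2 * ((i : ℤ) + 1)))
        (x := fun i => θ (X i) ^ p.1.1 i) (fun i _ => hgr.pow_mem (hx i) _)
      convert this using 2
      rw [boxDegree, expWeight]
      push_cast
      rw [Finset.mul_sum]
      exact Finset.sum_congr rfl fun i _ => by ring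
    · refine hgr.pow_mem ?_ _
      have h1 := hη.mem hgr hx (fun i => halg _ _ (X_mem_RBgr i)) (N - j)
      have h2 := hgr.mul_mem (halg 0 _ (C_mem_RBgr (c j))) h1
      rw [← (ht j).2] at h2
      convert h2 using 2
      rw [rowDegree]
      omega

end

section

open MvPolynomial

/-! ## Symmetric polynomials over the base ring -/

/-- `h_k(𝕏 - 𝔹)` as an element of `Sym(𝕏) ⊗ R`, where the elementary symmetric polynomials in `𝔹`
are elements of `R`. -/
def symDiffSeq {N : ℕ} (m : ℕ) {R : Type} [CommRing R] (B : Fin N → R) :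
    ℕ → symmetricSubalgebra (Fin m) R :=
  diffSeq (fun l : Fin N => algebraMap R (symmetricSubalgebra (Fin m) R) (B l))
    (fun k => ⟨hsymm (Fin m) R k, hsymm_isSymmetric _ _ _⟩)

theorem esymmAlgEquiv_X (m : ℕ) (R : Type) [CommRing R] (i : Fin m) :
    esymmAlgEquiv (Fin m) R (Fintype.card_fin m) (X i) =
      ⟨esymm (Fin m) R (i + 1), esymm_isSymmetric _ _ _⟩ := by
  rw [← esymmAlgEquiv_symm_apply R (Fintype.card_fin m) i, AlgEquiv.apply_symm_apply]

theorem isCompleteSeq_symDiffSeq {N : ℕ} (m : ℕ) {R : Type} [CommRing R] (B : Fin N → R) :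
    IsCompleteSeq (fun i => esymmAlgEquiv (Fin m) R (Fintype.card_fin m) (X i))
      (fun k => algebraMap R (symmetricSubalgebra (Fin m) R) (B k)) (symDiffSeq m B) := by
  rw [symDiffSeq]
  apply isCompleteSeq_diffSeq
  simp only [esymmAlgEquiv_X]
  exact altSeries_mul_eq_one_of_injective
      (algebraMap (symmetricSubalgebra (Fin m) R) (MvPolynomial (Fin m) R))
      Subtype.val_injective (altSeries_esymm_mul m R)

theorem exists_graded_basis_symmetricSubalgebra {m n N : ℕ} (hN : N = n + m) {c : Fin m → ℂ}
    {t : Fin m → symmetricSubalgebra (Fin m) (RB N)}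
    (ht : ∀ j : Fin m, c j ≠ 0 ∧
      t j = algebraMap (RB N) (symmetricSubalgebra (Fin m) (RB N)) (C (c j)) *
        symDiffSeq m (R := RB N) X (N - j)) :
    ∃ b : Module.Basis (BoxExp m n × (Fin m →₀ ℕ)) (RB N) (symmetricSubalgebra (Fin m) (RB N)),
      IsMonomialBasis t b ∧
        IsGradedBasis (M := symmetricSubalgebra (Fin m) (RB N)) (RBgr N) (symGr N m) b
          (monomialDegree boxDegree (rowDegree N m)) := by
  refine exists_graded_isMonomialBasis hN _ (isCompleteSeq_symDiffSeq m (R := RB N) X) ht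
    (isRingGrading_symGr N m) (fun n r hr => C_mem_totalGr hr) fun i => ?_
  rw [esymmAlgEquiv_X]
  have := esymm_mem_totalGr (σ := Fin m) (N := N) (i + 1)
  push_cast at this
  exact this

/-! ## Polynomials that are symmetric in two alphabets -/

instance partSymAlgebra (N m : ℕ) : Algebra (RB N) (partSym (Fin m) (Fin N) ℂ) :=
  (baseHom N m).toAlgebra

/-- The elementary symmetric polynomials in the first alphabet generate. -/
def partSymHom (N m : ℕ) : MvPolynomial (Fin m) (RB N) →ₐ[RB N] partSym (Fin m) (Fin N) ℂ :=
  aeval fun i : Fin m =>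
    symLeft (Fin N) (esymm (Fin m) ℂ (i + 1)) (esymm_isSymmetric _ _ _)

/-- The inclusion of `R_B` as the symmetric polynomials in `𝔹`. -/
def esymmIncl (N : ℕ) : RB N →ₐ[ℂ] MvPolynomial (Fin N) ℂ :=
  aeval fun k : Fin N => esymm (Fin N) ℂ (k + 1)

theorem esymmIncl_eq (N : ℕ) (r : RB N) : esymmIncl N r = (esymmAlgHom (Fin N) ℂ N r).1 := by
  rw [esymmAlgHom_apply]
  rfl

theorem esymmIncl_injective (N : ℕ) : Function.Injective (esymmIncl N) := by
  intro p q h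
  rw [esymmIncl_eq, esymmIncl_eq] at h
  exact esymmAlgHom_fin_injective ℂ le_rfl (Subtype.ext h)

theorem mem_range_esymmIncl {N : ℕ} {p : MvPolynomial (Fin N) ℂ} (hp : p.IsSymmetric) :
    p ∈ Set.range (esymmIncl N) := by
  obtain ⟨q, hq⟩ := (esymmAlgHom_fin_bijective ℂ N).2 ⟨p, hp⟩
  exact ⟨q, by rw [esymmIncl_eq, hq]⟩

theorem sumAlgEquiv_rename_inl {σ τ : Type} (p : MvPolynomial σ ℂ) :
    sumAlgEquiv ℂ σ τ (rename Sum.inl p) = map C p := by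
  induction p using MvPolynomial.induction_on with
  | C r => simp
  | add p q hp hq => rw [map_add, map_add, map_add, hp, hq]
  | mul_X p i hp => simp [hp]

theorem sumAlgEquiv_rename_inr {σ τ : Type} (p : MvPolynomial τ ℂ) :
    sumAlgEquiv ℂ σ τ (rename Sum.inr p) = C p := by
  induction p using MvPolynomial.induction_on with
  | C r => simp
  | add p q hp hq => rw [map_add, map_add, map_add, hp, hq]
  | mul_X p i hp => simp [hp]

theorem sumAlgEquiv_rename_sumCongr {σ τ : Type} (e : Equiv.Perm σ) (e' : Equiv.Perm τ)
    (p : MvPolynomial (σ ⊕ τ) ℂ) :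
    sumAlgEquiv ℂ σ τ (rename (Equiv.sumCongr e e') p) =
      rename e (map (rename e' : MvPolynomial τ ℂ →ₐ[ℂ] _).toRingHom (sumAlgEquiv ℂ σ τ p)) := by
  induction p using MvPolynomial.induction_on with
  | C r => simp
  | add p q hp hq => simp only [map_add, hp, hq]
  | mul_X p i hp =>
    rcases i with i | i <;> simp [hp]

theorem baseHom_val (N m : ℕ) (r : RB N) :
    (baseHom N m r).1 = rename Sum.inr (esymmIncl N r) := by
  have h : (partSym (Fin m) (Fin N) ℂ).val.comp (aeval (R := ℂ) fun k : Fin N =>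
      symRight (Fin m) (esymm (Fin N) ℂ (k + 1)) (esymm_isSymmetric _ _ _)) =
      (rename Sum.inr).comp (esymmIncl N) := by
    ext k : 1
    simp [esymmIncl, symRight]
  exact DFunLike.congr_fun h r

/-- Polynomials in both alphabets become polynomials in `𝕏` over `ℂ[𝔹]`. There `partSymHom` is the
map of the fundamental theorem on symmetric polynomials, after `R_B` is embedded into the
coefficients. -/
theorem partSymHom_val (N m : ℕ) (p : MvPolynomial (Fin m) (RB N)) :
    sumAlgEquiv ℂ (Fin m) (Fin N) (partSymHom N m p).1 =
      (esymmAlgHom (Fin m) (MvPolynomial (Fin N) ℂ) m (map (esymmIncl N).toRingHom p)).1 := by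
  rw [esymmAlgHom_apply]
  induction p using MvPolynomial.induction_on with
  | C r =>
    rw [partSymHom, aeval_C]
    change sumAlgEquiv ℂ (Fin m) (Fin N) (baseHom N m r).1 = _
    rw [baseHom_val, sumAlgEquiv_rename_inr, map_C, aeval_C]
    rfl
  | add p q hp hq => 
    simp only [map_add, Subalgebra.coe_add, hp, hq]
  | mul_X p i hp =>
    rw [map_mul, map_mul, map_mul, ← hp, map_X, aeval_X, ← map_esymm (Fin m) ℂ (i + 1) C,
      ← sumAlgEquiv_rename_inl, Subalgebra.coe_mul, map_mul]
    congr 3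
    rw [partSymHom, aeval_X]
    rfl

end

section

open MvPolynomial

theorem map_esymmAlgHom {σ R S : Type} [Fintype σ] [CommRing R] [CommRing S] (f : R →+* S) (n : ℕ)
    (p : MvPolynomial (Fin n) R) :
    map f (esymmAlgHom σ R n p).1 = (esymmAlgHom σ S n (map f p)).1 := by
  rw [esymmAlgHom_apply, esymmAlgHom_apply]
  induction p using MvPolynomial.induction_on with
  | C r => simp
  | add p q hp hq => simp only [map_add, hp, hq]
  | mul_X p i hp => rw [map_mul, map_mul, map_mul, map_mul, hp, aeval_X, map_X, aeval_X, map_esymm]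

/-- The fundamental theorem is used twice: in `𝕏` with coefficients in `ℂ[𝔹]`, and then in `𝔹` for
the coefficients of the polynomial so obtained. -/
theorem partSymHom_bijective (N m : ℕ) : Function.Bijective (partSymHom N m) := by
  constructor
  · intro p q h
    have h' := partSymHom_val N m p
    rw [h, partSymHom_val] at h'
    exact map_injective _ (esymmIncl_injective N)
      (esymmAlgHom_fin_injective _ le_rfl (Subtype.ext h'.symm))
  · intro x
    have hsym : (sumAlgEquiv ℂ (Fin m) (Fin N) x.1).IsSymmetric := by
      intro e
      have h := sumAlgEquiv_rename_sumCongr e 1 x.1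
      rw [x.2 e 1] at h
      conv_rhs => rw [h]
      congr 1
      have h1 : (rename (1 : Equiv.Perm (Fin N)) : MvPolynomial (Fin N) ℂ →ₐ[ℂ] _).toRingHom =
          RingHom.id _ := by
        ext <;> simp
      rw [h1, map_id]
    obtain ⟨q, hq⟩ := (esymmAlgHom_fin_bijective (MvPolynomial (Fin N) ℂ) m).2 ⟨_, hsym⟩
    have hq' : (esymmAlgHom (Fin m) (MvPolynomial (Fin N) ℂ) m q).1 =
      sumAlgEquiv ℂ (Fin m) (Fin N) x.1 := congrArg Subtype.val hq
    -- Uniqueness of `q` carries the symmetry of `x` in `𝔹` over to the coefficients of `q`.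
    have hqmap : ∀ e' : Equiv.Perm (Fin N),
        map (rename e' : MvPolynomial (Fin N) ℂ →ₐ[ℂ] _).toRingHom q = q := by
      intro e'
      apply esymmAlgHom_fin_injective (MvPolynomial (Fin N) ℂ) le_rfl
      apply Subtype.ext
      rw [← map_esymmAlgHom, hq']
      have h := sumAlgEquiv_rename_sumCongr 1 e' x.1
      rw [x.2 1 e'] at h
      conv_rhs => rw [h]
      rw [Equiv.Perm.coe_one, rename_id, AlgHom.id_apply]
    have hrange : q ∈ Set.range (map (esymmIncl N).toRingHom) := by
      rw [mem_range_map_iff_coeffs_subset]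
      intro c hc
      obtain ⟨s, -, rfl⟩ := mem_coeffs_iff.1 hc
      refine mem_range_esymmIncl fun e' => ?_
      conv_rhs => rw [← hqmap e', coeff_map]
      rfl
    obtain ⟨p, hp⟩ := hrange
    refine ⟨p, Subtype.ext ((sumAlgEquiv ℂ (Fin m) (Fin N)).injective ?_)⟩
    rw [partSymHom_val, hp, hq']

/-- `Sym(𝕏|𝔹)` as a polynomial ring over `R_B`. -/
def partSymEquiv (N m : ℕ) :
    MvPolynomial (Fin m) (RB N) ≃ₐ[RB N] partSym (Fin m) (Fin N) ℂ :=
  AlgEquiv.ofBijective (partSymHom N m) (partSymHom_bijective N m)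

theorem partSymEquiv_X (N m : ℕ) (i : Fin m) : partSymEquiv N m (X i) =
    symLeft (Fin N) (esymm (Fin m) ℂ (i + 1)) (esymm_isSymmetric _ _ _) := by
  rw [partSymEquiv, AlgEquiv.ofBijective_apply, partSymHom, aeval_X]

theorem algebraMap_partSym_X (N m : ℕ) (k : Fin N) :
    algebraMap (RB N) (partSym (Fin m) (Fin N) ℂ) (X k) =
      symRight (Fin m) (esymm (Fin N) ℂ (k + 1)) (esymm_isSymmetric _ _ _) := by
  change aeval (R := ℂ) _ (X k) = _
  rw [aeval_X]

theorem isCompleteSeq_hDiff (N m : ℕ) :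
    IsCompleteSeq (fun i => partSymEquiv N m (X i))
      (fun k => algebraMap (RB N) (partSym (Fin m) (Fin N) ℂ) (X k)) (hDiff N m) := by
  have hB : ∀ j : ℕ, extSeq (fun k => algebraMap (RB N) (partSym (Fin m) (Fin N) ℂ) (X k)) j =
      symRight (Fin m) (esymm (Fin N) ℂ j) (esymm_isSymmetric _ _ _) := by
    intro j
    apply Subtype.val_injective
    have h1 := map_extSeq (fun k => algebraMap (RB N) (partSym (Fin m) (Fin N) ℂ) (X k))
      (algebraMap (partSym (Fin m) (Fin N) ℂ) (MvPolynomial (Fin m ⊕ Fin N) ℂ)) j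
    have h2 := map_extSeq (fun i : Fin N => esymm (Fin N) ℂ (i + 1))
      (rename Sum.inr : MvPolynomial (Fin N) ℂ →ₐ[ℂ] MvPolynomial (Fin m ⊕ Fin N) ℂ).toRingHom j
    rw [extSeq_esymm] at h2
    refine (h1.trans ?_).trans h2.symm
    simp only [algebraMap_partSym_X]
    rfl
  have hX : altSeries (Q := partSym (Fin m) (Fin N) ℂ)
      (fun i => symLeft (Fin N) (esymm (Fin m) ℂ (i + 1)) (esymm_isSymmetric _ _ _)) *
      PowerSeries.mk (fun k => symLeft (Fin N) (hsymm (Fin m) ℂ k) (hsymm_isSymmetric _ _ _)) =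
        1 :=
    altSeries_mul_eq_one_of_injective
      (algebraMap (partSym (Fin m) (Fin N) ℂ) (MvPolynomial (Fin m ⊕ Fin N) ℂ))
      Subtype.val_injective
      (altSeries_mul_eq_one_map
        (rename Sum.inl : MvPolynomial (Fin m) ℂ →ₐ[ℂ] MvPolynomial (Fin m ⊕ Fin N) ℂ).toRingHom
        (altSeries_esymm_mul m ℂ))
  have h : hDiff N m =
      diffSeq (fun k => algebraMap (RB N) (partSym (Fin m) (Fin N) ℂ) (X k))
        (fun k => symLeft (Fin N) (hsymm (Fin m) ℂ k) (hsymm_isSymmetric _ _ _)) := by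
    funext k
    simp only [hDiff, diffSeq, hB]
  rw [h]
  apply isCompleteSeq_diffSeq
  simp only [partSymEquiv_X]
  exact hX

theorem symLeft_esymm_mem (N m k : ℕ) :
    symLeft (Fin N) (esymm (Fin m) ℂ k) (esymm_isSymmetric _ _ _) ∈ symXBGr N m (2 * k) := by
  have h := esymm_mem (isRingGrading_weightedHomogeneous fun _ : Fin m ⊕ Fin N => (2 : ℤ)) (R := ℂ)
    (fun i => isWeightedHomogeneous_X ℂ _ (Sum.inl i)) k
  change rename Sum.inl (esymm (Fin m) ℂ k) ∈ (weightedHomogeneousSubmodule ℂ _ _).toAddSubgroup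
  rw [← aeval_X_left_apply (rename _ _), aeval_rename]
  exact h

theorem symRight_esymm_mem (N m k : ℕ) :
    symRight (Fin m) (esymm (Fin N) ℂ k) (esymm_isSymmetric _ _ _) ∈ symXBGr N m (2 * k) := by
  have h := esymm_mem (isRingGrading_weightedHomogeneous fun _ : Fin m ⊕ Fin N => (2 : ℤ)) (R := ℂ)
    (fun i => isWeightedHomogeneous_X ℂ _ (Sum.inr i)) k
  change rename Sum.inr (esymm (Fin N) ℂ k) ∈ (weightedHomogeneousSubmodule ℂ _ _).toAddSubgroup
  rw [← aeval_X_left_apply (rename _ _), aeval_rename]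
  exact h

theorem algebraMap_mem_symXBGr (N m : ℕ) (n : ℤ) (r : RB N) (hr : r ∈ RBgr N n) :
    algebraMap (RB N) (partSym (Fin m) (Fin N) ℂ) r ∈ symXBGr N m n := by
  rw [r.as_sum, map_sum]
  refine sum_mem fun d hd => ?_
  have hdeg : Finsupp.weight (fun i : Fin N => 2 * ((i : ℤ) + 1)) d = n :=
    hr (mem_support_iff.1 hd)
  have hC : algebraMap (RB N) (partSym (Fin m) (Fin N) ℂ) (C (coeff d r)) ∈ symXBGr N m 0 := by
    change (aeval (R := ℂ) _ (C (coeff d r)) : partSym (Fin m) (Fin N) ℂ) ∈ _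
    rw [aeval_C]
    exact isWeightedHomogeneous_C _ _
  have hG := isRingGrading_symXBGr N m
  have hprod := hG.prod_mem d.support (d := fun i : Fin N => (d i : ℤ) * (2 * ((i : ℤ) + 1)))
    (x := fun i => algebraMap (RB N) (partSym (Fin m) (Fin N) ℂ) (X i) ^ d i) fun i _ => by
      refine hG.pow_mem ?_ _
      rw [algebraMap_partSym_X]
      exact_mod_cast symRight_esymm_mem N m (i + 1)
  have := hG.mul_mem hC hprod
  rw [monomial_eq, map_mul, Finsupp.prod, map_prod]
  simp only [map_pow]
  convert this using 2
  rw [zero_add, ← hdeg, Finsupp.weight_apply, Finsupp.sum]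
  simp

theorem exists_graded_basis_partSym {m n N : ℕ} (hN : N = n + m) :
    ∃ b : Module.Basis (BoxExp m n × (Fin m →₀ ℕ)) (RB N) (partSym (Fin m) (Fin N) ℂ),
      IsMonomialBasis (fun i : Fin m => hDiff N m (N - i)) b ∧
        IsGradedBasis (RBgr N) (symXBGr N m) b (monomialDegree boxDegree (rowDegree N m)) := by
  refine exists_graded_isMonomialBasis hN (partSymEquiv N m) (c := fun _ => 1)
    (isCompleteSeq_hDiff N m) (fun j => ⟨one_ne_zero, by rw [C_1, map_one, one_mul]⟩)
    (isRingGrading_symXBGr N m) (algebraMap_mem_symXBGr N m) fun i => ?_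
  rw [partSymEquiv_X]
  exact_mod_cast symLeft_esymm_mem N m (i + 1)

end

/-! ## Bases of quotients and tensor products -/

section Quotient

variable {Λ R A Q : Type} [CommRing R] [CommRing A] [Algebra R A] [AddCommGroup Q] [Module R Q]
  {k : ℕ} {a : Fin k → A} {b : Module.Basis (Λ × (Fin k →₀ ℕ)) R A}

/-- Modulo the ideal only the basis elements with `β = 0` survive, since any other one is a multiple
of some `a j`. -/
theorem IsMonomialBasis.sub_basisSection_mem {F : Type} [AddCommGroup F] [Module R F]
    (h : IsMonomialBasis a b) (bF : Module.Basis Λ R F) (x : A) :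
    x - basisSection b bF (basisProj b bF x) ∈ Ideal.span (Set.range a) := by
  have key : ∀ y ∈ Submodule.span R (Set.range b),
      y - basisSection b bF (basisProj b bF y) ∈ Ideal.span (Set.range a) := by
    intro y hy
    induction hy using Submodule.span_induction with
    | mem y hy =>
      obtain ⟨⟨α, β⟩, rfl⟩ := hy
      rw [basisProj_basis]
      by_cases hβ : β = 0
      · rw [if_pos hβ, basisSection_basis, hβ, sub_self]
        exact zero_mem _
      · obtain ⟨j, hj⟩ := Finsupp.ne_iff.1 hβ
        have e : b (α, β) = a j * b (α, β - Finsupp.single j 1) := by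
          rw [h j, tsub_add_cancel_of_le]
          rw [Finsupp.single_le_iff]
          simp only [Finsupp.coe_zero, Pi.zero_apply] at hj
          omega
        rw [if_neg hβ, map_zero, sub_zero, e]
        exact Ideal.mul_mem_right _ _ (Ideal.subset_span ⟨j, rfl⟩)
    | zero => simp
    | add y z _ _ hy hz =>
      rw [map_add, map_add, add_sub_add_comm]
      exact add_mem hy hz
    | smul r y _ hy =>
      rw [map_smul, map_smul, ← smul_sub, Algebra.smul_def]
      exact Ideal.mul_mem_left _ _ hy
  exact key x (by rw [b.span_eq]; trivial)

theorem IsMonomialBasis.basisProj_eq_zero {F : Type} [AddCommGroup F] [Module R F]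
    (h : IsMonomialBasis a b) (bF : Module.Basis Λ R F) {x : A}
    (hx : x ∈ Ideal.span (Set.range a)) :
    basisProj b bF x = 0 := by
  -- The extra factor `y` absorbs the multipliers from `A`, for which `basisProj` is not linear.
  have key : ∀ y, basisProj b bF (x * y) = 0 := by
    induction hx using Submodule.span_induction with
    | mem x hx =>
      obtain ⟨j, rfl⟩ := hx
      exact h.basisProj_mul j
    | zero => simp
    | add x z _ _ hx hz =>
      intro y
      rw [add_mul, map_add, hx, hz, add_zero]
    | smul c x _ hx =>
      intro y
      rw [smul_eq_mul, mul_right_comm, mul_comm, mul_comm c y, hx]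
  simpa using key 1

/-- The quotient of `A` by the ideal generated by the `a j` has the basis `(α, 0)`. -/
theorem IsMonomialBasis.exists_basis_quotient (h : IsMonomialBasis a b) {π : A →ₗ[R] Q}
    (hπ : Function.Surjective π) (hker : ∀ x, π x = 0 ↔ x ∈ Ideal.span (Set.range a)) :
    ∃ bQ : Module.Basis Λ R Q, π = basisProj b bQ := by
  let bF : Module.Basis Λ R (Λ →₀ R) := Finsupp.basisSingleOne
  let p := basisProj b bF
  have hp : Function.Surjective p := fun x => ⟨basisSection b bF x, basisProj_basisSection x⟩
  -- Both kernels are the ideal generated by the `a j`, so `Q` is identified with the free module on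
  -- `Λ`.
  have hk : LinearMap.ker π = LinearMap.ker p := by
    ext x
    rw [LinearMap.mem_ker, LinearMap.mem_ker, hker]
    refine ⟨h.basisProj_eq_zero bF, fun hx => ?_⟩
    have := h.sub_basisSection_mem bF x
    rwa [show basisProj b bF x = 0 from hx, map_zero, sub_zero] at this
  let e : Q ≃ₗ[R] (Λ →₀ R) := (π.quotKerEquivOfSurjective hπ).symm.trans
    ((Submodule.quotEquivOfEq _ _ hk).trans (p.quotKerEquivOfSurjective hp))
  have he : ∀ x, e (π x) = p x := by
    intro x
    have h1 : (π.quotKerEquivOfSurjective hπ).symm (π x) = Submodule.Quotient.mk x := by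
      rw [LinearEquiv.symm_apply_eq]
      rfl
    change p.quotKerEquivOfSurjective hp (Submodule.quotEquivOfEq _ _ hk
      ((π.quotKerEquivOfSurjective hπ).symm (π x))) = p x
    rw [h1]
    rfl
  refine ⟨Module.Basis.ofRepr e, b.ext fun q => e.injective ?_⟩
  obtain ⟨α, β⟩ := q
  rw [he, basisProj_basis, basisProj_basis]
  split_ifs
  · simp [bF]
  · rw [map_zero]

variable {𝒜 : ℤ → AddSubgroup R} {grA : ℤ → AddSubgroup A} {grQ : ℤ → AddSubgroup Q} {δ : Λ → ℤ}
  {da : Fin k → ℤ}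

theorem IsGradedBasis.quotient (hgr : IsGradedBasis 𝒜 grA b (monomialDegree δ da))
    {bQ : Module.Basis Λ R Q}
    (hQ : ∀ n x, x ∈ grQ n ↔ ∃ y ∈ grA n, basisProj b bQ y = x) : IsGradedBasis 𝒜 grQ bQ δ := by
  intro n x
  rw [hQ]
  constructor
  · rintro ⟨y, hy, rfl⟩ α
    rw [repr_basisProj]
    simpa [monomialDegree] using (hgr n y).1 hy (α, 0)
  · intro hx
    refine ⟨basisSection b bQ x, ?_, basisProj_basisSection x⟩
    rw [hgr]
    rintro ⟨α, β⟩
    rw [repr_basisSection]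
    split_ifs with hβ
    · subst hβ
      simpa [monomialDegree] using hx α
    · exact zero_mem _

end Quotient

theorem IsGradedBasis.tensor {Λ R Q : Type} [CommRing R] [AddCommGroup Q] [Module R Q]
    {𝒜 : ℤ → AddSubgroup R} {grQ : ℤ → AddSubgroup Q} {δ : Λ → ℤ} {bQ : Module.Basis Λ R Q}
    (h𝒜 : IsRingGrading 𝒜) (h : IsGradedBasis 𝒜 grQ bQ δ) :
    IsGradedBasis 𝒜 (MatFact.tensorGr 𝒜 grQ) (bQ.map (TensorProduct.lid R Q).symm) δ := by
  intro n x
  have hrepr : ∀ (x : R ⊗[R] Q) i, (bQ.map (TensorProduct.lid R Q).symm).repr x i =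
      bQ.repr (TensorProduct.lid R Q x) i := by
    intro x i
    simp
  simp only [hrepr]
  constructor
  · intro hx
    induction hx using AddSubgroup.closure_induction with
    | mem x hx =>
      obtain ⟨i, j, rfl, r, hr, y, hy, rfl⟩ := hx
      intro l
      rw [TensorProduct.lid_tmul, map_smul, Finsupp.smul_apply, smul_eq_mul, add_sub_assoc]
      exact h𝒜.mul_mem hr ((h j y).1 hy l)
    | zero => simp
    | add x y _ _ hx hy =>
      intro l
      rw [map_add, map_add, Finsupp.add_apply]
      exact add_mem (hx l) (hy l)
    | neg x _ hx =>
      intro l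
      rw [map_neg, map_neg, Finsupp.neg_apply]
      exact neg_mem (hx l)
  · intro hx
    have e : x = ∑ i ∈ (bQ.repr (TensorProduct.lid R Q x)).support,
        bQ.repr (TensorProduct.lid R Q x) i ⊗ₜ[R] bQ i := by
      apply (TensorProduct.lid R Q).injective
      rw [map_sum]
      simp only [TensorProduct.lid_tmul]
      exact (bQ.linearCombination_repr _).symm
    rw [e]
    refine sum_mem fun i _ => AddSubgroup.subset_closure
      ⟨n - δ i, δ i, by ring, _, hx i, _, h.mem_of_one_mem h𝒜.one_mem i, rfl⟩

theorem isGradedFree_of_subsingleton {R M : Type} [CommRing R] [AddCommGroup M] [Module R M]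
    [Subsingleton M] (𝒜 : ℤ → AddSubgroup R) (gr : ℤ → AddSubgroup M) : IsGradedFree 𝒜 gr := by
  refine ⟨Empty, Module.Basis.empty M, fun _ => 0, fun n x => ⟨fun _ i => i.elim, fun _ => ?_⟩⟩
  rw [Subsingleton.elim x 0]
  exact zero_mem _

/-! ## Shifts of factorizations -/

namespace MatFact

variable {R : Type} [CommRing R] {𝒜 : ℤ → AddSubgroup R} {N : ℕ} {w : R}

/-- Exchanging the two halves twice is the identity definitionally, so only the parity of `k`
matters. -/
theorem shiftBy_of_even (M : MatFact R) {k : ℕ} (hk : Even k) : M.shiftBy k = M := by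
  obtain ⟨l, rfl⟩ := hk
  have h : (shift^[2] : MatFact R → MatFact R) = id := rfl
  rw [shiftBy, ← two_mul, Function.iterate_mul, h, Function.iterate_id, id]

theorem shiftBy_of_odd (M : MatFact R) {k : ℕ} (hk : Odd k) : M.shiftBy k = M.shift := by
  obtain ⟨l, rfl⟩ := hk
  exact shiftBy_of_even M.shift (even_two_mul l)

theorem IsGraded.shift {M : MatFact R} (h : M.IsGraded 𝒜 N w) : M.shift.IsGraded 𝒜 N w :=
  ⟨h.free₁, h.free₀, h.deg_d₁, h.deg_d₀, h.d₀_d₁, h.d₁_d₀⟩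

theorem IsGraded.shiftBy {M : MatFact R} (h : M.IsGraded 𝒜 N w) (k : ℕ) :
    (M.shiftBy k).IsGraded 𝒜 N w := by
  rcases k.even_or_odd with hk | hk
  · rwa [shiftBy_of_even M hk]
  · rw [shiftBy_of_odd M hk]
    exact h.shift

theorem Isomorphic.shift {M M' : MatFact R} (h : Isomorphic M M') :
    Isomorphic M.shift M'.shift := by
  obtain ⟨φ, ψ, h₁, h₂⟩ := h
  refine ⟨⟨φ.f₁, φ.f₀, φ.comm₁, φ.comm₀, φ.deg₁, φ.deg₀⟩,
    ⟨ψ.f₁, ψ.f₀, ψ.comm₁, ψ.comm₀, ψ.deg₁, ψ.deg₀⟩, ?_, ?_⟩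
  · injection h₁ with h₀ h₁
    exact (Hom.mk.injEq ..).mpr ⟨h₁, h₀⟩
  · injection h₂ with h₀ h₁
    exact (Hom.mk.injEq ..).mpr ⟨h₁, h₀⟩

theorem Isomorphic.shiftBy {M M' : MatFact R} (h : Isomorphic M M') (k : ℕ) :
    Isomorphic (M.shiftBy k) (M'.shiftBy k) := by
  rcases k.even_or_odd with hk | hk
  · rwa [shiftBy_of_even M hk, shiftBy_of_even M' hk]
  · rw [shiftBy_of_odd M hk, shiftBy_of_odd M' hk]
    exact h.shift

theorem isGraded_of_subsingleton (T : MatFact R) [Subsingleton T.M₁] {ι : Type}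
    {b : Module.Basis ι R T.M₀} {δ : ι → ℤ} (h : IsGradedBasis 𝒜 T.gr₀ b δ) :
    T.IsGraded 𝒜 N 0 where
  free₀ := h.isGradedFree
  free₁ := isGradedFree_of_subsingleton 𝒜 T.gr₁
  deg_d₀ n x _ := by
    rw [Subsingleton.elim (T.d₀ x) 0]
    exact zero_mem _
  deg_d₁ n x _ := by
    rw [Subsingleton.elim x 0, map_zero]
    exact zero_mem _
  d₁_d₀ x := by rw [Subsingleton.elim (T.d₀ x) 0, map_zero, zero_smul]
  d₀_d₁ x := Subsingleton.elim _ _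

/-- When the odd parts vanish there are no conditions from the differentials, and a
degree-preserving bijection of homogeneous bases suffices. -/
theorem isomorphic_of_subsingleton (T T' : MatFact R) [Subsingleton T.M₁] [Subsingleton T'.M₁]
    {ι ι' : Type} {b : Module.Basis ι R T.M₀} {b' : Module.Basis ι' R T'.M₀} {δ : ι → ℤ}
    {δ' : ι' → ℤ} (h : IsGradedBasis 𝒜 T.gr₀ b δ) (h' : IsGradedBasis 𝒜 T'.gr₀ b' δ') (e : ι ≃ ι')
    (he : ∀ i, δ' (e i) = δ i) : Isomorphic T T' := by
  refine ⟨⟨(b.equiv b' e).toLinearMap, 0, fun x => Subsingleton.elim _ _, fun x => ?_,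
    fun n x hx => ?_, fun n x _ => zero_mem _⟩,
    ⟨(b'.equiv b e.symm).toLinearMap, 0, fun x => Subsingleton.elim _ _, fun x => ?_,
    fun n x hx => ?_, fun n x _ => zero_mem _⟩, ?_, ?_⟩
  · rw [Subsingleton.elim x 0, map_zero, map_zero, map_zero, map_zero]
  · simpa using h.equiv_mem h' e 0 (by simpa using he) n x hx
  · rw [Subsingleton.elim x 0, map_zero, map_zero, map_zero, map_zero]
  · have := h'.equiv_mem h e.symm 0
      (fun i => by rw [← he, Equiv.apply_symm_apply, add_zero]) n x hx
    simpa using this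
  · rw [Hom.comp, Hom.id, Hom.mk.injEq]
    refine ⟨b.ext fun i => ?_, Subsingleton.elim _ _⟩
    simp
  · rw [Hom.comp, Hom.id, Hom.mk.injEq]
    refine ⟨b'.ext fun i => ?_, Subsingleton.elim _ _⟩
    simp

end MatFact

theorem koszul_isGraded {ι R A : Type} [CommRing R] [CommRing A] [Algebra R A] {k N : ℕ}
    {𝒜 : ℤ → AddSubgroup R} {a : Fin k → A} {E : Fin k → A →ₗ[R] A} {grA : ℤ → AddSubgroup A}
    {da : Fin k → ℤ} (hE : Koszul.IsHomogeneousDivision grA da a E) {b : Module.Basis ι R A}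
    {δ : ι → ℤ} (hb : IsGradedBasis 𝒜 grA b δ) :
    (koszul R grA N a (fun _ => 0) da).IsGraded 𝒜 N 0 where
  free₀ := hb.piece N da _
  free₁ := hb.piece N da _
  deg_d₀ n x hx := by
    rw [Koszul.koszul_d₀]
    exact Koszul.diffMap_mem hE hx
  deg_d₁ n x hx := by
    rw [Koszul.koszul_d₁]
    exact Koszul.diffMap_mem hE hx
  d₁_d₀ x := by
    rw [Koszul.koszul_d₀, Koszul.koszul_d₁, zero_smul]
    exact Koszul.diffMap_diffMap (fun s j hs => Koszul.odd_of_even j hs) x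
  d₀_d₁ x := by
    rw [Koszul.koszul_d₀, Koszul.koszul_d₁, zero_smul]
    exact Koszul.diffMap_diffMap (fun s j hs => Koszul.even_of_odd j hs) x

/-- The sum in the degrees of `bQ` is the degree of `1_ε` for the full subset, where the quotient
survives. The parity of that subset is the parity of `k`, hence the shift by `k`. -/
theorem IsMonomialBasis.koszul_homotopyEquivalent {Λ R A : Type} [CommRing R] [CommRing A]
    [Algebra R A] {k N : ℕ} {𝒜 : ℤ → AddSubgroup R} {a : Fin k → A} {grA : ℤ → AddSubgroup A}
    {da : Fin k → ℤ} {δ : Λ → ℤ} {b : Module.Basis (Λ × (Fin k →₀ ℕ)) R A}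
    (hb : IsMonomialBasis a b) (hgr : IsGradedBasis 𝒜 grA b (monomialDegree δ da)) {T : MatFact R}
    [hT : Subsingleton T.M₁] {bQ : Module.Basis Λ R T.M₀}
    (hbQ : IsGradedBasis 𝒜 T.gr₀ bQ (fun α => δ α + ∑ j, ((N : ℤ) + 1 - da j))) :
    MatFact.HomotopyEquivalent N (koszul R grA N a (fun _ => 0) da) (T.shiftBy k) := by
  have hE := hb.isHomogeneousDivision hgr
  have hπ := basisProj_mem hgr hbQ
  have hι := basisSection_mem hgr hbQ
  rcases k.even_or_odd with hk | hk
  · rw [MatFact.shiftBy_of_even _ hk]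
    exact koszul_homotopyEquivalent_of_even hE hk T hb.basisProj_mul basisProj_basisSection
      hb.basisSection_basisProj hπ hι
  · rw [MatFact.shiftBy_of_odd _ hk]
    have : Subsingleton T.shift.M₀ := hT
    exact koszul_homotopyEquivalent_of_odd hE hk T.shift (π := basisProj b bQ)
      (ι := basisSection b bQ) hb.basisProj_mul basisProj_basisSection
      hb.basisSection_basisProj hπ hι

/-! ## The three factorizations -/

/-- The quotient map as a homomorphism of `R_B`-modules. -/
def grassMap (N m : ℕ) : partSym (Fin m) (Fin N) ℂ →ₗ[RB N] GrassRing N m where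
  toFun := GrassRing.mk N m
  map_add' := map_add _
  map_smul' r x := by
    rw [Algebra.smul_def, Algebra.smul_def, map_mul]
    rfl

theorem exists_graded_basis_grassRing {m n N : ℕ} (hN : N = n + m) :
    ∃ bQ : Module.Basis (BoxExp m n) (RB N) (GrassRing N m),
      IsGradedBasis (RBgr N) (grassGr N m) bQ boxDegree := by
  obtain ⟨b, hb, hgr⟩ := exists_graded_basis_partSym hN
  obtain ⟨bQ, hbQ⟩ := hb.exists_basis_quotient (π := grassMap N m)
    Ideal.Quotient.mk_surjective (fun x => Ideal.Quotient.eq_zero_iff_mem)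
  refine ⟨bQ, hgr.quotient fun n x => ?_⟩
  rw [← hbQ]
  rfl

/-- `C_f(∅) ⊗ Sym(𝕏|𝔹)/ℋ {q^(-m(N-m))}`. -/
abbrev grassFact (N m : ℕ) : MatFact (RB N) :=
  ((CfEmpty N).tensorModule (GrassRing N m) (grassGr N m)).qShift (-((m : ℤ) * ((N : ℤ) - m)))

theorem exists_graded_basis_grassFact {m n N : ℕ} (hN : N = n + m) :
    ∃ b : Module.Basis (BoxExp m n) (RB N) (grassFact N m).M₀,
      IsGradedBasis (RBgr N) (grassFact N m).gr₀ b
        (fun α => boxDegree α + -((m : ℤ) * ((N : ℤ) - m))) := by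
  obtain ⟨bQ, hbQ⟩ := exists_graded_basis_grassRing hN
  have h := hbQ.tensor (isRingGrading_RBgr N)
  refine ⟨bQ.map (TensorProduct.lid (RB N) (GrassRing N m)).symm, fun n x => ?_⟩
  refine (h (n - -((m : ℤ) * ((N : ℤ) - m))) x).trans (forall_congr' fun i => ?_)
  have e : n - -((m : ℤ) * ((N : ℤ) - m)) - boxDegree i =
    n - (boxDegree i + -((m : ℤ) * ((N : ℤ) - m))) := by ring
  exact iff_of_eq (congrArg (_ ∈ RBgr N ·) e)

instance subsingleton_grassFact (N m : ℕ) : Subsingleton (grassFact N m).M₁ := by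
  change Subsingleton (PUnit ⊗[RB N] GrassRing N m)
  infer_instance

instance subsingleton_qSum (N m : ℕ) : Subsingleton ((CfEmpty N).qSum (qBinom N m)).M₁ := by
  change Subsingleton (((k : ℤ) × Fin ((qBinom N m).coeff k)) →₀ PUnit)
  infer_instance

theorem exists_graded_basis_qSum (N m : ℕ) :
    ∃ b : Module.Basis ((k : ℤ) × Fin ((qBinom N m).coeff k)) (RB N)
      ((CfEmpty N).qSum (qBinom N m)).M₀,
      IsGradedBasis (RBgr N) ((CfEmpty N).qSum (qBinom N m)).gr₀ b Sigma.fst :=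
  ⟨Finsupp.basisSingleOne, fun _ _ => Iff.rfl⟩

theorem grassFact_isGraded {N m : ℕ} (hm : m ≤ N) : (grassFact N m).IsGraded (RBgr N) N 0 := by
  obtain ⟨n, rfl⟩ := Nat.exists_eq_add_of_le' hm
  obtain ⟨b, hb⟩ := exists_graded_basis_grassFact (rfl : n + m = n + m)
  exact MatFact.isGraded_of_subsingleton _ hb

theorem qSum_isGraded (N m : ℕ) :
    ((CfEmpty N).qSum (qBinom N m)).IsGraded (RBgr N) N 0 := by
  obtain ⟨b, hb⟩ := exists_graded_basis_qSum N m
  exact MatFact.isGraded_of_subsingleton _ hb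

theorem grassFact_isomorphic_qSum {N m : ℕ} (hm : m ≤ N) :
    MatFact.Isomorphic (grassFact N m) ((CfEmpty N).qSum (qBinom N m)) := by
  obtain ⟨n, rfl⟩ := Nat.exists_eq_add_of_le' hm
  obtain ⟨b, hb⟩ := exists_graded_basis_grassFact (rfl : n + m = n + m)
  obtain ⟨b', hb'⟩ := exists_graded_basis_qSum (n + m) m
  obtain ⟨e, he⟩ := exists_qBinom_equiv n m
  refine MatFact.isomorphic_of_subsingleton _ _ hb hb' e fun α => ?_
  rw [he, boxDegree]
  push_cast
  ring

/-- The degree of the summand of the full subset. This is the source of the factor `q^(-m(N-m))`. -/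
theorem sum_rowDegree (N m : ℕ) :
    ∑ j, ((N : ℤ) + 1 - rowDegree N m j) = -((m : ℤ) * ((N : ℤ) - m)) := by
  have h : ∑ j : Fin m, ((j : ℕ) : ℤ) * 2 = m * (m - 1) := by
    rw [Fin.sum_univ_eq_sum_range fun i => (i : ℤ) * 2]
    induction m with
    | zero => simp
    | succ m ih =>
      rw [Finset.sum_range_succ, ih]
      push_cast
      ring
  have h' : ∀ j : Fin m, (N : ℤ) + 1 - rowDegree N m j = ((j : ℕ) : ℤ) * 2 + (1 - N) := by
    intro j
    rw [rowDegree]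
    ring
  simp only [h', Finset.sum_add_distrib, h]
  simp
  ring

section Circle

variable {N m : ℕ} {c : Fin m → ℂ}
  {t : Fin m → MvPolynomial.symmetricSubalgebra (Fin m) (RB N)}

theorem koszul_isGraded_of_eq (hm : m ≤ N) (ht : ∀ j : Fin m, c j ≠ 0 ∧
      t j = algebraMap (RB N) (MvPolynomial.symmetricSubalgebra (Fin m) (RB N))
        (MvPolynomial.C (c j)) * symDiffSeq m (R := RB N) MvPolynomial.X (N - j)) :
    (koszul (RB N) (symGr N m) N t (fun _ => 0) (rowDegree N m)).IsGraded (RBgr N) N 0 := by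
  obtain ⟨n, hN⟩ := Nat.exists_eq_add_of_le' hm
  obtain ⟨b, hb, hgr⟩ := exists_graded_basis_symmetricSubalgebra hN ht
  exact koszul_isGraded (hb.isHomogeneousDivision hgr) hgr

theorem koszul_homotopyEquivalent_grassFact (hm : m ≤ N) (ht : ∀ j : Fin m, c j ≠ 0 ∧
      t j = algebraMap (RB N) (MvPolynomial.symmetricSubalgebra (Fin m) (RB N))
        (MvPolynomial.C (c j)) * symDiffSeq m (R := RB N) MvPolynomial.X (N - j)) :
    MatFact.HomotopyEquivalent N
      (koszul (RB N) (symGr N m) N t (fun _ => 0) (rowDegree N m)) ((grassFact N m).shiftBy m) := by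
  obtain ⟨n, hN⟩ := Nat.exists_eq_add_of_le' hm
  obtain ⟨b, hb, hgr⟩ := exists_graded_basis_symmetricSubalgebra hN ht
  obtain ⟨bQ, hbQ⟩ := exists_graded_basis_grassFact hN
  rw [← sum_rowDegree] at hbQ
  exact hb.koszul_homotopyEquivalent hgr hbQ

end Circle

section

open MvPolynomial

/-! ## Existence of the first entries of the rows -/

theorem rename_mem_totalGr {σ τ : Type} {N : ℕ} (f : σ → τ) {n : ℤ} {p : MvPolynomial σ (RB N)}
    (hp : p ∈ totalGr σ N n) : rename f p ∈ totalGr τ N n := by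
  rw [p.as_sum, map_sum]
  refine sum_mem fun d _ => ?_
  have hG := isRingGrading_totalGr τ N
  have hprod := hG.prod_mem d.support (d := fun i => (d i : ℤ) * 2)
    (x := fun i => (X (f i) : MvPolynomial τ (RB N)) ^ d i)
    fun i _ => hG.pow_mem (X_mem_totalGr (f i)) _
  have := hG.mul_mem (C_mem_totalGr (hp d)) hprod
  rw [monomial_eq, map_mul, Finsupp.prod, map_prod]
  simp only [map_pow, rename_X, rename_C]
  convert this using 2
  rw [Finsupp.degree_apply, ← Finset.sum_mul]
  push_cast
  ring

/-- `p` is symmetric, homogeneous of degree `d`, and `p(𝕏) - p(𝕐)` is a combination of the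
differences `X_j - Y_j` with homogeneous coefficients. -/
structure HasArc (N m : ℕ) (d : ℤ) (p : MvPolynomial (Fin m) (RB N)) : Prop where
  isSymmetric : p.IsSymmetric
  mem : p ∈ totalGr (Fin m) N d
  exists_coeff : ∃ V : Fin m → MvPolynomial (Fin m ⊕ Fin m) (RB N),
    (∀ j, V j ∈ partSym (Fin m) (Fin m) (RB N)) ∧
    (∀ j : Fin m, V j ∈ totalGr (Fin m ⊕ Fin m) N (d - 2 * ((j : ℤ) + 1))) ∧
    ∑ j : Fin m, V j * (rename Sum.inl (esymm (Fin m) (RB N) (j + 1)) -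
      rename Sum.inr (esymm (Fin m) (RB N) (j + 1))) = rename Sum.inl p - rename Sum.inr p

namespace HasArc

variable {N m : ℕ} {d d' : ℤ} {p q : MvPolynomial (Fin m) (RB N)}

theorem zero : HasArc N m d 0 :=
  ⟨fun e => map_zero _, zero_mem _, fun _ => 0, fun _ => zero_mem _, fun _ => zero_mem _, by simp⟩

theorem add (hp : HasArc N m d p) (hq : HasArc N m d q) : HasArc N m d (p + q) := by
  obtain ⟨hp1, hp2, V, hV1, hV2, hV3⟩ := hp
  obtain ⟨hq1, hq2, W, hW1, hW2, hW3⟩ := hq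
  refine ⟨hp1.add hq1, add_mem hp2 hq2, fun j => V j + W j, fun j => add_mem (hV1 j) (hW1 j),
    fun j => add_mem (hV2 j) (hW2 j), ?_⟩
  simp only [add_mul, Finset.sum_add_distrib, hV3, hW3, map_add]
  ring

theorem sum {ι : Type} (s : Finset ι) {p : ι → MvPolynomial (Fin m) (RB N)}
    (h : ∀ i ∈ s, HasArc N m d (p i)) : HasArc N m d (∑ i ∈ s, p i) := by
  classical
  induction s using Finset.induction_on with
  | empty => exact zero
  | insert a s ha ih =>
    rw [Finset.sum_insert ha]
    exact (h a (Finset.mem_insert_self a s)).add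
      (ih fun i hi => h i (Finset.mem_insert_of_mem hi))

theorem C {r : RB N} (hr : r ∈ RBgr N d) : HasArc N m d (C r) :=
  ⟨IsSymmetric.C r, C_mem_totalGr hr, fun _ => 0, fun _ => zero_mem _, fun _ => zero_mem _, by
    simp⟩

theorem mul (hp : HasArc N m d p) (hq : HasArc N m d' q) : HasArc N m (d + d') (p * q) := by
  obtain ⟨hp1, hp2, V, hV1, hV2, hV3⟩ := hp
  obtain ⟨hq1, hq2, W, hW1, hW2, hW3⟩ := hq
  have hG := isRingGrading_totalGr (Fin m ⊕ Fin m) N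
  refine ⟨hp1.mul hq1, (isRingGrading_totalGr (Fin m) N).mul_mem hp2 hq2,
    -- From `p(𝕏)q(𝕏) - p(𝕐)q(𝕐) = p(𝕏)(q(𝕏) - q(𝕐)) + q(𝕐)(p(𝕏) - p(𝕐))`.
    fun j => rename Sum.inl p * W j + rename Sum.inr q * V j,
    fun j => add_mem (mul_mem (symLeft (Fin m) p hp1).2 (hW1 j))
      (mul_mem (symRight (Fin m) q hq1).2 (hV1 j)), fun j => add_mem ?_ ?_, ?_⟩
  · convert hG.mul_mem (rename_mem_totalGr Sum.inl hp2) (hW2 j) using 2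
    ring
  · convert hG.mul_mem (rename_mem_totalGr Sum.inr hq2) (hV2 j) using 2
    ring
  · simp only [add_mul, Finset.sum_add_distrib, mul_assoc, ← Finset.mul_sum, hV3, hW3, map_mul]
    ring

theorem C_mul {r : RB N} (hr : r ∈ RBgr N d') (hp : HasArc N m d p) :
    HasArc N m (d' + d) (MvPolynomial.C r * p) :=
  (C hr).mul hp

theorem intCast_mul (c : ℤ) (hp : HasArc N m d p) : HasArc N m d (c * p) := by
  have := C_mul (C_mem_RBgr (c : ℂ)) hp
  rw [zero_add] at this
  simpa using this

theorem neg (hp : HasArc N m d p) : HasArc N m d (-p) := by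
  have e : ((-1 : ℤ) : MvPolynomial (Fin m) (RB N)) * p = -p := by
    push_cast
    ring
  exact e ▸ hp.intCast_mul (-1)

theorem esymm (k : ℕ) : HasArc N m (2 * ((k : ℤ) + 1)) (esymm (Fin m) (RB N) (k + 1)) := by
  refine ⟨esymm_isSymmetric _ _ _, by exact_mod_cast esymm_mem_totalGr (k + 1), ?_⟩
  by_cases hk : k < m
  · refine ⟨Pi.single ⟨k, hk⟩ 1, fun j => ?_, fun j => ?_, ?_⟩
    · rw [Pi.single_apply]
      split_ifs
      · exact one_mem _
      · exact zero_mem _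
    · rw [Pi.single_apply]
      split_ifs with h
      · subst h
        simpa using (isRingGrading_totalGr (Fin m ⊕ Fin m) N).one_mem
      · exact zero_mem _
    · rw [Finset.sum_eq_single ⟨k, hk⟩]
      · simp
      · intro j _ hj
        rw [Pi.single_eq_of_ne hj, zero_mul]
      · simp
  · refine ⟨fun _ => 0, fun _ => zero_mem _, fun _ => zero_mem _, ?_⟩
    rw [MvPolynomial.esymm, Finset.powersetCard_eq_empty.2 (by simp; omega)]
    simp

/-- Newton's identity expresses a power sum by elementary symmetric polynomials and lower power
sums. -/
theorem psum (k : ℕ) : HasArc N m (2 * ((k : ℤ) + 1)) (psum (Fin m) (RB N) (k + 1)) := by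
  induction k using Nat.strong_induction_on with
  | _ k ih =>
  rw [psum_eq_mul_esymm_sub_sum _ _ _ (Nat.succ_pos k), sub_eq_add_neg]
  refine add ?_ (neg (sum _ fun a ha => ?_))
  · simpa using (esymm k).intCast_mul ((-1) ^ (k + 1 + 1) * (k + 1))
  · rw [Finset.mem_filter, Finset.HasAntidiagonal.mem_antidiagonal] at ha
    obtain ⟨h1, h2, h3⟩ := ha
    obtain ⟨i, hi⟩ : ∃ i, a.1 = i + 1 := ⟨a.1 - 1, by omega⟩
    obtain ⟨j, hj⟩ : ∃ j, a.2 = j + 1 := ⟨a.2 - 1, by omega⟩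
    have := ((esymm i).mul (ih j (by omega))).intCast_mul ((-1) ^ a.1)
    rw [hi, hj, mul_assoc]
    have e : 2 * ((i : ℤ) + 1) + 2 * ((j : ℤ) + 1) = 2 * ((k : ℤ) + 1) := by omega
    rw [e] at this
    simpa [hi] using this

theorem potential : HasArc N m (2 * (N : ℤ) + 2) (potential (Fin m) N) := by
  refine add ?_ (sum _ fun i _ => ?_)
  · have := psum (N := N) (m := m) N
    rwa [mul_add, mul_one] at this
  · have h := (isRingGrading_RBgr N).mul_mem
      (C_mem_RBgr ((-1 : ℂ) ^ ((i : ℕ) + 1) * (((N : ℂ) + 1) / ((N : ℂ) - i)))) (X_mem_RBgr i)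
    have := C_mul h (psum (N := N) (m := m) (N - i - 1))
    have e1 : N - (i : ℕ) - 1 + 1 = N - i := by omega
    have e2 : 0 + 2 * (((i : ℕ) : ℤ) + 1) + 2 * (((N - i - 1 : ℕ) : ℤ) + 1) =
      2 * (N : ℤ) + 2 := by omega
    rwa [e1, e2] at this

end HasArc

theorem exists_isArcChoice (N m : ℕ) :
    ∃ U : Fin m → partSym (Fin m) (Fin m) (RB N), IsArcChoice N m U := by
  obtain ⟨-, -, V, hV1, hV2, hV3⟩ := HasArc.potential (N := N) (m := m)
  refine ⟨fun j => ⟨V j, hV1 j⟩, hV2, ?_⟩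
  rw [← hV3, AddSubmonoidClass.coe_finsetSum]
  rfl

end

section

open MvPolynomial

/-! ## The first entries of the rows after gluing -/

/-! ### The Jacobian system for the glued coefficients -/

section Nonsingular

variable {m : ℕ} {R : Type} [CommRing R]

theorem prod_X_add_eq_sum_esymmOn {σ : Type} (s : Finset σ) (y : MvPolynomial σ R) :
    ∏ i ∈ s, (X i + y) = ∑ j ∈ Finset.range (s.card + 1), esymmOn R s j * y ^ (s.card - j) := by
  classical
  rw [Finset.prod_add, Finset.sum_powerset]
  refine Finset.sum_congr rfl fun j _ => ?_
  rw [esymmOn, Finset.sum_mul]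
  refine Finset.sum_congr rfl fun t ht => ?_
  obtain ⟨h1, h2⟩ := Finset.mem_powersetCard.1 ht
  rw [Finset.prod_const, Finset.card_sdiff_of_subset h1, h2]

theorem esymmOn_eq_zero {σ : Type} {s : Finset σ} {k : ℕ} (hk : s.card < k) :
    esymmOn R s k = 0 := by
  rw [esymmOn, Finset.powersetCard_eq_empty.2 hk, Finset.sum_empty]

/-- The Jacobian of the elementary symmetric polynomials is nonsingular. -/
theorem eq_zero_of_sum_mul_esymmOn_erase [IsDomain R] {D : Fin m → MvPolynomial (Fin m) R}
    (h : ∀ κ, ∑ j : Fin m, D j * esymmOn R (Finset.univ.erase κ) j = 0) : D = 0 := by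
  let E : Matrix (Fin m) (Fin m) (MvPolynomial (Fin m) R) :=
    Matrix.of fun κ j => esymmOn R (Finset.univ.erase κ) j
  let F : Matrix (Fin m) (Fin m) (MvPolynomial (Fin m) R) :=
    Matrix.of fun j l => (-X l) ^ (m - 1 - (j : ℕ))
  -- Row `κ` of `E` lists the coefficients of `∏_{i ≠ κ} (x_i + y)`, and column `l` of `F` evaluates
  -- it at `y = -x_l`. The value is zero unless `l = κ`.
  have hEF : E * F = Matrix.diagonal fun κ => ∏ i ∈ Finset.univ.erase κ, (X i + -X κ) := by
    ext1 κ l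
    have hcard : (Finset.univ.erase κ : Finset (Fin m)).card + 1 = m := by
      rw [Finset.card_erase_add_one (Finset.mem_univ κ), Finset.card_fin]
    have e : (E * F) κ l = ∏ i ∈ Finset.univ.erase κ, (X i + -X l : MvPolynomial (Fin m) R) := by
      rw [prod_X_add_eq_sum_esymmOn, hcard, ← Fin.sum_univ_eq_sum_range
        (fun j => esymmOn R (Finset.univ.erase κ) j *
          (-X l) ^ ((Finset.univ.erase κ : Finset (Fin m)).card - j)) m, Matrix.mul_apply]
      refine Finset.sum_congr rfl fun j _ => ?_
      simp only [E, F, Matrix.of_apply]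
      rw [show m - 1 - (j : ℕ) = (Finset.univ.erase κ : Finset (Fin m)).card - j by omega]
    rw [e]
    by_cases hκ : κ = l
    · rw [hκ, Matrix.diagonal_apply_eq]
    · rw [Matrix.diagonal_apply_ne _ hκ]
      refine Finset.prod_eq_zero (Finset.mem_erase.2 ⟨Ne.symm hκ, Finset.mem_univ l⟩) ?_
      rw [add_neg_cancel]
  -- The determinant of `E F` is a product of differences of distinct variables, nonzero in a
  -- domain.
  have hdet : E.det ≠ 0 := by
    intro h0
    have := congrArg Matrix.det hEF
    rw [Matrix.det_mul, h0, zero_mul, Matrix.det_diagonal] at this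
    refine Finset.prod_ne_zero_iff.2 (fun κ _ => Finset.prod_ne_zero_iff.2 fun i hi => ?_)
      this.symm
    rw [← sub_eq_add_neg, sub_ne_zero]
    exact fun hX => (Finset.mem_erase.1 hi).1 (X_injective hX)
  refine Matrix.eq_zero_of_mulVec_eq_zero hdet (funext fun κ => ?_)
  rw [Pi.zero_apply, ← h κ, Matrix.mulVec, dotProduct]
  exact Finset.sum_congr rfl fun j _ => mul_comm _ _

/-- The polynomial `∑ (-1)^j B_j x^(N-j)` in terms of the `h_k(𝕏 - 𝔹)`. -/
theorem sum_diffSeq_mul_esymmOn_erase {N : ℕ} (hm : m ≤ N) (B : Fin N → R) (κ : Fin m) :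
    ∑ j : Fin m, (-1) ^ (j : ℕ) * diffSeq (fun l => (C (B l) : MvPolynomial (Fin m) R))
      (fun k => hsymm (Fin m) R k) (N - j) * esymmOn R (Finset.univ.erase κ) j =
    diffSeq (fun l => (C (B l) : MvPolynomial (Fin m) R)) (fun k => X κ ^ k) N := by
  -- The claim is the coefficient of `T^N` in the identity `mk_hsymm_mul_prod_erase` multiplied by
  -- `∏ (1 - bT)`, written as the series of the `B_k`.
  have h := congrArg (fun s => altSeries (fun l => (C (B l) : MvPolynomial (Fin m) R)) * s)
    (mk_hsymm_mul_prod_erase (R := R) κ)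
  simp only [← mul_assoc, ← mk_diffSeq] at h
  have hN := congrArg (PowerSeries.coeff N) h
  rw [PowerSeries.coeff_mk, mul_comm, prod_linFactor, PowerSeries.coeff_mul,
    Finset.Nat.sum_antidiagonal_eq_sum_range_succ_mk] at hN
  simp only [PowerSeries.coeff_mk] at hN
  rw [← hN, Fin.sum_univ_eq_sum_range (fun j => (-1) ^ j *
    diffSeq (fun l => (C (B l) : MvPolynomial (Fin m) R)) (fun k => hsymm (Fin m) R k) (N - j) *
      esymmOn R (Finset.univ.erase κ) j) m]
  -- The convolution runs up to `N`, but the elementary symmetric polynomials in the remaining `m -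
  -- 1` variables vanish from degree `m` on. The range `m` fits into `N + 1` because `m ≤ N`.
  refine (Finset.sum_subset (Finset.range_mono (by omega)) fun j _ hj => ?_).trans
    (Finset.sum_congr rfl fun j _ => by ring)
  rw [esymmOn_eq_zero, mul_zero]
  have hcard : (Finset.univ.erase κ : Finset (Fin m)).card + 1 = m := by
    rw [Finset.card_erase_add_one (Finset.mem_univ κ), Finset.card_fin]
  rw [Finset.mem_range] at hj
  omega

end Nonsingular

theorem pderiv_inl_rename_inr {σ τ R : Type} [CommRing R] (i : σ) (p : MvPolynomial τ R) :
    pderiv (Sum.inl i) (rename Sum.inr p : MvPolynomial (σ ⊕ τ) R) = 0 := by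
  induction p using MvPolynomial.induction_on with
  | C r => rw [rename_C, pderiv_C]
  | add p q hp hq => rw [map_add, map_add, hp, hq, add_zero]
  | mul_X p j hp =>
    rw [map_mul, Derivation.leibniz, hp, rename_X, pderiv_X_of_ne (by simp)]
    simp

theorem extSeq_C_X (N m : ℕ) (k : ℕ) (hk : k < N) :
    extSeq (fun l : Fin N => (C (X l) : MvPolynomial (Fin m) (RB N))) ((k + 1 : ℕ) : ℤ) =
      C (X ⟨k, hk⟩) := by
  rw [Nat.cast_succ]
  exact extSeq_succ _ ⟨k, hk⟩

/-- The factors `(N+1)/(N+1-k)` in the potential cancel the exponents produced by differentiation,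
leaving the common constant `N + 1` and the polynomial `∑ (-1)^k B_k x^(N-k)`. -/
theorem pderiv_potential (N m : ℕ) (κ : Fin m) :
    pderiv κ (potential (Fin m) N) = C (C ((N : ℂ) + 1)) *
      diffSeq (fun l : Fin N => (C (X l) : MvPolynomial (Fin m) (RB N))) (fun k => X κ ^ k) N := by
  have hsum : ∑ i : Fin N, pderiv κ
      (C (C ((-1 : ℂ) ^ ((i : ℕ) + 1) * (((N : ℂ) + 1) / ((N : ℂ) - i))) * X i) *
        psum (Fin m) (RB N) (N - i)) =
      ∑ i : Fin N, C (C ((N : ℂ) + 1)) * ((-1) ^ ((i : ℕ) + 1) *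
        extSeq (fun l : Fin N => (C (X l) : MvPolynomial (Fin m) (RB N))) (((i : ℕ) + 1 : ℕ) : ℤ) *
        X κ ^ (N - ((i : ℕ) + 1))) := by
    refine Finset.sum_congr rfl fun i _ => ?_
    obtain ⟨i, hi⟩ := i
    -- This removes the truncated subtractions and shows the denominator `N - i = k + 1` to be
    -- nonzero.
    obtain ⟨k, rfl⟩ : ∃ k, N = k + i + 1 := ⟨N - i - 1, by omega⟩
    have e1 : k + i + 1 - i = k + 1 := by omega
    have e2 : k + i + 1 - (i + 1) = k := by omega
    have hC : ((-1 : ℂ) ^ (i + 1) * ((((k + i + 1 : ℕ) : ℂ) + 1) / (((k + i + 1 : ℕ) : ℂ) - i))) *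
        ((k : ℂ) + 1) = (((k + i + 1 : ℕ) : ℂ) + 1) * (-1) ^ (i + 1) := by
      have h0 : ((k : ℂ) + 1) ≠ 0 := by exact_mod_cast Nat.succ_ne_zero k
      have h1 : ((k + i + 1 : ℕ) : ℂ) - i = k + 1 := by
        push_cast
        ring
      rw [h1]
      field_simp
    have hC' := congrArg (fun z => (C (C z) : MvPolynomial (Fin m) (RB (k + i + 1)))) hC
    simp only [map_mul, map_pow, map_neg, map_one, map_add, map_natCast] at hC'
    rw [extSeq_C_X _ _ _ hi, Derivation.leibniz, pderiv_C, smul_zero, add_zero]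
    simp only [e1, e2, pderiv_psum, smul_eq_mul, map_mul, map_pow, map_neg, map_one, map_add,
      map_natCast]
    linear_combination (C (X ⟨i, hi⟩) * X κ ^ k) * hC'
  have h0 : ((N : MvPolynomial (Fin m) (RB N)) + 1) * X κ ^ N = C (C ((N : ℂ) + 1)) *
      ((-1) ^ 0 * extSeq (fun l : Fin N => (C (X l) : MvPolynomial (Fin m) (RB N))) ((0 : ℕ) : ℤ) *
        X κ ^ (N - 0)) := by
    simp [extSeq_zero]
  rw [potential, map_add, map_sum, pderiv_psum, hsum, h0, diffSeq, Finset.sum_range_succ',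
    ← Finset.mul_sum, ← mul_add, Fin.sum_univ_eq_sum_range (fun j => (-1) ^ (j + 1) *
      extSeq (fun l : Fin N => (C (X l) : MvPolynomial (Fin m) (RB N))) ((j + 1 : ℕ) : ℤ) *
        X κ ^ (N - (j + 1))) N]
  exact congrArg _ (add_comm _ _)

theorem symDiffSeq_val {N : ℕ} (m : ℕ) {R : Type} [CommRing R] (B : Fin N → R) (k : ℕ) :
    (symDiffSeq m B k).1 = diffSeq (fun l => (C (B l) : MvPolynomial (Fin m) R))
      (fun k => hsymm (Fin m) R k) k :=
  map_diffSeq (algebraMap (symmetricSubalgebra (Fin m) R) (MvPolynomial (Fin m) R)) _ _ k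

theorem glue_arcDiff (N m : ℕ) (j : Fin m) : glue N m (arcDiff N m j) = 0 := by
  rw [arcDiff, map_sub, sub_eq_zero]
  apply Subtype.ext
  change rename (Sum.elim id id) (rename Sum.inl _) = rename (Sum.elim id id) (rename Sum.inr _)
  rw [rename_rename, rename_rename, Sum.elim_comp_inl, Sum.elim_comp_inr]

/-- The defining identity of the `U_j` is differentiated with respect to `x_κ` and then `𝕐 = 𝕏` is
set. The terms with derivatives of `U_j` carry a factor `X_j - Y_j` and disappear. -/
theorem sum_glue_mul_esymmOn_erase {N m : ℕ} {U : Fin m → partSym (Fin m) (Fin m) (RB N)}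
    (hU : IsArcChoice N m U) (κ : Fin m) :
    ∑ j : Fin m, (glue N m (U j)).1 * esymmOn (RB N) (Finset.univ.erase κ) j =
      pderiv κ (potential (Fin m) N) := by
  have h := congrArg (fun p => rename (Sum.elim id id) (pderiv (Sum.inl κ) p)) hU.sum_eq
  simp only [map_sub, pderiv_inl_rename_inr, sub_zero,
    pderiv_rename Sum.inl_injective, rename_rename, Sum.elim_comp_inl, rename_id_apply] at h
  rw [← h, AddSubmonoidClass.coe_finsetSum, map_sum, map_sum]
  refine Finset.sum_congr rfl fun j _ => ?_
  have hd : rename (Sum.elim id id) (arcDiff N m j).1 = 0 :=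
    congrArg Subtype.val (glue_arcDiff N m j)
  have hp : rename (Sum.elim id id) (pderiv (Sum.inl κ) (arcDiff N m j).1) =
      esymmOn (RB N) (Finset.univ.erase κ) j := by
    change rename (Sum.elim id id) (pderiv (Sum.inl κ)
      (rename Sum.inl (esymm (Fin m) (RB N) (j + 1)) -
        rename Sum.inr (esymm (Fin m) (RB N) (j + 1)))) = _
    rw [map_sub, pderiv_inl_rename_inr, sub_zero, pderiv_rename Sum.inl_injective, rename_rename,
      Sum.elim_comp_inl, rename_id_apply, pderiv_esymm_succ]
  rw [Subalgebra.coe_mul, Derivation.leibniz, map_add, smul_eq_mul, smul_eq_mul, map_mul, map_mul,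
    hd, hp, zero_mul, add_zero]
  rfl

/-- Both sides solve the same linear system with the nonsingular Jacobian matrix, so the outcome
does not depend on the choice of `U`. -/
theorem glue_arcChoice {N m : ℕ} (hm : m ≤ N) {U : Fin m → partSym (Fin m) (Fin m) (RB N)}
    (hU : IsArcChoice N m U) (j : Fin m) :
    glue N m (U j) = algebraMap (RB N) (symmetricSubalgebra (Fin m) (RB N))
      (C (((N : ℂ) + 1) * (-1) ^ (j : ℕ))) * symDiffSeq m (R := RB N) X (N - j) := by
  have h := eq_zero_of_sum_mul_esymmOn_erase (R := RB N)
    (D := fun j : Fin m => (glue N m (U j)).1 - C (C ((N : ℂ) + 1)) * ((-1) ^ (j : ℕ) *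
      diffSeq (fun l => (C (X l) : MvPolynomial (Fin m) (RB N)))
        (fun k => hsymm (Fin m) (RB N) k) (N - j))) (by
      intro κ
      simp only [sub_mul, Finset.sum_sub_distrib, mul_assoc]
      rw [sum_glue_mul_esymmOn_erase hU, ← Finset.mul_sum, pderiv_potential,
        ← sum_diffSeq_mul_esymmOn_erase hm]
      simp only [mul_assoc, sub_self])
  have hj := sub_eq_zero.1 (congrFun h j)
  apply Subtype.ext
  rw [hj, Subalgebra.coe_mul, symDiffSeq_val, ← mul_assoc]
  congr 1
  change _ = C (C _)
  rw [C_mul, C_mul, map_pow, map_pow, map_neg, map_neg, map_one, map_one]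

theorem CfCircle_eq (N m : ℕ) (U : Fin m → partSym (Fin m) (Fin m) (RB N)) :
    CfCircle N m U = koszul (RB N) (symGr N m) N (fun j => glue N m (U j)) (fun _ => 0)
      (rowDegree N m) := by
  rw [CfCircle, funext (glue_arcDiff N m)]
  rfl

end

end

/-! ### The circle: the statements combined -/

theorem proposition3 (N m : ℕ) (hN : 2 ≤ N) (hm : m ≤ N) :
    (∃ U : Fin m → partSym (Fin m) (Fin m) (RB N), IsArcChoice N m U) ∧
    ∀ U : Fin m → partSym (Fin m) (Fin m) (RB N), IsArcChoice N m U →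
      (CfCircle N m U).IsGraded (RBgr N) N 0 ∧
      ((((CfEmpty N).tensorModule (GrassRing N m) (grassGr N m)).qShift
        (-((m : ℤ) * ((N : ℤ) - m)))).shiftBy m).IsGraded (RBgr N) N 0 ∧
      (((CfEmpty N).qSum (qBinom N m)).shiftBy m).IsGraded (RBgr N) N 0 ∧
      MatFact.HomotopyEquivalent N (CfCircle N m U)
        ((((CfEmpty N).tensorModule (GrassRing N m) (grassGr N m)).qShift
          (-((m : ℤ) * ((N : ℤ) - m)))).shiftBy m) ∧
      MatFact.Isomorphic
        ((((CfEmpty N).tensorModule (GrassRing N m) (grassGr N m)).qShift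
          (-((m : ℤ) * ((N : ℤ) - m)))).shiftBy m)
        (((CfEmpty N).qSum (qBinom N m)).shiftBy m) := by
  refine ⟨exists_isArcChoice N m, fun U hU => ?_⟩
  -- The constants `(N + 1) (-1)^j` are nonzero, so the rows generate the same ideal as the
  -- `h_(N-j)(𝕏 - 𝔹)` and the basis theorem applies to them.
  have ht : ∀ j : Fin m, ((N : ℂ) + 1) * (-1) ^ (j : ℕ) ≠ 0 ∧
      glue N m (U j) = algebraMap (RB N) (MvPolynomial.symmetricSubalgebra (Fin m) (RB N))
        (MvPolynomial.C (((N : ℂ) + 1) * (-1) ^ (j : ℕ))) *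
          symDiffSeq m (R := RB N) MvPolynomial.X (N - j) := fun j =>
    ⟨mul_ne_zero (by exact_mod_cast Nat.succ_ne_zero N) (pow_ne_zero _ (by norm_num)),
      glue_arcChoice hm hU j⟩
  rw [CfCircle_eq]
  exact ⟨koszul_isGraded_of_eq hm ht, (grassFact_isGraded hm).shiftBy m,
    (qSum_isGraded N m).shiftBy m, koszul_homotopyEquivalent_grassFact hm ht,
    (grassFact_isomorphic_qSum hm).shiftBy m⟩
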